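/- For a read-cost function $f:\{1,2,\dots\}\to[0,\infty]$, an instance of $\mathrm{BMC}_f$ is a sequence $I=\langle(\ell_t,r_t)\rangle_{t=1}^n$ of pairs of non-negative reals. One maintains a stack of lengths, initially empty. At time $t$ the length $\ell_t$ is put on top of the stack; then a contiguous block of lengths at the top of the stack, containing the new one, is replaced by its sum $L_t$ (a compaction). If $k_t$ is the resulting stack size, the cost of the sequence of compactions is $\sum_{t=1}^n (L_t+r_t f(k_t))$, and $\mathrm{OPT}(I)$ is the minimum cost over all such sequences. An algorithm is online if its choice at time $t$ depends only on $(\ell_1,r_1),\dots,(\ell_t,r_t)$ (in particular, it knows neither $n$ nor the distribution of the input); $A(I)$ denotes the cost of $A$ on $I$. For an integer $K\ge 1$, $\mathrm{BMC}_{\le K}$ is the case $f(k)=0$ for $k\le K$ and $f(k)=\infty$ for $k>K$, where $\infty$ means that such stack sizes are forbidden (even if $r_t=0$). LINEAR BMC is the case $f(k)=k$. Write $X\sim Y$ if $X=(1\pm o(1))Y$ as $n\to\infty$. **Theorem.** (i) For every integer $K\ge1$ there is an online algorithm $A$ for $\mathrm{BMC}_{\le K}$ such that the following holds for every bounded probability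 distribution on $[0,\infty)\times[0,\infty)$: if $I$ is a sequence of $n$ i.i.d. pairs $(\ell_t,r_t)$ from this distribution and $\bar\ell=\mathrm{E}[\ell_t]$, then $$\mathrm{E}[A(I)]\sim \mathrm{E}[\mathrm{OPT}(I)]\sim \bar\ell\,K\,n^{1+1/K}/c_K,\qquad c_K=\frac{K+1}{(K!)^{1/K}}.$$ Moreover $c_K\to e$ as $K\to\infty$. (ii) There is an online algorithm $B$ for LINEAR BMC such that for every bounded probability distribution on $[0,\infty)\times[0,\infty)$, if $I$ is a sequence of $n$ i.i.d. pairs from it, then $\mathrm{E}[B(I)]\sim\mathrm{E}[\mathrm{OPT}(I)]$. If moreover the means $\bar\ell=\mathrm{E}[\ell_t]$ and $\bar r=\mathrm{E}[r_t]$ are both positive, then $$\mathrm{E}[\mathrm{OPT}(I)]\sim \beta\, n\log_2 n,$$ where $\beta>0$ is the unique solution of $2^{-\bar\ell/\beta}+2^{-\bar r/\beta}=1$, and $\beta=\Theta\big((\bar\ell+\bar r)/\ln(1+\max(\bar\ell/\bar r,\bar r/\bar\ell))\big)$ with absolute constants. -/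

import Mathlib

open MeasureTheory Filter Topology Asymptotics
open scoped NNReal ENNReal Nat

namespace BMC

/-- A request `(ℓ, r)`: the length `ℓ` of the newly inserted file and the read rate `r`. -/
abbrev Request := ℝ≥0 × ℝ≥0

/-- The length of the file produced by merging a new file of length `x` with the `m` topmost
files of the stack `s` (top of the stack first; all files of `s` if it holds fewer than `m`). -/
def mergedLength (m : ℕ) (x : ℝ≥0) (s : List ℝ≥0) : ℝ≥0 := x + (s.take m).sum

/-- The stack after a file of length `x` is put on top of `s` and merged with the `m` files
below it. -/
def compact (m : ℕ) (x : ℝ≥0) (s : List ℝ≥0) : List ℝ≥0 := mergedLength m x s :: s.drop m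

/-- A schedule for `n` requests: for each time, the number of old files, counted from the top of
the stack, that are merged with the new file. (A number exceeding the stack size means that all
files are merged.) -/
abbrev Schedule (n : ℕ) := Fin n → ℕ

/-- The stack of lengths (top first) after the first `t` requests of `I` have been served
according to `σ`. -/
def stack {n : ℕ} (I : Fin n → Request) (σ : Schedule n) : ℕ → List ℝ≥0
  | 0 => []
  | t + 1 => if h : t < n then compact (σ ⟨t, h⟩) (I ⟨t, h⟩).1 (stack I σ t) else stack I σ t

/-- The merge cost `L_t`. -/
def mergeCost {n : ℕ} (I : Fin n → Request) (σ : Schedule n) (t : Fin n) : ℝ≥0 :=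
  mergedLength (σ t) (I t).1 (stack I σ t)

/-- The stack size `k_t` after the compaction for request `t`. -/
def stackSize {n : ℕ} (I : Fin n → Request) (σ : Schedule n) (t : Fin n) : ℕ :=
  (stack I σ (t + 1)).length

/-- The read cost `r * f k`, where `f k = ∞` forbids the stack size `k` altogether, i.e. costs `∞`
even if `r = 0`. The read-cost function is evaluated at stack sizes only. -/
noncomputable def readCost (f : ℕ → ℝ≥0∞) (r : ℝ≥0) (k : ℕ) : ℝ≥0∞ :=
  if f k = ⊤ then ⊤ else r * f k

/-- The cost of the schedule `σ` on the instance `I` of the problem BMC with read-cost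
function `f`. -/
noncomputable def cost (f : ℕ → ℝ≥0∞) {n : ℕ} (I : Fin n → Request) (σ : Schedule n) : ℝ≥0∞ :=
  ∑ t : Fin n, ((mergeCost I σ t : ℝ≥0∞) + readCost f (I t).2 (stackSize I σ t))

/-- The optimal (offline) cost. -/
noncomputable def opt (f : ℕ → ℝ≥0∞) {n : ℕ} (I : Fin n → Request) : ℝ≥0∞ :=
  ⨅ σ : Schedule n, cost f I σ

/-- The read-cost function of BMC with at most `K` levels. -/
noncomputable def fLevels (K : ℕ) (k : ℕ) : ℝ≥0∞ := if k ≤ K then 0 else ⊤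

/-- The read-cost function of LINEAR BMC. -/
noncomputable def fLinear (k : ℕ) : ℝ≥0∞ := k

/-- A deterministic online algorithm: the compaction at the `(t+1)`-st request is a function of
the first `t + 1` requests only. In particular neither the number of requests nor their
distribution is known to it. -/
abbrev OnlineAlgorithm := (t : ℕ) → (Fin (t + 1) → Request) → ℕ

/-- The schedule that the online algorithm `A` outputs on `I`. -/
def OnlineAlgorithm.schedule (A : OnlineAlgorithm) {n : ℕ} (I : Fin n → Request) : Schedule n :=
  fun t => A t fun i => I (Fin.castLE t.isLt i)

/-- The cost `A(I)` of the online algorithm `A` on `I`. -/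
noncomputable def OnlineAlgorithm.cost (A : OnlineAlgorithm) (f : ℕ → ℝ≥0∞) {n : ℕ}
    (I : Fin n → Request) : ℝ≥0∞ :=
  BMC.cost f I (A.schedule I)

/-- The law of a sequence of `n` independent requests with distribution `p`. -/
noncomputable def iid (p : Measure Request) (n : ℕ) : Measure (Fin n → Request) :=
  Measure.pi fun _ => p

/-- `E[A(I)]` for `n` i.i.d. requests with distribution `p`. -/
noncomputable def expectedCost (A : OnlineAlgorithm) (f : ℕ → ℝ≥0∞) (p : Measure Request)
    (n : ℕ) : ℝ :=
  ∫ I, (A.cost f I).toReal ∂(iid p n)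

/-- `E[OPT(I)]` for `n` i.i.d. requests with distribution `p`. -/
noncomputable def expectedOpt (f : ℕ → ℝ≥0∞) (p : Measure Request) (n : ℕ) : ℝ :=
  ∫ I, (opt f I).toReal ∂(iid p n)

/-- The distribution `p` is bounded. -/
def IsBoundedDist (p : Measure Request) : Prop :=
  ∃ M : ℝ≥0, ∀ᵐ x ∂p, x.1 ≤ M ∧ x.2 ≤ M

/-- The mean length. -/
noncomputable def meanLength (p : Measure Request) : ℝ := ∫ x, (x.1 : ℝ) ∂p

/-- The mean read rate. -/
noncomputable def meanRate (p : Measure Request) : ℝ := ∫ x, (x.2 : ℝ) ∂p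

/-- `A` is asymptotically 1-competitive in expectation on i.i.d. requests with distribution `p`,
for read-cost function `f`; the expectations involved are required to be genuine. -/
def AsymptoticallyOneCompetitive (A : OnlineAlgorithm) (f : ℕ → ℝ≥0∞) (p : Measure Request) :
    Prop :=
  (∀ n, Integrable (fun I => (A.cost f I).toReal) (iid p n)) ∧
  (∀ n, Integrable (fun I => (opt f I).toReal) (iid p n)) ∧
  expectedCost A f p ~[atTop] expectedOpt f p

/-- The constant `c_K = (K + 1) / (K!)^{1/K}`. -/
noncomputable def levelConst (K : ℕ) : ℝ := ((K : ℝ) + 1) / ((K ! : ℕ) : ℝ) ^ (1 / (K : ℝ))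

/-- `β` is a positive solution of `2^{-x/β} + 2^{-y/β} = 1`. -/
def SolvesKraft (x y β : ℝ) : Prop :=
  0 < β ∧ (2 : ℝ) ^ (-(x / β)) + (2 : ℝ) ^ (-(y / β)) = 1

end BMC

/-!
The sequence `b` of stack sizes of a schedule determines its cost: request `u` takes part in the
merge at time `v ≥ u` exactly if `b v ≤ b s` for all `s ∈ [u, v]` (`mem_recordSet`), so that the
total cost is the sum over `u` of the length of `u` times its number `records b n u` of merges,
plus its read rate times `b u` (`sum_mergeLen`, `cost_fLinear`). Cutting a range of times at the
last minimum of `b` shows that the pairs `(records b n u, b u)` occupy distinct positions of a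
binary tree whose coordinates count left and right turns.

*Lower bounds.* Summing a potential over this tree yields packing inequalities
(`sum_value_le`): with at most `K` levels, the numbers of merges fall short of `D` by at most
`(D + K).choose (K + 1)` in total (`sum_sub_records_le`); for the linear problem with unit costs
`x` and `y` the corresponding bound comes from Kraft's equation `2^(-x/β) + 2^(-y/β) = 1`
(`sum_sub_linear_le`). Random lengths and rates are replaced by their means as follows. The number
of merges drops by at most one and the stack size grows by at most one from one request to the
next, so each length and rate may be averaged over a window of `m` requests at an additive cost
`O(m n)` (`window_records_le`, `window_size_le`). By Chebyshev's inequality the windows of almost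
all requests are typical if `m` is large (`exists_le_integral_card_typical`), and the packing
inequalities are applied to these requests only.

*Upper bounds.* For at most `K` levels, a fixed infinite sequence of stack sizes is optimal up to
lower order terms for all numbers of requests at once. It is read off the combinatorial number
system: all requests are merged at the times `(d + K).choose K`, and in between the sequence for
`K - 1` levels is used (`levels`, `sum_topFile_levels_le`). For the linear problem, the algorithm
works in phases `[N, 2 N)`. It estimates the means from the first `N` requests, and within the
phase it follows the binary search tree that divides each range of requests in the ratio
`2^(-x/β) : 2^(-y/β)`. Each node has a nonempty subtree, which bounds its cost by
`β log N + x + y` (`balanced_spec`, `balanced_cost_le`). The requests of a phase are independent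
of the estimates, and inaccurate estimates have probability `O(1/N)`, while the cost of a phase is
`O(N ^ 2)` in any case (`integral_phase_le`). If all lengths or all rates vanish, then the linear
algorithm is exactly optimal (`expectedCost_linearAlgorithm_eq_opt`).
-/

namespace BMC

open ProbabilityTheory

/-! ### Records of a sequence of stack sizes -/

/-- The times `v ∈ [t, e)` at which the sequence `b` of stack sizes is at most all its values on
`[t, v]`. If `b` is the sequence of stack sizes of a schedule, these are the times at which the
request `t` takes part in a merge. -/
def recordSet (b : ℕ → ℕ) (e t : ℕ) : Finset ℕ :=
  (Finset.Ico t e).filter fun v => ∀ s ∈ Finset.Icc t v, b v ≤ b s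

/-- The number of merges before time `e` in which the request `t` takes part. -/
def records (b : ℕ → ℕ) (e t : ℕ) : ℕ := (recordSet b e t).card

lemma mem_recordSet {b : ℕ → ℕ} {e t v : ℕ} :
    v ∈ recordSet b e t ↔ (t ≤ v ∧ v < e) ∧ ∀ s, t ≤ s → s ≤ v → b v ≤ b s := by
  simp [recordSet, Finset.mem_Icc]

lemma records_mono (b : ℕ → ℕ) {e e' : ℕ} (h : e ≤ e') (t : ℕ) :
    records b e t ≤ records b e' t := by
  refine Finset.card_le_card fun v hv => ?_
  rw [mem_recordSet] at hv ⊢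
  exact ⟨⟨hv.1.1, hv.1.2.trans_le h⟩, hv.2⟩

lemma records_le_add (b : ℕ → ℕ) (e : ℕ) {u v : ℕ} (h : u ≤ v) :
    records b e u ≤ records b e v + (v - u) := by
  have hsub : recordSet b e u ⊆ recordSet b e v ∪ Finset.Ico u v := by
    intro w hw
    rw [mem_recordSet] at hw
    rw [Finset.mem_union, mem_recordSet, Finset.mem_Ico]
    rcases lt_or_ge w v with hwv | hwv
    · exact Or.inr ⟨hw.1.1, hwv⟩
    · exact Or.inl ⟨⟨hwv, hw.1.2⟩, fun s hs hs' => hw.2 s (h.trans hs) hs'⟩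
  calc records b e u ≤ (recordSet b e v ∪ Finset.Ico u v).card := Finset.card_le_card hsub
    _ ≤ _ := Finset.card_union_le _ _
    _ = _ := by rw [Nat.card_Ico, records]

lemma records_pos (b : ℕ → ℕ) {e t : ℕ} (h : t < e) : 1 ≤ records b e t := by
  refine Finset.card_pos.mpr ⟨t, ?_⟩
  rw [mem_recordSet]
  refine ⟨⟨le_rfl, h⟩, fun s hs hs' => ?_⟩
  rw [le_antisymm hs' hs]

/-- Records only depend on the order of the values of `b` on `[t, e)`, up to a shift of time. -/
lemma records_shift {b c : ℕ → ℕ} {e t k k' : ℕ}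
    (h : ∀ s, t ≤ s → s < e → b (k + s) = c s + k') :
    records b (k + e) (k + t) = records c e t := by
  have : recordSet b (k + e) (k + t) = (recordSet c e t).map (addLeftEmbedding k) := by
    ext v
    simp only [Finset.mem_map, addLeftEmbedding_apply, mem_recordSet]
    constructor
    · rintro ⟨⟨h1, h2⟩, h3⟩
      obtain ⟨w, rfl⟩ : ∃ w, v = k + w := ⟨v - k, by omega⟩
      refine ⟨w, ⟨⟨by omega, by omega⟩, fun s hs hs' => ?_⟩, rfl⟩
      have := h3 (k + s) (by omega) (by omega)
      rw [h w (by omega) (by omega), h s (by omega) (by omega)] at this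
      omega
    · rintro ⟨w, ⟨⟨h1, h2⟩, h3⟩, rfl⟩
      refine ⟨⟨by omega, by omega⟩, fun s hs hs' => ?_⟩
      obtain ⟨s, rfl⟩ : ∃ w, s = k + w := ⟨s - k, by omega⟩
      have := h3 s (by omega) (by omega)
      rw [h w (by omega) (by omega), h s (by omega) (by omega)]
      omega
  rw [records, this, Finset.card_map, records]

/-- A nonempty range of times contains a last one at which `b` is minimal. -/
lemma exists_last_argmin (b : ℕ → ℕ) {s e : ℕ} (h : s < e) :
    ∃ t, s ≤ t ∧ t < e ∧ (∀ u, s ≤ u → u < e → b t ≤ b u) ∧ ∀ u, t < u → u < e → b t < b u := by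
  induction e, h using Nat.le_induction with
  | base => exact ⟨s, le_rfl, by omega, fun u h1 h2 => by rw [show u = s by omega],
      fun u h1 h2 => by omega⟩
  | succ e he ih =>
    obtain ⟨t, h1, h2, h3, h4⟩ := ih
    rcases lt_or_ge (b t) (b e) with hlt | hge
    · refine ⟨t, h1, by omega, fun u hu hu' => ?_, fun u hu hu' => ?_⟩
      · rcases eq_or_ne u e with rfl | hne
        · exact hlt.le
        · exact h3 u hu (by omega)
      · rcases eq_or_ne u e with rfl | hne
        · exact hlt
        · exact h4 u hu (by omega)
    · refine ⟨e, by omega, by omega, fun u hu hu' => ?_, fun u hu hu' => by omega⟩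
      rcases eq_or_ne u e with rfl | hne
      · exact le_rfl
      · exact hge.trans (h3 u hu (by omega))

/-- The packing bound behind both lower bounds: the pairs (number of merges, stack size) occupied
by the requests of a schedule are the positions of the nodes of a binary tree, counted by left and
by right turns. If `V` is a value of such positions, then the total value of the occupied
positions is at most `P 1 1` for any potential `P` that dominates `V` along the tree. The offsets
`a₀` and `b₀` place the requests of `[s, e)` in a subtree, for the induction over `e - s`. -/
lemma sum_value_le {V P : ℕ → ℕ → ℝ} (hV : ∀ a b, 0 ≤ V a b) (hP : ∀ a b, 0 ≤ P a b)
    (hVa : ∀ b, Antitone fun a => V a b)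
    (hstep : ∀ a b, 1 ≤ a → 1 ≤ b → V a b + P (a + 1) b + P a (b + 1) ≤ P a b)
    (b : ℕ → ℕ) (k : ℕ) : ∀ s e, e - s ≤ k → ∀ a₀ b₀, 1 ≤ b₀ →
      (∀ t, s ≤ t → t < e → b₀ ≤ b t) →
      ∑ t ∈ Finset.Ico s e, V (a₀ + records b e t) (b t) ≤ P (a₀ + 1) b₀ := by
  have hanti : ∀ a b₀, 1 ≤ a → 1 ≤ b₀ → ∀ b₁, b₀ ≤ b₁ → P a b₁ ≤ P a b₀ := by
    intro a b₀ ha hb₀ b₁ hb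
    induction b₁, hb using Nat.le_induction with
    | base => exact le_rfl
    | succ c hc ih =>
      have := hstep a c ha (hb₀.trans hc)
      linarith [hV a c, hP (a + 1) c]
  induction k with
  | zero =>
    intro s e hk a₀ b₀ _ _
    rw [Finset.Ico_eq_empty (by omega), Finset.sum_empty]
    exact hP _ _
  | succ k ih =>
    intro s e hk a₀ b₀ hb₀ hb
    rcases le_or_gt e s with hes | hse
    · rw [Finset.Ico_eq_empty (by omega), Finset.sum_empty]
      exact hP _ _
    obtain ⟨t, h1, h2, h3, h4⟩ := exists_last_argmin b hse
    have hbt : b₀ ≤ b t := hb t h1 h2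
    rw [← Finset.sum_Ico_consecutive _ h1 h2.le, Finset.sum_eq_sum_Ico_succ_bot h2]
    have hleft : ∑ u ∈ Finset.Ico s t, V (a₀ + records b e u) (b u) ≤ P (a₀ + 1 + 1) (b t) := by
      refine le_trans (Finset.sum_le_sum fun u hu => ?_)
        (ih s t (by omega) (a₀ + 1) (b t) (hb₀.trans hbt) fun u hu hu' => h3 u hu (by omega))
      rw [Finset.mem_Ico] at hu
      refine hVa (b u) ?_
      have hsub : insert t (recordSet b t u) ⊆ recordSet b e u := by
        intro v hv
        rw [Finset.mem_insert] at hv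
        rw [mem_recordSet]
        rcases hv with rfl | hv
        · exact ⟨⟨hu.2.le, h2⟩, fun w hw hw' => h3 w (by omega) (by omega)⟩
        · rw [mem_recordSet] at hv
          exact ⟨⟨hv.1.1, by omega⟩, hv.2⟩
      have hcard := Finset.card_le_card hsub
      rw [Finset.card_insert_of_notMem (by rw [mem_recordSet]; omega)] at hcard
      simp only [records]
      omega
    have hright : ∑ u ∈ Finset.Ico (t + 1) e, V (a₀ + records b e u) (b u)
        ≤ P (a₀ + 1) (b t + 1) :=
      ih (t + 1) e (by omega) a₀ (b t + 1) (by omega) fun u hu hu' => h4 u (by omega) hu'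
    have hroot : V (a₀ + records b e t) (b t) ≤ V (a₀ + 1) (b t) :=
      hVa (b t) (by have := records_pos b h2; omega)
    have := hstep (a₀ + 1) (b t) (by omega) (hb₀.trans hbt)
    have := hanti (a₀ + 1) b₀ (by omega) hb₀ (b t) hbt
    linarith

/-- Packing bound for at most `K` levels: few requests take part in fewer than `D` merges. -/
lemma sum_sub_records_le {K D n : ℕ} (hD : 1 ≤ D) {b : ℕ → ℕ}
    (hb : ∀ t < n, 1 ≤ b t ∧ b t ≤ K) {S : Finset ℕ} (hS : S ⊆ Finset.range n) :
    ∑ t ∈ S, ((D : ℝ) - records b n t) ≤ ((D + K).choose (K + 1) : ℕ) := by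
  set V : ℕ → ℕ → ℝ := fun a b => if b ≤ K then ((D - a : ℕ) : ℝ) else 0 with hVdef
  set P : ℕ → ℕ → ℝ := fun a b =>
    (((D - a) + (K + 1 - b) + 1).choose ((K + 1 - b) + 1) : ℕ) - ((D - a : ℕ) : ℝ) - 1 with hPdef
  have hV : ∀ a b, 0 ≤ V a b := by
    intro a b; simp only [hVdef]; split_ifs <;> positivity
  have hchoose : ∀ d k : ℕ, d + 1 ≤ (d + k + 1).choose (k + 1) := by
    intro d k
    induction k with
    | zero => simp
    | succ k ih => rw [← add_assoc, Nat.choose_succ_succ]; exact ih.trans (Nat.le_add_right _ _)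
  have hP : ∀ a b, 0 ≤ P a b := by
    intro a b
    have := hchoose (D - a) (K + 1 - b)
    have : ((D - a : ℕ) : ℝ) + 1 ≤ (((D - a) + (K + 1 - b) + 1).choose ((K + 1 - b) + 1) : ℕ) := by
      exact_mod_cast this
    simp only [hPdef]; linarith
  have hVa : ∀ b, Antitone fun a => V a b := by
    intro b a a' h
    simp only [hVdef]
    split_ifs
    · exact_mod_cast Nat.sub_le_sub_left h D
    · exact le_rfl
  have hstep : ∀ a b, 1 ≤ a → 1 ≤ b → V a b + P (a + 1) b + P a (b + 1) ≤ P a b := by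
    intro a b _ _
    rcases le_or_gt b K with hbK | hbK
    · rcases lt_or_ge a D with haD | haD
      · obtain ⟨d, hd⟩ : ∃ d, D - a = d + 1 := ⟨D - a - 1, by omega⟩
        obtain ⟨k, hk⟩ : ∃ k, K + 1 - b = k + 1 := ⟨K - b, by omega⟩
        have h1 : D - (a + 1) = d := by omega
        have h2 : K + 1 - (b + 1) = k := by omega
        simp only [hVdef, hPdef, hbK, if_true, hd, hk, h1, h2]
        rw [show d + 1 + (k + 1) + 1 = (d + k + 2) + 1 by ring,
          show d + (k + 1) + 1 = d + k + 2 by ring, show d + 1 + k + 1 = d + k + 2 by ring,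
          Nat.choose_succ_succ (d + k + 2) (k + 1)]
        push_cast
        linarith
      · have h1 : D - (a + 1) = 0 := by omega
        have h2 : D - a = 0 := by omega
        simp [hVdef, hPdef, h1, h2]
    · have h1 : K + 1 - (b + 1) = 0 := by omega
      have h2 : K + 1 - b = 0 := by omega
      simp [hVdef, hPdef, h1, h2, not_le.mpr hbK]
  have key := sum_value_le hV hP hVa hstep b n 0 n (by omega) 0 1 le_rfl
    (fun t _ ht => (hb t ht).1)
  simp only [zero_add, ← Finset.range_eq_Ico] at key
  calc ∑ t ∈ S, ((D : ℝ) - records b n t) ≤ ∑ t ∈ S, V (records b n t) (b t) := by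
        refine Finset.sum_le_sum fun t ht => ?_
        have := (hb t (Finset.mem_range.mp (hS ht))).2
        simp only [hVdef, this, if_true]
        have : (D : ℝ) ≤ ((D - records b n t : ℕ) : ℝ) + records b n t := by
          exact_mod_cast (by omega : D ≤ D - records b n t + records b n t)
        linarith
    _ ≤ ∑ t ∈ Finset.range n, V (records b n t) (b t) :=
        Finset.sum_le_sum_of_subset_of_nonneg hS fun _ _ _ => hV _ _
    _ ≤ P 1 1 := key
    _ ≤ _ := by
        simp only [hPdef]
        rw [show D - 1 + (K + 1 - 1) + 1 = D + K by omega, show K + 1 - 1 + 1 = K + 1 by omega]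
        have : (0 : ℝ) ≤ ((D - 1 : ℕ) : ℝ) := by positivity
        linarith

lemma self_le_two_rpow (u : ℝ) : u ≤ (2 : ℝ) ^ u := by
  rcases le_or_gt u 0 with hu | hu
  · exact hu.trans (by positivity)
  rw [Real.rpow_def_of_pos two_pos]
  set z := Real.log 2 * u / 2 with hz
  have h1 : Real.exp (Real.log 2 * u) = Real.exp z * Real.exp z := by
    rw [← Real.exp_add]; congr 1; ring
  have h2 := Real.add_one_le_exp z
  have h3 : 0 < z := by have := Real.log_pos one_lt_two; positivity
  have h4 : (z + 1) * (z + 1) ≤ Real.exp z * Real.exp z := by gcongr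
  rw [h1]
  nlinarith [sq_nonneg (z - 1), Real.log_two_gt_d9]

/-- Packing bound for the linear problem: few requests `t` have a small value of
`x * records + y * b t`, by Kraft's equation. -/
lemma sum_sub_linear_le {x y β l : ℝ} (hx : 0 < x) (hy : 0 < y) (hβ : SolvesKraft x y β)
    {n : ℕ} {b : ℕ → ℕ}
    (hb : ∀ t < n, 1 ≤ b t) (hl : 0 ≤ l) {S : Finset ℕ} (hS : S ⊆ Finset.range n) :
    ∑ t ∈ S, (l - (x * records b n t + y * b t)) ≤ β * (2 : ℝ) ^ (l / β) := by
  obtain ⟨hβ0, hkraft⟩ := hβ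
  set V : ℕ → ℕ → ℝ := fun a b => max (l - x * a - y * b) 0 with hVdef
  set μ : ℕ → ℕ → ℝ := fun a b => l - x * ((a : ℝ) - 1) - y * ((b : ℝ) - 1) with hμ
  set P : ℕ → ℕ → ℝ := fun a b =>
    if μ a b ≤ x + y then 0 else β * (2 : ℝ) ^ (μ a b / β) - μ a b with hPdef
  have hG : ∀ z : ℝ, 0 ≤ β * (2 : ℝ) ^ (z / β) - z := by
    intro z
    have := mul_le_mul_of_nonneg_left (self_le_two_rpow (z / β)) hβ0.le
    rw [mul_div_cancel₀ _ hβ0.ne'] at this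
    linarith
  have hP : ∀ a b, 0 ≤ P a b := by
    intro a b; simp only [hPdef]; split_ifs
    · exact le_rfl
    · exact hG _
  have hPle : ∀ a b, P a b ≤ β * (2 : ℝ) ^ (μ a b / β) - μ a b := by
    intro a b; simp only [hPdef]; split_ifs
    · exact hG _
    · exact le_rfl
  have hV : ∀ a b, 0 ≤ V a b := fun a b => le_max_right _ _
  have hVa : ∀ b, Antitone fun a => V a b := by
    intro b a a' h
    have : (a : ℝ) ≤ a' := by exact_mod_cast h
    simp only [hVdef]
    gcongr
  have hstep : ∀ a b, 1 ≤ a → 1 ≤ b → V a b + P (a + 1) b + P a (b + 1) ≤ P a b := by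
    intro a b _ _
    have e1 : μ (a + 1) b = μ a b - x := by simp only [hμ]; push_cast; ring
    have e2 : μ a (b + 1) = μ a b - y := by simp only [hμ]; push_cast; ring
    have e3 : l - x * a - y * b = μ a b - x - y := by simp only [hμ]; ring
    by_cases hle : μ a b ≤ x + y
    · have h1 : P (a + 1) b = 0 := by simp only [hPdef, e1]; rw [if_pos]; linarith
      have h2 : P a (b + 1) = 0 := by simp only [hPdef, e2]; rw [if_pos]; linarith
      have h3 : V a b = 0 := by simp only [hVdef, e3]; exact max_eq_right (by linarith)
      rw [h1, h2, h3]; linarith [hP a b]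
    · have h3 : V a b = μ a b - x - y := by
        simp only [hVdef, e3]; exact max_eq_left (by linarith)
      have h4 : P a b = β * (2 : ℝ) ^ (μ a b / β) - μ a b := by simp only [hPdef, if_neg hle]
      have h5 := hPle (a + 1) b
      have h6 := hPle a (b + 1)
      rw [e1] at h5
      rw [e2] at h6
      have hs : ∀ z : ℝ, (2 : ℝ) ^ ((μ a b - z) / β)
          = (2 : ℝ) ^ (μ a b / β) * (2 : ℝ) ^ (-(z / β)) := by
        intro z; rw [← Real.rpow_add two_pos]; congr 1; ring
      rw [hs] at h5 h6
      have h7 : β * ((2 : ℝ) ^ (μ a b / β) * (2 : ℝ) ^ (-(x / β)))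
          + β * ((2 : ℝ) ^ (μ a b / β) * (2 : ℝ) ^ (-(y / β))) = β * (2 : ℝ) ^ (μ a b / β) := by
        rw [← mul_add, ← mul_add, hkraft, mul_one]
      rw [h3, h4]
      linarith
  have key := sum_value_le hV hP hVa hstep b n 0 n (by omega) 0 1 le_rfl
    (fun t _ ht => hb t ht)
  simp only [zero_add, ← Finset.range_eq_Ico] at key
  calc ∑ t ∈ S, (l - (x * records b n t + y * b t)) ≤ ∑ t ∈ S, V (records b n t) (b t) := by
        refine Finset.sum_le_sum fun t ht => ?_
        simp only [hVdef]
        exact le_trans (by linarith) (le_max_left _ _)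
    _ ≤ ∑ t ∈ Finset.range n, V (records b n t) (b t) :=
        Finset.sum_le_sum_of_subset_of_nonneg hS fun _ _ _ => hV _ _
    _ ≤ P 1 1 := key
    _ ≤ _ := by
        have := hPle 1 1
        simp only [hμ] at this
        norm_num at this
        linarith

/-! ### Costs in terms of stack sizes -/

/-- The length of request `u`, as a function on `ℕ` that vanishes from `n` on. -/
def len {n : ℕ} (I : Fin n → Request) (u : ℕ) : ℝ≥0 := if h : u < n then (I ⟨u, h⟩).1 else 0

/-- The read rate of request `u`, as a function on `ℕ` that vanishes from `n` on. -/
def rate {n : ℕ} (I : Fin n → Request) (u : ℕ) : ℝ≥0 := if h : u < n then (I ⟨u, h⟩).2 else 0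

/-- The stack size after request `t`, as a function on `ℕ`. -/
def size {n : ℕ} (I : Fin n → Request) (σ : Schedule n) (t : ℕ) : ℕ := (stack I σ (t + 1)).length

/-- The requests that are part of the top file after request `t`, if `b` is the sequence of stack
sizes. -/
def topFile (b : ℕ → ℕ) (t : ℕ) : Finset ℕ :=
  (Finset.range (t + 1)).filter fun u => ∀ s ∈ Finset.Icc u t, b t ≤ b s

lemma mem_topFile {b : ℕ → ℕ} {t u : ℕ} :
    u ∈ topFile b t ↔ u ≤ t ∧ ∀ s, u ≤ s → s ≤ t → b t ≤ b s := by
  simp [topFile, Finset.mem_Icc]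

lemma stack_succ {n : ℕ} (I : Fin n → Request) (σ : Schedule n) {t : ℕ} (h : t < n) :
    stack I σ (t + 1) = compact (σ ⟨t, h⟩) (I ⟨t, h⟩).1 (stack I σ t) := by
  rw [stack, dif_pos h]

lemma size_eq {n : ℕ} (I : Fin n → Request) (σ : Schedule n) {t : ℕ} (h : t < n) :
    size I σ t = (stack I σ t).length - σ ⟨t, h⟩ + 1 := by
  rw [size, stack_succ I σ h, compact, List.length_cons, List.length_drop]

lemma size_zero {n : ℕ} (I : Fin n → Request) (σ : Schedule n) (h : 0 < n) : size I σ 0 = 1 := by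
  rw [size_eq I σ h]; simp [stack]

lemma size_succ {n : ℕ} (I : Fin n → Request) (σ : Schedule n) {t : ℕ} (h : t + 1 < n) :
    size I σ (t + 1) = size I σ t - σ ⟨t + 1, h⟩ + 1 := size_eq I σ h

lemma one_le_size {n : ℕ} (I : Fin n → Request) (σ : Schedule n) {t : ℕ} (h : t < n) :
    1 ≤ size I σ t := by
  rw [size_eq I σ h]; omega

lemma size_le {n : ℕ} (I : Fin n → Request) (σ : Schedule n) {t : ℕ} (h : t < n) :
    size I σ t ≤ t + 1 := by
  induction t with
  | zero => rw [size_zero I σ h]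
  | succ t ih => rw [size_succ I σ h]; have := ih (by omega); omega

lemma size_le_add {n : ℕ} (I : Fin n → Request) (σ : Schedule n) {u v : ℕ} (h : u ≤ v)
    (hv : v < n) : size I σ v ≤ size I σ u + (v - u) := by
  induction v, h using Nat.le_induction with
  | base => omega
  | succ v huv ih => rw [size_succ I σ hv]; have := ih (by omega); omega

lemma filter_since_succ (b : ℕ → ℕ) {T T' j : ℕ} (hT : T' = T + 1) (h : j ≤ b T) :
    ((Finset.range T').filter fun u => ∀ s ∈ Finset.Ico u T', j ≤ b s)
      = insert T ((Finset.range T).filter fun u => ∀ s ∈ Finset.Ico u T, j ≤ b s) := by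
  subst hT
  ext u
  simp only [Finset.mem_filter, Finset.mem_range, Finset.mem_insert, Finset.mem_Ico]
  constructor
  · rintro ⟨h1, h2⟩
    rcases eq_or_ne u T with rfl | hne
    · exact Or.inl rfl
    · exact Or.inr ⟨by omega, fun s hs => h2 s ⟨hs.1, by omega⟩⟩
  · rintro (rfl | ⟨h1, h2⟩)
    · refine ⟨by omega, fun s hs => ?_⟩
      rwa [show s = u by omega]
    · refine ⟨by omega, fun s hs => ?_⟩
      rcases eq_or_ne s T with rfl | hne
      · exact h
      · exact h2 s ⟨hs.1, by omega⟩

/-- The files at level `j` or higher, counted from the bottom of the stack, contain the requests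
since which the stack size has been at least `j`. -/
lemma sum_take_stack {n : ℕ} (I : Fin n → Request) (σ : Schedule n) (T : ℕ) (hT : T ≤ n)
    (j : ℕ) (hj : 1 ≤ j) :
    ((stack I σ T).take ((stack I σ T).length - (j - 1))).sum
      = ∑ u ∈ (Finset.range T).filter (fun u => ∀ s ∈ Finset.Ico u T, j ≤ size I σ s),
          len I u := by
  induction T with
  | zero => simp [stack]
  | succ T ih =>
    have hTn : T < n := by omega
    have ih := ih (by omega)
    have hb := size_eq I σ hTn
    set b := size I σ T with hbdef
    rcases lt_or_ge b j with hbj | hbj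
    · have hl : (stack I σ (T + 1)).length = b := rfl
      rw [hl, show b - (j - 1) = 0 by omega, List.take_zero, List.sum_nil, Finset.filter_false_of_mem,
        Finset.sum_empty]
      intro u hu hs
      have := hs T (by rw [Finset.mem_Ico]; rw [Finset.mem_range] at hu; omega)
      omega
    · have hl : (stack I σ (T + 1)).length = b := rfl
      rw [filter_since_succ (size I σ) rfl hbj, Finset.sum_insert (by simp), ← ih, hl, stack_succ I σ hTn, compact,
        show b - (j - 1) = (b - j) + 1 by omega, List.take_succ_cons, List.sum_cons, mergedLength,
        add_assoc]
      have hlen : len I T = (I ⟨T, hTn⟩).1 := by rw [len, dif_pos hTn]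
      rw [hlen]
      congr 1
      rw [← List.sum_append, ← List.take_add]
      -- if all files are merged, the number of merged files may exceed the stack size
      rcases le_total (σ ⟨T, hTn⟩) (stack I σ T).length with hm | hm
      · congr 2; omega
      · rw [List.take_of_length_le (by omega), List.take_of_length_le (by omega)]

lemma mergeCost_eq {n : ℕ} (I : Fin n → Request) (σ : Schedule n) {t : ℕ} (h : t < n) :
    mergeCost I σ ⟨t, h⟩ = ∑ u ∈ topFile (size I σ) t, len I u := by
  have := sum_take_stack I σ (t + 1) h (size I σ t) (one_le_size I σ h)
  have hl : (stack I σ (t + 1)).length = size I σ t := rfl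
  have h1 := one_le_size I σ h
  rw [hl, show size I σ t - (size I σ t - 1) = 1 by omega, stack_succ I σ h, compact,
    List.take_succ_cons, List.take_zero, List.sum_singleton] at this
  rw [mergeCost, this, topFile]
  congr 1

/-- Summing merge costs over time or over requests. -/
lemma sum_topFile_eq (b : ℕ → ℕ) (w : ℕ → ℝ) (s e : ℕ) :
    ∑ t ∈ Finset.Ico s e, ∑ u ∈ (topFile b t).filter (s ≤ ·), w u
      = ∑ u ∈ Finset.Ico s e, w u * records b e u := by
  simp_rw [records, ← nsmul_eq_mul', ← Finset.sum_const]
  refine Finset.sum_comm' fun t u => ?_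
  rw [Finset.mem_filter, mem_topFile, mem_recordSet, Finset.mem_Ico, Finset.mem_Ico]
  constructor
  · rintro ⟨h1, ⟨h2, h3⟩, h4⟩
    exact ⟨⟨⟨h2, h1.2⟩, h3⟩, h4, by omega⟩
  · rintro ⟨⟨⟨h1, h2⟩, h3⟩, h4⟩
    exact ⟨⟨by omega, h2⟩, ⟨h1, h3⟩, h4.1⟩

/-- The merge cost of request `t`, as a real number. -/
def mergeLen {n : ℕ} (I : Fin n → Request) (σ : Schedule n) (t : ℕ) : ℝ :=
  ∑ u ∈ topFile (size I σ) t, (len I u : ℝ)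

lemma mergeLen_nonneg {n : ℕ} (I : Fin n → Request) (σ : Schedule n) (t : ℕ) :
    0 ≤ mergeLen I σ t := Finset.sum_nonneg fun _ _ => NNReal.coe_nonneg _

lemma sum_mergeLen {n : ℕ} (I : Fin n → Request) (σ : Schedule n) :
    ∑ t ∈ Finset.range n, mergeLen I σ t
      = ∑ u ∈ Finset.range n, (len I u : ℝ) * records (size I σ) n u := by
  have := sum_topFile_eq (size I σ) (fun u => (len I u : ℝ)) 0 n
  simp only [Nat.zero_le, Finset.filter_true, ← Finset.range_eq_Ico] at this
  exact this

lemma coe_mergeCost {n : ℕ} (I : Fin n → Request) (σ : Schedule n) (t : Fin n) :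
    (mergeCost I σ t : ℝ≥0∞) = ENNReal.ofReal (mergeLen I σ t) := by
  rw [mergeCost_eq I σ t.isLt, mergeLen, ← NNReal.coe_sum, ENNReal.ofReal_coe_nnreal]

lemma coe_rate {n : ℕ} (I : Fin n → Request) (t : Fin n) : (rate I t : ℝ≥0) = (I t).2 := by
  rw [rate, dif_pos t.isLt]

/-- The cost of a schedule for the linear problem. -/
lemma cost_fLinear {n : ℕ} (I : Fin n → Request) (σ : Schedule n) :
    cost fLinear I σ
      = ENNReal.ofReal (∑ t ∈ Finset.range n, (mergeLen I σ t + rate I t * size I σ t)) := by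
  rw [← Fin.sum_univ_eq_sum_range (fun t => mergeLen I σ t + rate I t * size I σ t), cost,
    ENNReal.ofReal_sum_of_nonneg]
  · refine Finset.sum_congr rfl fun t _ => ?_
    rw [ENNReal.ofReal_add (mergeLen_nonneg _ _ _) (by positivity), coe_mergeCost, readCost,
      fLinear, if_neg (ENNReal.natCast_ne_top _), coe_rate,
      ENNReal.ofReal_mul (NNReal.coe_nonneg _), ENNReal.ofReal_coe_nnreal, ENNReal.ofReal_natCast]
    rfl
  · intro t _
    have := mergeLen_nonneg I σ t
    positivity

/-- The cost of a schedule for the problem with at most `K` levels, if it is feasible. -/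
lemma cost_fLevels {K n : ℕ} (I : Fin n → Request) (σ : Schedule n)
    (h : ∀ t < n, size I σ t ≤ K) :
    cost (fLevels K) I σ = ENNReal.ofReal (∑ t ∈ Finset.range n, mergeLen I σ t) := by
  rw [← Fin.sum_univ_eq_sum_range (fun t => mergeLen I σ t), cost,
    ENNReal.ofReal_sum_of_nonneg fun t _ => mergeLen_nonneg _ _ _]
  refine Finset.sum_congr rfl fun t _ => ?_
  have : stackSize I σ t ≤ K := h t t.isLt
  simp [coe_mergeCost, readCost, fLevels, this]

lemma cost_fLevels_eq_top {K n : ℕ} (I : Fin n → Request) (σ : Schedule n) {t : ℕ} (ht : t < n)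
    (h : K < size I σ t) : cost (fLevels K) I σ = ⊤ := by
  rw [cost, ENNReal.sum_eq_top]
  refine ⟨⟨t, ht⟩, Finset.mem_univ _, ?_⟩
  have : ¬ stackSize I σ ⟨t, ht⟩ ≤ K := not_le.mpr h
  simp [readCost, fLevels, this]

lemma size_congr {n : ℕ} (I J : Fin n → Request) (σ : Schedule n) : size I σ = size J σ := by
  funext t
  induction t with
  | zero =>
    by_cases h : 0 < n
    · rw [size_zero I σ h, size_zero J σ h]
    · simp [size, stack, h]
  | succ t ih =>
    by_cases h : t + 1 < n
    · rw [size_succ I σ h, size_succ J σ h, ih]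
    · have (I : Fin n → Request) : size I σ (t + 1) = size I σ t := by
        rw [size, stack, dif_neg h]; rfl
      rw [this, this, ih]

/-! ### Window averages -/

/-- Replacing the weights `w` by their averages over windows of length `m` that start at a given
time does not cost much: a request takes part in at most `m` more merges than any of the `m`
requests that follow it. -/
lemma window_records_le {n m : ℕ} (hm : 1 ≤ m) (b : ℕ → ℕ) {w : ℕ → ℝ} (hw : ∀ u, 0 ≤ w u) {c : ℝ}
    {S : Finset ℕ} (hS : ∀ u ∈ S, u + m ≤ n)
    (hwin : ∀ u ∈ S, m * c ≤ ∑ j ∈ Finset.range m, w (u + j)) :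
    c * ∑ u ∈ S, (records b n u : ℝ)
      ≤ ∑ u ∈ Finset.range n, w u * records b n u + m * ∑ u ∈ Finset.range n, w u := by
  have hj : ∀ j ∈ Finset.range m, ∑ u ∈ S, w (u + j) * records b n u
      ≤ ∑ u ∈ Finset.range n, w u * (records b n u + m) := by
    intro j hj
    rw [Finset.mem_range] at hj
    calc ∑ u ∈ S, w (u + j) * records b n u
        ≤ ∑ u ∈ S, w (u + j) * (records b n (u + j) + m) := by
          refine Finset.sum_le_sum fun u _ => mul_le_mul_of_nonneg_left ?_ (hw _)
          have := records_le_add b n (Nat.le_add_right u j)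
          exact_mod_cast (by omega : records b n u ≤ records b n (u + j) + m)
      _ = ∑ v ∈ S.map (addRightEmbedding j), w v * (records b n v + m) := by
          rw [Finset.sum_map]; rfl
      _ ≤ _ := by
          refine Finset.sum_le_sum_of_subset_of_nonneg ?_ fun v _ _ =>
            mul_nonneg (hw v) (by positivity)
          intro v hv
          rw [Finset.mem_map] at hv
          obtain ⟨u, hu, rfl⟩ := hv
          have := hS u hu
          simp only [addRightEmbedding_apply, Finset.mem_range]
          omega
  have hsum := Finset.sum_le_sum hj
  rw [Finset.sum_comm, Finset.sum_const, Finset.card_range, nsmul_eq_mul] at hsum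
  have hlow : m * (c * ∑ u ∈ S, (records b n u : ℝ))
      ≤ ∑ u ∈ S, ∑ j ∈ Finset.range m, w (u + j) * records b n u := by
    rw [← mul_assoc, Finset.mul_sum]
    refine Finset.sum_le_sum fun u hu => ?_
    rw [← Finset.sum_mul]
    exact mul_le_mul_of_nonneg_right (hwin u hu) (by positivity)
  have hm0 : (0 : ℝ) < m := by exact_mod_cast hm
  have := le_of_mul_le_mul_left (hlow.trans hsum) hm0
  simp_rw [mul_add, Finset.sum_add_distrib] at this
  rw [← Finset.sum_mul, mul_comm _ (m : ℝ)] at this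
  exact this

/-- The analogue of `window_records_le` for stack sizes, which grow by at most one per request;
the windows extend to the past. -/
lemma window_size_le {n m : ℕ} (hm : 1 ≤ m) {b : ℕ → ℕ}
    (hb : ∀ u v, u ≤ v → v < n → b v ≤ b u + (v - u)) {w : ℕ → ℝ} (hw : ∀ u, 0 ≤ w u) {c : ℝ}
    {S : Finset ℕ} (hS : ∀ u ∈ S, m ≤ u ∧ u < n)
    (hwin : ∀ u ∈ S, m * c ≤ ∑ j ∈ Finset.range m, w (u - j)) :
    c * ∑ u ∈ S, (b u : ℝ)
      ≤ ∑ u ∈ Finset.range n, w u * b u + m * ∑ u ∈ Finset.range n, w u := by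
  have hj : ∀ j ∈ Finset.range m, ∑ u ∈ S, w (u - j) * b u
      ≤ ∑ u ∈ Finset.range n, w u * (b u + m) := by
    intro j hj
    rw [Finset.mem_range] at hj
    have hinj : Set.InjOn (fun u => u - j) S := by
      intro u hu v hv huv
      have := hS u hu
      have := hS v hv
      simp only at huv
      omega
    calc ∑ u ∈ S, w (u - j) * b u
        ≤ ∑ u ∈ S, w (u - j) * (b (u - j) + m) := by
          refine Finset.sum_le_sum fun u hu => mul_le_mul_of_nonneg_left ?_ (hw _)
          have h1 := hS u hu
          have := hb (u - j) u (by omega) h1.2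
          exact_mod_cast (by omega : b u ≤ b (u - j) + m)
      _ = ∑ v ∈ S.image (fun u => u - j), w v * (b v + m) := by
          rw [Finset.sum_image hinj]
      _ ≤ _ := by
          refine Finset.sum_le_sum_of_subset_of_nonneg ?_ fun v _ _ =>
            mul_nonneg (hw v) (by positivity)
          intro v hv
          rw [Finset.mem_image] at hv
          obtain ⟨u, hu, rfl⟩ := hv
          have := hS u hu
          rw [Finset.mem_range]
          omega
  have hsum := Finset.sum_le_sum hj
  rw [Finset.sum_comm, Finset.sum_const, Finset.card_range, nsmul_eq_mul] at hsum
  have hlow : m * (c * ∑ u ∈ S, (b u : ℝ))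
      ≤ ∑ u ∈ S, ∑ j ∈ Finset.range m, w (u - j) * b u := by
    rw [← mul_assoc, Finset.mul_sum]
    refine Finset.sum_le_sum fun u hu => ?_
    rw [← Finset.sum_mul]
    exact mul_le_mul_of_nonneg_right (hwin u hu) (by positivity)
  have hm0 : (0 : ℝ) < m := by exact_mod_cast hm
  have := le_of_mul_le_mul_left (hlow.trans hsum) hm0
  simp_rw [mul_add, Finset.sum_add_distrib] at this
  rw [← Finset.sum_mul, mul_comm _ (m : ℝ)] at this
  exact this

/-! ### Independent requests -/

instance instIsProbabilityMeasureIid (p : Measure Request) [IsProbabilityMeasure p] (n : ℕ) :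
    IsProbabilityMeasure (iid p n) := by unfold iid; infer_instance

/-- The function `ψ` of request `u`, extended by `0` to `u ≥ n`. -/
noncomputable def coord (ψ : Request → ℝ) {n : ℕ} (I : Fin n → Request) (u : ℕ) : ℝ :=
  if h : u < n then ψ (I ⟨u, h⟩) else 0

/-- The length of a request, as a real number. -/
noncomputable def lenFun (x : Request) : ℝ := x.1

/-- The read rate of a request, as a real number. -/
noncomputable def rateFun (x : Request) : ℝ := x.2

lemma measurable_lenFun : Measurable lenFun := by unfold lenFun; fun_prop

lemma measurable_rateFun : Measurable rateFun := by unfold rateFun; fun_prop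

lemma coe_len {n : ℕ} (I : Fin n → Request) (u : ℕ) : (len I u : ℝ) = coord lenFun I u := by
  unfold len coord lenFun; split_ifs <;> simp

lemma coe_rate_eq {n : ℕ} (I : Fin n → Request) (u : ℕ) :
    (rate I u : ℝ) = coord rateFun I u := by
  unfold rate coord rateFun; split_ifs <;> simp

lemma measurable_coord {ψ : Request → ℝ} (hψ : Measurable ψ) {n : ℕ} (u : ℕ) :
    Measurable fun I : Fin n → Request => coord ψ I u := by
  unfold coord; split_ifs
  · exact hψ.comp (measurable_pi_apply _)
  · exact measurable_const

/-- `ψ` is measurable and takes values in `[0, M]` almost surely. -/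
structure BoundedBy (p : Measure Request) (ψ : Request → ℝ) (M : ℝ) : Prop where
  measurable : Measurable ψ
  nonneg : ∀ x, 0 ≤ ψ x
  le : ∀ᵐ x ∂p, ψ x ≤ M

lemma IsBoundedDist.exists_boundedBy {p : Measure Request} (hp : IsBoundedDist p) :
    ∃ M : ℝ, 0 ≤ M ∧ BoundedBy p lenFun M ∧ BoundedBy p rateFun M := by
  obtain ⟨M, hM⟩ := hp
  refine ⟨M, M.2, ⟨measurable_lenFun, fun x => x.1.2, ?_⟩, ⟨measurable_rateFun, fun x => x.2.2, ?_⟩⟩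
  · filter_upwards [hM] with x hx using hx.1
  · filter_upwards [hM] with x hx using hx.2

lemma BoundedBy.coord_nonneg {p : Measure Request} {ψ : Request → ℝ} {M : ℝ}
    (h : BoundedBy p ψ M) {n : ℕ} (I : Fin n → Request) (u : ℕ) :
    0 ≤ coord ψ I u := by
  unfold coord; split_ifs
  · exact h.nonneg _
  · exact le_rfl

section
variable {p : Measure Request} [IsProbabilityMeasure p] {ψ : Request → ℝ} {M : ℝ}

lemma measurePreserving_request (p : Measure Request) [IsProbabilityMeasure p] {n : ℕ}
    (t : Fin n) : MeasurePreserving (fun I : Fin n → Request => I t) (iid p n) p :=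
  measurePreserving_eval (fun _ : Fin n => p) t

lemma BoundedBy.ae_coord_le (h : BoundedBy p ψ M) (hM : 0 ≤ M) (n : ℕ) :
    ∀ᵐ I ∂(iid p n), ∀ u, coord ψ I u ≤ M := by
  rw [ae_all_iff]
  intro u
  by_cases hu : u < n
  · have := (measurePreserving_request p (⟨u, hu⟩ : Fin n)).quasiMeasurePreserving.ae h.le
    filter_upwards [this] with I hI
    rwa [coord, dif_pos hu]
  · filter_upwards with I
    rwa [coord, dif_neg hu]

lemma BoundedBy.memLp (h : BoundedBy p ψ M) (hM : 0 ≤ M) (n u : ℕ) (q : ℝ≥0∞) :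
    MemLp (fun I : Fin n → Request => coord ψ I u) q (iid p n) := by
  refine MemLp.of_bound (measurable_coord h.measurable u).aestronglyMeasurable M ?_
  filter_upwards [h.ae_coord_le hM n] with I hI
  rw [Real.norm_of_nonneg (h.coord_nonneg I u)]
  exact hI u

lemma BoundedBy.integrable_coord (h : BoundedBy p ψ M) (hM : 0 ≤ M) (n u : ℕ) :
    Integrable (fun I : Fin n → Request => coord ψ I u) (iid p n) :=
  (h.memLp hM n u 1).integrable le_rfl

lemma integral_coord (hψ : Measurable ψ) {n u : ℕ} (hu : u < n) :
    ∫ I, coord ψ I u ∂(iid p n) = ∫ x, ψ x ∂p := by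
  have hmp := measurePreserving_request p (⟨u, hu⟩ : Fin n)
  have := integral_map hmp.measurable.aemeasurable
    (hψ.aestronglyMeasurable (μ := Measure.map (fun I : Fin n → Request => I ⟨u, hu⟩) (iid p n)))
  rw [hmp.map_eq] at this
  simp only [coord, dif_pos hu, this]

lemma iIndepFun_request (p : Measure Request) [IsProbabilityMeasure p] (n : ℕ) :
    iIndepFun (fun (t : Fin n) (I : Fin n → Request) => I t) (iid p n) :=
  iIndepFun_pi (μ := fun _ : Fin n => p) (X := fun _ x => x) fun _ => measurable_id.aemeasurable

lemma indepFun_coord (hψ : Measurable ψ) {n u v : ℕ} (huv : u ≠ v) (hu : u < n) (hv : v < n) :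
    IndepFun (fun I : Fin n → Request => coord ψ I u) (fun I => coord ψ I v) (iid p n) := by
  have := (iIndepFun_request p n).indepFun (i := ⟨u, hu⟩) (j := ⟨v, hv⟩) (by simpa using huv)
  have := this.comp hψ hψ
  simp only [coord, dif_pos hu, dif_pos hv]
  exact this

/-- Chebyshev's inequality for sums over windows of requests. -/
lemma BoundedBy.prob_sum_dev_le (h : BoundedBy p ψ M) (hM : 0 ≤ M) {n : ℕ} {W : Finset ℕ}
    (hW : ∀ u ∈ W, u < n) {c : ℝ} (hc : 0 < c) :
    (iid p n).real {I | c ≤ |∑ u ∈ W, coord ψ I u - W.card * ∫ x, ψ x ∂p|}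
      ≤ W.card * M ^ 2 / c ^ 2 := by
  have hmean : ∫ I, ∑ u ∈ W, coord ψ I u ∂(iid p n) = W.card * ∫ x, ψ x ∂p := by
    rw [integral_finsetSum W fun u _ => h.integrable_coord hM n u,
      Finset.sum_congr rfl fun u hu => integral_coord h.measurable (hW u hu), Finset.sum_const,
      nsmul_eq_mul]
  have hvar1 : ∀ u, Var[fun I : Fin n → Request => coord ψ I u; iid p n] ≤ M ^ 2 := by
    intro u
    refine (variance_le_expectation_sq
      (measurable_coord h.measurable u).aestronglyMeasurable).trans ?_
    calc ∫ I, ((fun I : Fin n → Request => coord ψ I u) ^ 2) I ∂(iid p n)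
        ≤ ∫ _, M ^ 2 ∂(iid p n) := by
          refine integral_mono_ae (h.memLp hM n u 2).integrable_sq (integrable_const _) ?_
          filter_upwards [h.ae_coord_le hM n] with I hI
          exact pow_le_pow_left₀ (h.coord_nonneg I u) (hI u) 2
      _ = M ^ 2 := by simp
  have hvar : Var[∑ u ∈ W, fun I : Fin n → Request => coord ψ I u; iid p n] ≤ W.card * M ^ 2 := by
    rw [IndepFun.variance_sum (fun u _ => h.memLp hM n u 2) fun u hu v hv huv =>
      indepFun_coord h.measurable huv (hW u hu) (hW v hv), ← nsmul_eq_mul]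
    exact Finset.sum_le_card_nsmul _ _ _ fun u _ => hvar1 u
  have heq : (∑ u ∈ W, fun I : Fin n → Request => coord ψ I u)
      = fun I => ∑ u ∈ W, coord ψ I u := by ext I; simp
  rw [heq] at hvar
  have hcheb := meas_ge_le_variance_div_sq
    (memLp_finsetSum W fun u _ => h.memLp hM n u 2) hc
  rw [hmean] at hcheb
  refine ENNReal.toReal_le_of_le_ofReal (by positivity) (hcheb.trans ?_)
  gcongr

/-! ### Requests surrounded by typical windows -/

/-- The requests whose following and preceding windows of `m` requests have average length at
least `x'` and average read rate at least `y'`, respectively. -/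
noncomputable def typical (m : ℕ) (x' y' : ℝ) {n : ℕ} (I : Fin n → Request) : Finset ℕ :=
  open Classical in
  (Finset.range n).filter fun u => (m ≤ u ∧ u + m ≤ n) ∧
    m * x' ≤ ∑ j ∈ Finset.range m, (len I (u + j) : ℝ) ∧
    m * y' ≤ ∑ j ∈ Finset.range m, (rate I (u - j) : ℝ)

lemma mem_typical {m : ℕ} {x' y' : ℝ} {n : ℕ} {I : Fin n → Request} {u : ℕ} :
    u ∈ typical m x' y' I ↔ u < n ∧ (m ≤ u ∧ u + m ≤ n) ∧
      m * x' ≤ ∑ j ∈ Finset.range m, (len I (u + j) : ℝ) ∧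
      m * y' ≤ ∑ j ∈ Finset.range m, (rate I (u - j) : ℝ) := by
  simp only [typical, Finset.mem_filter, Finset.mem_range]

lemma typical_subset (m : ℕ) (x' y' : ℝ) {n : ℕ} (I : Fin n → Request) :
    typical m x' y' I ⊆ Finset.range n := by
  intro u hu
  exact Finset.mem_range.mpr (mem_typical.mp hu).1

lemma measurableSet_mem_typical (m : ℕ) (x' y' : ℝ) (n u : ℕ) :
    MeasurableSet {I : Fin n → Request | u ∈ typical m x' y' I} := by
  simp only [mem_typical, coe_len, coe_rate_eq]
  have h1 : Measurable fun I : Fin n → Request =>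
      ∑ j ∈ Finset.range m, coord lenFun I (u + j) :=
    Finset.measurable_fun_sum _ fun j _ => measurable_coord measurable_lenFun _
  have h2 : Measurable fun I : Fin n → Request =>
      ∑ j ∈ Finset.range m, coord rateFun I (u - j) :=
    Finset.measurable_fun_sum _ fun j _ => measurable_coord measurable_rateFun _
  exact (MeasurableSet.const _).inter ((MeasurableSet.const _).inter
    ((measurableSet_le measurable_const h1).inter (measurableSet_le measurable_const h2)))

lemma card_typical (m : ℕ) (x' y' : ℝ) {n : ℕ} (I : Fin n → Request) :
    ((typical m x' y' I).card : ℝ)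
      = ∑ u ∈ Finset.range n, Set.indicator {I | u ∈ typical m x' y' I} 1 I := by
  classical
  simp only [Set.indicator_apply, Set.mem_ofPred_eq, Pi.one_apply]
  rw [Finset.sum_ite_mem, Finset.inter_eq_right.mpr (typical_subset _ _ _ I)]
  simp

lemma integrable_indicator_typical (m : ℕ) (x' y' : ℝ) (n u : ℕ) :
    Integrable (Set.indicator {I : Fin n → Request | u ∈ typical m x' y' I} (1 : (Fin n → Request) → ℝ))
      (iid p n) :=
  (integrable_const (1 : ℝ)).indicator (measurableSet_mem_typical m x' y' n u)

lemma integrable_card_typical (m : ℕ) (x' y' : ℝ) (n : ℕ) :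
    Integrable (fun I : Fin n → Request => ((typical m x' y' I).card : ℝ)) (iid p n) := by
  simp_rw [card_typical]
  exact integrable_finsetSum _ fun u _ => integrable_indicator_typical m x' y' n u

lemma prob_window_le (h : BoundedBy p ψ M) (hM : 0 ≤ M) {n m : ℕ} (hm : 1 ≤ m)
    {f : ℕ → ℕ} (hf : Set.InjOn f (Finset.range m)) (hfn : ∀ j < m, f j < n) {ε : ℝ} (hε : 0 < ε)
    {x : ℝ} (hx : ∫ z, ψ z ∂p = x) (hx0 : 0 ≤ x) :
    (iid p n).real {I | ¬ m * ((1 - ε) * x) ≤ ∑ j ∈ Finset.range m, coord ψ I (f j)}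
      ≤ (M / (ε * x)) ^ 2 / m := by
  have hm0 : (0 : ℝ) < m := by exact_mod_cast hm
  rcases hx0.eq_or_lt with rfl | hxpos
  · have : {I : Fin n → Request |
        ¬ (m : ℝ) * ((1 - ε) * 0) ≤ ∑ j ∈ Finset.range m, coord ψ I (f j)} = ∅ := by
      rw [Set.eq_empty_iff_forall_notMem]
      intro I hI
      refine hI ?_
      rw [mul_zero, mul_zero]
      exact Finset.sum_nonneg fun j _ => h.coord_nonneg I _
    rw [this]
    simp
  have hdev := h.prob_sum_dev_le hM (n := n) (W := (Finset.range m).image f)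
    (by simpa using hfn) (c := m * (ε * x)) (by positivity)
  rw [Finset.card_image_of_injOn hf, Finset.card_range, hx] at hdev
  calc _ ≤ (iid p n).real {I | m * (ε * x)
          ≤ |∑ u ∈ (Finset.range m).image f, coord ψ I u - m * x|} := by
        refine measureReal_mono fun I hI => ?_
        simp only [Set.mem_ofPred_eq, not_le] at hI ⊢
        rw [Finset.sum_image hf]
        refine le_trans ?_ (neg_le_abs _)
        linarith
    _ ≤ _ := hdev
    _ = _ := by field_simp

lemma meanLength_nonneg (p : Measure Request) : 0 ≤ meanLength p :=
  integral_nonneg fun x => x.1.2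

lemma meanRate_nonneg (p : Measure Request) : 0 ≤ meanRate p :=
  integral_nonneg fun x => x.2.2

/-- For sufficiently long windows, all but a small fraction of the requests are typical. -/
lemma exists_le_integral_card_typical (hp : IsBoundedDist p) {ε δ : ℝ} (hε : 0 < ε)
    (hδ : 0 < δ) (hδ1 : δ ≤ 1) :
    ∃ m : ℕ, 1 ≤ m ∧ ∀ n : ℕ, (1 - δ) * (n - 2 * m) ≤
      ∫ I, ((typical m ((1 - ε) * meanLength p) ((1 - ε) * meanRate p) I).card : ℝ) ∂(iid p n) := by
  obtain ⟨M, hM, hl, hr⟩ := hp.exists_boundedBy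
  set x := meanLength p with hx
  set y := meanRate p with hy
  set C := (M / (ε * x)) ^ 2 + (M / (ε * y)) ^ 2 with hC
  obtain ⟨m, hm⟩ := exists_nat_ge (C / δ)
  refine ⟨m + 1, by omega, fun n => ?_⟩
  set m' := m + 1 with hm'
  have hm'0 : (0 : ℝ) < m' := by positivity
  have hCm : C / m' ≤ δ := by
    rw [div_le_iff₀ hm'0]
    rw [div_le_iff₀ hδ] at hm
    rw [hm']; push_cast; nlinarith
  simp_rw [card_typical]
  rw [integral_finsetSum _ fun u _ => integrable_indicator_typical m' _ _ n u]
  have hu : ∀ u ∈ Finset.Ico m' (n + 1 - m'), 1 - δ ≤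
      ∫ I, Set.indicator {I : Fin n → Request |
        u ∈ typical m' ((1 - ε) * x) ((1 - ε) * y) I} (1 : (Fin n → Request) → ℝ) I ∂(iid p n) := by
    intro u hu
    rw [Finset.mem_Ico] at hu
    rw [integral_indicator_one (measurableSet_mem_typical m' _ _ n u)]
    have hcompl := measureReal_compl (μ := iid p n)
      (measurableSet_mem_typical m' ((1 - ε) * x) ((1 - ε) * y) n u)
    rw [probReal_univ] at hcompl
    have hbad : (iid p n).real {I : Fin n → Request |
        u ∈ typical m' ((1 - ε) * x) ((1 - ε) * y) I}ᶜ ≤ C / m' := by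
      have h1 := prob_window_le hl hM (n := n) (m := m') (by omega) (f := fun j => u + j)
        (fun a _ b _ hab => by simpa using hab) (fun j hj => by omega) hε (x := x) rfl
        (meanLength_nonneg p)
      have h2 := prob_window_le hr hM (n := n) (m := m') (by omega) (f := fun j => u - j)
        (fun a ha b hb hab => by
          simp only [Finset.coe_range, Set.mem_Iio] at ha hb hab; omega)
        (fun j hj => by omega) hε (x := y) rfl (meanRate_nonneg p)
      have hsub : {I : Fin n → Request | u ∈ typical m' ((1 - ε) * x) ((1 - ε) * y) I}ᶜ ⊆
          {I | ¬ m' * ((1 - ε) * x) ≤ ∑ j ∈ Finset.range m', coord lenFun I (u + j)} ∪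
          {I | ¬ m' * ((1 - ε) * y) ≤ ∑ j ∈ Finset.range m', coord rateFun I (u - j)} := by
        intro I hI
        rw [Set.mem_compl_iff, Set.mem_ofPred_eq, mem_typical] at hI
        simp only [coe_len, coe_rate_eq] at hI
        rw [Set.mem_union, Set.mem_ofPred_eq, Set.mem_ofPred_eq]
        by_contra hcon
        push Not at hcon
        exact hI ⟨by omega, ⟨by omega, by omega⟩, hcon.1, hcon.2⟩
      refine (measureReal_mono hsub).trans ((measureReal_union_le _ _).trans ?_)
      rw [hC, add_div]
      exact add_le_add h1 h2
    linarith
  calc (1 - δ) * (n - 2 * m') ≤ (1 - δ) * ((n + 1 - m' - m' : ℕ) : ℝ) := by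
        refine mul_le_mul_of_nonneg_left ?_ (by linarith)
        have : (n : ℝ) ≤ ((n + 1 - m' - m' : ℕ) : ℝ) + 2 * m' := by
          exact_mod_cast (by omega : n ≤ (n + 1 - m' - m') + 2 * m')
        linarith
    _ = ∑ u ∈ Finset.Ico m' (n + 1 - m'), (1 - δ) := by
        rw [Finset.sum_const, Nat.card_Ico, nsmul_eq_mul, mul_comm]
    _ ≤ _ := Finset.sum_le_sum hu
    _ ≤ _ := by
        refine Finset.sum_le_sum_of_subset_of_nonneg ?_ fun u _ _ =>
          integral_nonneg fun I => Set.indicator_nonneg (fun _ _ => zero_le_one) I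
        intro u hu
        rw [Finset.mem_Ico] at hu
        rw [Finset.mem_range]
        omega

lemma BoundedBy.integral_sum_coord (h : BoundedBy p ψ M) (hM : 0 ≤ M) (n : ℕ) :
    ∫ I, ∑ u ∈ Finset.range n, coord ψ I u ∂(iid p n) = n * ∫ x, ψ x ∂p := by
  rw [integral_finsetSum _ fun u _ => h.integrable_coord hM n u,
    Finset.sum_congr rfl fun u hu => integral_coord h.measurable (Finset.mem_range.mp hu),
    Finset.sum_const, Finset.card_range, nsmul_eq_mul]

/-- Expectation of a pathwise lower bound in terms of the number of typical requests. -/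
lemma le_integral_of_typical (hp : IsBoundedDist p) {m n : ℕ} {x' y' δ c l Φ : ℝ}
    (hcard : (1 - δ) * (n - 2 * m) ≤ ∫ I, ((typical m x' y' I).card : ℝ) ∂(iid p n))
    (hc : 0 ≤ c) (hl : 0 ≤ l) {F : (Fin n → Request) → ℝ} (hF : Integrable F (iid p n))
    (h : ∀ᵐ I ∂(iid p n), c * (l * (typical m x' y' I).card - Φ)
      ≤ F I + m * ∑ u ∈ Finset.range n, (len I u : ℝ)
        + m * ∑ u ∈ Finset.range n, (rate I u : ℝ)) :
    c * (l * ((1 - δ) * (n - 2 * m)) - Φ) - m * n * (meanLength p + meanRate p)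
      ≤ ∫ I, F I ∂(iid p n) := by
  obtain ⟨M, hM, hlen, hrate⟩ := hp.exists_boundedBy
  simp only [coe_len, coe_rate_eq] at h
  have i1 : Integrable (fun I : Fin n → Request =>
      (m : ℝ) * ∑ u ∈ Finset.range n, coord lenFun I u) (iid p n) :=
    (integrable_finsetSum _ fun u _ => hlen.integrable_coord hM n u).const_mul _
  have i2 : Integrable (fun I : Fin n → Request =>
      (m : ℝ) * ∑ u ∈ Finset.range n, coord rateFun I u) (iid p n) :=
    (integrable_finsetSum _ fun u _ => hrate.integrable_coord hM n u).const_mul _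
  have i3 := integrable_card_typical (p := p) m x' y' n
  have i4 : Integrable (fun I : Fin n → Request =>
      c * (l * ((typical m x' y' I).card : ℝ) - Φ)) (iid p n) :=
    ((i3.const_mul l).sub (integrable_const Φ)).const_mul c
  have key := integral_mono_ae i4 ((hF.add i1).add i2) h
  have e1 : ∫ I, c * (l * ((typical m x' y' I).card : ℝ) - Φ) ∂(iid p n)
      = c * (l * ∫ I, ((typical m x' y' I).card : ℝ) ∂(iid p n) - Φ) := by
    rw [integral_const_mul, integral_sub (i3.const_mul l) (integrable_const Φ), integral_const_mul]
    simp
  rw [e1, integral_add' (hF.add i1) i2, integral_add' hF i1, integral_const_mul, integral_const_mul,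
    hlen.integral_sum_coord hM, hrate.integral_sum_coord hM] at key
  change _ ≤ _ + m * (n * meanLength p) + m * (n * meanRate p) at key
  have : c * (l * ((1 - δ) * (n - 2 * m)) - Φ)
      ≤ c * (l * ∫ I, ((typical m x' y' I).card : ℝ) ∂(iid p n) - Φ) := by gcongr
  linarith

end

/-! ### Measurability and integrability of costs -/

lemma measurable_cost (f : ℕ → ℝ≥0∞) {n : ℕ} (σ : Schedule n) :
    Measurable fun I : Fin n → Request => cost f I σ := by
  unfold cost
  refine Finset.measurable_fun_sum _ fun t _ => Measurable.fun_add ?_ ?_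
  · have h : (fun I : Fin n → Request => (mergeCost I σ t : ℝ≥0∞))
        = fun I => ENNReal.ofReal (∑ u ∈ topFile (size (0 : Fin n → Request) σ) t,
          coord lenFun I u) := by
      funext I
      rw [coe_mergeCost, mergeLen, size_congr I 0]
      simp_rw [coe_len]
    rw [h]
    exact (Finset.measurable_fun_sum _ fun u _ => measurable_coord measurable_lenFun u).ennreal_ofReal
  · have h : ∀ I : Fin n → Request, stackSize I σ t = size (0 : Fin n → Request) σ t :=
      fun I => congrFun (size_congr I 0 σ) t
    simp_rw [h]
    unfold readCost
    split_ifs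
    · exact measurable_const
    · fun_prop

lemma measurable_schedule {A : OnlineAlgorithm} (hA : ∀ t, Measurable (A t)) (n : ℕ) :
    Measurable fun I : Fin n → Request => A.schedule I := by
  refine measurable_pi_lambda _ fun t => ?_
  exact (hA t).comp (measurable_pi_lambda _ fun i => measurable_pi_apply _)

lemma measurable_algCost {A : OnlineAlgorithm} (hA : ∀ t, Measurable (A t)) (f : ℕ → ℝ≥0∞)
    (n : ℕ) : Measurable fun I : Fin n → Request => A.cost f I := by
  have h : Measurable fun q : (Fin n → Request) × Schedule n => cost f q.1 q.2 :=
    measurable_from_prod_countable_left fun σ => measurable_cost f σ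
  have h2 := measurable_id.prodMk (measurable_schedule hA n)
  have h3 : (fun I : Fin n → Request => A.cost f I)
      = (fun q : (Fin n → Request) × Schedule n => cost f q.1 q.2)
        ∘ fun I => (id I, A.schedule I) := rfl
  rw [h3]
  exact h.comp h2

lemma measurable_opt (f : ℕ → ℝ≥0∞) (n : ℕ) : Measurable fun I : Fin n → Request => opt f I := by
  unfold opt
  exact Measurable.iInf fun σ => measurable_cost f σ

lemma opt_le_algCost (A : OnlineAlgorithm) (f : ℕ → ℝ≥0∞) {n : ℕ} (I : Fin n → Request) :
    opt f I ≤ A.cost f I := iInf_le _ _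

lemma integrable_opt {A : OnlineAlgorithm} {f : ℕ → ℝ≥0∞} {n : ℕ} {p : Measure Request}
    (hfin : ∀ I : Fin n → Request, A.cost f I ≠ ⊤)
    (hint : Integrable (fun I => (A.cost f I).toReal) (iid p n)) :
    Integrable (fun I => (opt f I).toReal) (iid p n) := by
  refine hint.mono' (measurable_opt f n).ennreal_toReal.aestronglyMeasurable ?_
  filter_upwards with I
  rw [Real.norm_of_nonneg ENNReal.toReal_nonneg]
  exact ENNReal.toReal_mono (hfin I) (opt_le_algCost A f I)

lemma le_toReal_opt {f : ℕ → ℝ≥0∞} {n : ℕ} {I : Fin n → Request} {c : ℝ} (hfin : opt f I ≠ ⊤)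
    (h : ∀ σ : Schedule n, cost f I σ ≠ ⊤ → c ≤ (cost f I σ).toReal) : c ≤ (opt f I).toReal := by
  refine (ENNReal.ofReal_le_iff_le_toReal hfin).mp (le_iInf fun σ => ?_)
  by_cases hσ : cost f I σ = ⊤
  · rw [hσ]; exact le_top
  · exact (ENNReal.ofReal_le_iff_le_toReal hσ).mpr (h σ hσ)

lemma expectedOpt_le {A : OnlineAlgorithm} {f : ℕ → ℝ≥0∞} {n : ℕ} {p : Measure Request}
    (hfin : ∀ I : Fin n → Request, A.cost f I ≠ ⊤)
    (hint : Integrable (fun I => (A.cost f I).toReal) (iid p n)) :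
    expectedOpt f p n ≤ expectedCost A f p n :=
  integral_mono (integrable_opt hfin hint) hint fun I =>
    ENNReal.toReal_mono (hfin I) (opt_le_algCost A f I)

/-- Two sequences between almost matching bounds are asymptotically equivalent to the bounds and
to each other. -/
lemma isEquivalent_of_squeeze {u v g : ℕ → ℝ} (hg : ∀ᶠ n in atTop, 0 < g n)
    (huv : ∀ n, u n ≤ v n) (hlo : ∀ η > 0, ∀ᶠ n in atTop, (1 - η) * g n ≤ u n)
    (hhi : ∀ η > 0, ∀ᶠ n in atTop, v n ≤ (1 + η) * g n) : v ~[atTop] u ∧ u ~[atTop] g := by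
  have key : ∀ w : ℕ → ℝ, (∀ n, u n ≤ w n) → (∀ n, w n ≤ v n) → w ~[atTop] g := by
    intro w h1 h2
    refine IsLittleO.of_bound fun c hc => ?_
    filter_upwards [hg, hlo c hc, hhi c hc] with n hn hl hh
    rw [Pi.sub_apply, Real.norm_eq_abs, Real.norm_of_nonneg hn.le, abs_le]
    constructor <;> nlinarith [h1 n, h2 n]
  have hu := key u (fun _ => le_rfl) huv
  exact ⟨(key v huv fun _ => le_rfl).trans hu.symm, hu⟩

/-! ### The algorithm for at most `K` levels -/

/-- The largest `d` with `(d + K).choose K ≤ t + 1`. -/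
def levelIndex (K t : ℕ) : ℕ := Nat.findGreatest (fun d => (d + K).choose K ≤ t + 1) t

/-- The stack size after request `t` (counted from `0`) of the algorithm for at most `K` levels,
in terms of the representation of `t + 1` in the combinatorial number system. All requests are
merged at the times `t + 1 = (d + K).choose K`; between two such times, the algorithm for `K - 1`
levels runs on top of the merged file. -/
def levels : ℕ → ℕ → ℕ
  | 0, _ => 0
  | K + 1, t =>
    if (levelIndex (K + 1) t + (K + 1)).choose (K + 1) = t + 1 then 1
    else 1 + levels K (t - (levelIndex (K + 1) t + (K + 1)).choose (K + 1))

lemma lt_choose_succ (d K : ℕ) : d < (d + (K + 1)).choose (K + 1) := by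
  induction d with
  | zero => simp
  | succ d ih =>
    rw [show d + 1 + (K + 1) = d + (K + 1) + 1 by ring, Nat.choose_succ_succ']
    have : 0 < (d + (K + 1)).choose K := Nat.choose_pos (by omega)
    omega

lemma levelIndex_eq {K d t : ℕ} (h1 : (d + (K + 1)).choose (K + 1) ≤ t + 1)
    (h2 : t + 1 < (d + 1 + (K + 1)).choose (K + 1)) : levelIndex (K + 1) t = d := by
  unfold levelIndex
  rw [Nat.findGreatest_eq_iff]
  have := lt_choose_succ d K
  refine ⟨by omega, fun _ => h1, fun k hk hk' h => ?_⟩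
  have : (d + 1 + (K + 1)).choose (K + 1) ≤ (k + (K + 1)).choose (K + 1) :=
    Nat.choose_le_choose _ (by omega)
  omega

lemma exists_levelIndex (K t : ℕ) : ∃ d, (d + (K + 1)).choose (K + 1) ≤ t + 1 ∧
    t + 1 < (d + 1 + (K + 1)).choose (K + 1) := by
  refine ⟨levelIndex (K + 1) t, ?_, ?_⟩
  · exact Nat.findGreatest_spec (P := fun d => (d + (K + 1)).choose (K + 1) ≤ t + 1)
      (Nat.zero_le t) (by simp)
  · by_contra hcon
    push Not at hcon
    have h1 := lt_choose_succ (levelIndex (K + 1) t + 1) K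
    have := Nat.le_findGreatest (P := fun d => (d + (K + 1)).choose (K + 1) ≤ t + 1)
      (n := t) (m := levelIndex (K + 1) t + 1) (by omega) hcon
    change _ ≤ levelIndex (K + 1) t at this
    omega

lemma choose_pascal (d K : ℕ) : (d + 1 + (K + 1)).choose (K + 1)
    = (d + (K + 1)).choose (K + 1) + (d + 1 + K).choose K := by
  rw [show d + 1 + (K + 1) = (d + (K + 1)) + 1 by ring, Nat.choose_succ_succ,
    show d + (K + 1) = d + 1 + K by ring]
  ring

lemma levels_root {K d t : ℕ} (h : t + 1 = (d + (K + 1)).choose (K + 1)) :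
    levels (K + 1) t = 1 := by
  have hd : levelIndex (K + 1) t = d := by
    refine levelIndex_eq h.ge ?_
    rw [choose_pascal, h]
    have : 0 < (d + 1 + K).choose K := Nat.choose_pos (by omega)
    omega
  rw [levels, hd, if_pos h.symm]

lemma levels_inner {K d j : ℕ} (h : j + 1 < (d + 1 + K).choose K) :
    levels (K + 1) ((d + (K + 1)).choose (K + 1) + j) = 1 + levels K j := by
  have hd : levelIndex (K + 1) ((d + (K + 1)).choose (K + 1) + j) = d := by
    refine levelIndex_eq (by omega) ?_
    rw [choose_pascal]
    omega
  rw [levels, hd, if_neg (by omega), Nat.add_sub_cancel_left]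

/-- Every time is a time at which all requests are merged, or lies between two of them. -/
lemma exists_root_or_inner (K t : ℕ) : (∃ d, t + 1 = (d + (K + 1)).choose (K + 1)) ∨
    ∃ d j, t = (d + (K + 1)).choose (K + 1) + j ∧ j + 1 < (d + 1 + K).choose K := by
  obtain ⟨d, h1, h2⟩ := exists_levelIndex K t
  rcases h1.eq_or_lt with h | h
  · exact Or.inl ⟨d, h.symm⟩
  · refine Or.inr ⟨d, t - (d + (K + 1)).choose (K + 1), by omega, ?_⟩
    rw [choose_pascal] at h2
    omega

lemma levels_le (K t : ℕ) : levels K t ≤ K := by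
  induction K generalizing t with
  | zero => simp [levels]
  | succ K ih =>
    rw [levels]
    split_ifs
    · omega
    · have := ih (t - (levelIndex (K + 1) t + (K + 1)).choose (K + 1)); omega

lemma one_le_levels (K t : ℕ) : 1 ≤ levels (K + 1) t := by
  rw [levels]; split_ifs <;> omega

lemma levels_zero_le (K : ℕ) : levels K 0 ≤ 1 := by
  cases K with
  | zero => simp [levels]
  | succ K => rw [levels_root (d := 0) (by simp)]

lemma levels_succ_le (K t : ℕ) : levels K (t + 1) ≤ levels K t + 1 := by
  induction K generalizing t with
  | zero => simp [levels]
  | succ K ih =>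
    rcases exists_root_or_inner K (t + 1) with ⟨d, hd⟩ | ⟨d, j, hj, hlt⟩
    · rw [levels_root hd]; omega
    · rw [hj, levels_inner hlt]
      cases j with
      | zero =>
        rw [levels_root (t := t) (d := d) (by omega)]
        have := levels_zero_le K
        omega
      | succ j =>
        rw [show t = (d + (K + 1)).choose (K + 1) + j by omega, levels_inner (by omega)]
        have := ih j
        omega

lemma card_topFile_le (b : ℕ → ℕ) (t : ℕ) : (topFile b t).card ≤ t + 1 := by
  calc _ ≤ (Finset.range (t + 1)).card := Finset.card_filter_le _ _
    _ = t + 1 := Finset.card_range _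

lemma card_topFile_inner {K d j : ℕ} (h : j + 1 < (d + 1 + K).choose K) :
    (topFile (levels (K + 1)) ((d + (K + 1)).choose (K + 1) + j)).card
      ≤ (topFile (levels K) j).card := by
  set c := (d + (K + 1)).choose (K + 1) with hc
  have hc0 : 0 < c := Nat.choose_pos (by omega)
  cases K with
  | zero => simp at h
  | succ K =>
    refine (Finset.card_le_card ?_).trans
      (Finset.card_map (addLeftEmbedding c) (s := topFile (levels (K + 1)) j)).le
    intro u hu
    rw [mem_topFile, hc, levels_inner h, ← hc] at hu
    have hcu : c ≤ u := by
      by_contra hlt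
      have := hu.2 (c - 1) (by omega) (by omega)
      rw [levels_root (K := K + 1) (t := c - 1) (d := d) (by omega)] at this
      have := one_le_levels K j
      omega
    obtain ⟨v, rfl⟩ : ∃ v, u = c + v := ⟨u - c, by omega⟩
    rw [Finset.mem_map]
    refine ⟨v, ?_, rfl⟩
    rw [mem_topFile]
    refine ⟨by omega, fun s hs hs' => ?_⟩
    have := hu.2 (c + s) (by omega) (by omega)
    rw [hc, levels_inner (by omega)] at this
    omega

lemma sum_topFile_levels_succ_le (K : ℕ)
    (ih : ∀ d, ∑ t ∈ Finset.range ((d + K).choose K - 1), (topFile (levels K) t).card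
      ≤ K * (d + K + 1).choose (K + 1)) (d : ℕ) :
    ∑ t ∈ Finset.range ((d + (K + 1)).choose (K + 1)), (topFile (levels (K + 1)) t).card
      ≤ (K + 1) * (d + (K + 1) + 1).choose (K + 1 + 1) := by
  induction d with
  | zero =>
    have := card_topFile_le (levels (K + 1)) 0
    simp only [zero_add, Nat.choose_self, Finset.sum_range_one]
    omega
  | succ d ihd =>
    have hpos : 0 < (d + 1 + K).choose K := Nat.choose_pos (by omega)
    obtain ⟨q, hq⟩ : ∃ q, (d + 1 + K).choose K = q + 1 := ⟨(d + 1 + K).choose K - 1, by omega⟩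
    have ihK := ih (d + 1)
    rw [hq, Nat.add_sub_cancel] at ihK
    have hinner : ∑ j ∈ Finset.range q,
        (topFile (levels (K + 1)) ((d + (K + 1)).choose (K + 1) + j)).card
        ≤ ∑ j ∈ Finset.range q, (topFile (levels K) j).card := by
      refine Finset.sum_le_sum fun j hj => card_topFile_inner ?_
      rw [Finset.mem_range] at hj
      omega
    have hlast := card_topFile_le (levels (K + 1)) ((d + (K + 1)).choose (K + 1) + q)
    have hp := choose_pascal d K
    rw [hp, Finset.sum_range_add, hq, Finset.sum_range_succ]
    have h1 : (d + 1 + (K + 1) + 1).choose (K + 1 + 1)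
        = (d + (K + 1) + 1).choose (K + 1 + 1) + (d + 1 + (K + 1)).choose (K + 1) := by
      have := choose_pascal d (K + 1)
      simpa only [add_assoc] using this
    have h2 : (d + 1 + K + 1).choose (K + 1) = (d + 1 + (K + 1)).choose (K + 1) := rfl
    rw [h2] at ihK
    rw [h1]
    generalize (d + (K + 1) + 1).choose (K + 1 + 1) = X at *
    generalize (d + 1 + (K + 1)).choose (K + 1) = Y at *
    nlinarith

lemma sum_topFile_levels_le_aux (K d : ℕ) :
    ∑ t ∈ Finset.range ((d + K).choose K - 1), (topFile (levels K) t).card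
      ≤ K * (d + K + 1).choose (K + 1) := by
  induction K generalizing d with
  | zero => simp
  | succ K ih =>
    refine le_trans ?_ (sum_topFile_levels_succ_le K ih d)
    exact Finset.sum_le_sum_of_subset (Finset.range_subset_range.mpr (by omega))

/-- The total number of requests merged during the first `n` steps of the algorithm for at most
`K` levels. -/
lemma sum_topFile_levels_le {K : ℕ} (hK : 1 ≤ K) {n : ℕ} (hn : 1 ≤ n) :
    ∃ d : ℕ, (d + K).choose K ≤ n ∧
      ∑ t ∈ Finset.range n, (topFile (levels K) t).card ≤ K * (d + K + 2).choose (K + 1) := by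
  obtain ⟨K, rfl⟩ : ∃ k, K = k + 1 := ⟨K - 1, by omega⟩
  obtain ⟨d, h1, h2⟩ := exists_levelIndex K (n - 1)
  refine ⟨d, by omega, ?_⟩
  have := sum_topFile_levels_succ_le K (sum_topFile_levels_le_aux K) (d + 1)
  rw [show d + (K + 1) + 2 = d + 1 + (K + 1) + 1 by ring]
  refine le_trans (Finset.sum_le_sum_of_subset (Finset.range_subset_range.mpr (by omega))) this

/-- The online algorithm that realizes the stack sizes `b`, whatever the requests are. -/
def obliviousAlgorithm (b : ℕ → ℕ) : OnlineAlgorithm := fun t _ => b (t - 1) + 1 - b t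

lemma size_oblivious {b : ℕ → ℕ} (h0 : b 0 = 1) (hpos : ∀ t, 1 ≤ b t)
    (hsucc : ∀ t, b (t + 1) ≤ b t + 1) {n : ℕ} (I : Fin n → Request) {t : ℕ} (ht : t < n) :
    size I ((obliviousAlgorithm b).schedule I) t = b t := by
  induction t with
  | zero => rw [size_zero I _ ht, h0]
  | succ t ih =>
    rw [size_succ I _ ht, ih (by omega)]
    have h1 := hpos (t + 1)
    have h2 := hsucc t
    simp only [OnlineAlgorithm.schedule, obliviousAlgorithm, Nat.add_sub_cancel]
    omega

lemma topFile_congr {b c : ℕ → ℕ} {t : ℕ} (h : ∀ s ≤ t, b s = c s) :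
    topFile b t = topFile c t := by
  ext u
  rw [mem_topFile, mem_topFile]
  refine and_congr_right fun _ => forall_congr' fun s => forall_congr' fun _ =>
    forall_congr' fun hs => ?_
  rw [h t le_rfl, h s hs]

/-- The algorithm for at most `K` levels. -/
def levelAlgorithm (K : ℕ) : OnlineAlgorithm := obliviousAlgorithm (levels K)

lemma size_levelAlgorithm {K : ℕ} (hK : 1 ≤ K) {n : ℕ} (I : Fin n → Request) {t : ℕ}
    (ht : t < n) : size I ((levelAlgorithm K).schedule I) t = levels K t := by
  obtain ⟨K, rfl⟩ : ∃ k, K = k + 1 := ⟨K - 1, by omega⟩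
  exact size_oblivious (levels_root (d := 0) (by simp)) (one_le_levels K) (levels_succ_le _) I ht

lemma cost_levelAlgorithm {K : ℕ} (hK : 1 ≤ K) {n : ℕ} (I : Fin n → Request) :
    (levelAlgorithm K).cost (fLevels K) I = ENNReal.ofReal
      (∑ t ∈ Finset.range n, ∑ u ∈ topFile (levels K) t, coord lenFun I u) := by
  rw [OnlineAlgorithm.cost, cost_fLevels I _ fun t ht => by
    rw [size_levelAlgorithm hK I ht]; exact levels_le K t]
  congr 1
  refine Finset.sum_congr rfl fun t ht => ?_
  rw [Finset.mem_range] at ht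
  simp_rw [mergeLen, coe_len]
  rw [topFile_congr fun s hs => size_levelAlgorithm hK I (lt_of_le_of_lt hs ht)]

lemma toReal_cost_levelAlgorithm {K : ℕ} (hK : 1 ≤ K) {n : ℕ} (I : Fin n → Request) :
    ((levelAlgorithm K).cost (fLevels K) I).toReal
      = ∑ t ∈ Finset.range n, ∑ u ∈ topFile (levels K) t, coord lenFun I u := by
  rw [cost_levelAlgorithm hK, ENNReal.toReal_ofReal]
  refine Finset.sum_nonneg fun t _ => Finset.sum_nonneg fun u _ => ?_
  rw [← coe_len]
  exact NNReal.coe_nonneg _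

section
variable {p : Measure Request} [IsProbabilityMeasure p]

lemma integrable_cost_levelAlgorithm (hp : IsBoundedDist p) {K : ℕ} (hK : 1 ≤ K) (n : ℕ) :
    Integrable (fun I => ((levelAlgorithm K).cost (fLevels K) I).toReal) (iid p n) := by
  obtain ⟨M, hM, hl, _⟩ := hp.exists_boundedBy
  simp_rw [toReal_cost_levelAlgorithm hK]
  exact integrable_finsetSum _ fun t _ => integrable_finsetSum _ fun u _ =>
    hl.integrable_coord hM n u

lemma expectedCost_levelAlgorithm (hp : IsBoundedDist p) {K : ℕ} (hK : 1 ≤ K) (n : ℕ) :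
    expectedCost (levelAlgorithm K) (fLevels K) p n
      = meanLength p * (∑ t ∈ Finset.range n, (topFile (levels K) t).card : ℕ) := by
  obtain ⟨M, hM, hl, _⟩ := hp.exists_boundedBy
  unfold expectedCost
  simp_rw [toReal_cost_levelAlgorithm hK]
  rw [integral_finsetSum _ fun t _ => integrable_finsetSum _ fun u _ =>
    hl.integrable_coord hM n u]
  push_cast
  rw [Finset.mul_sum]
  refine Finset.sum_congr rfl fun t ht => ?_
  rw [Finset.mem_range] at ht
  rw [integral_finsetSum _ fun u _ => hl.integrable_coord hM n u,
    Finset.sum_congr rfl fun u hu => integral_coord hl.measurable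
      (show u < n by rw [mem_topFile] at hu; omega), Finset.sum_const, nsmul_eq_mul, mul_comm]
  rfl

/-! ### Asymptotics for at most `K` levels -/

lemma opt_fLevels_lower (hp : IsBoundedDist p) {K : ℕ} (hK : 1 ≤ K) {m n D : ℕ} (hm : 1 ≤ m)
    (hD : 1 ≤ D) {ε δ : ℝ} (hε1 : ε ≤ 1)
    (hcard : (1 - δ) * (n - 2 * m) ≤ ∫ I, ((typical m ((1 - ε) * meanLength p)
      ((1 - ε) * meanRate p) I).card : ℝ) ∂(iid p n)) :
    (1 - ε) * meanLength p * (D * ((1 - δ) * (n - 2 * m)) - ((D + K).choose (K + 1) : ℕ))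
      - m * n * (meanLength p + meanRate p) ≤ expectedOpt (fLevels K) p n := by
  have hc : 0 ≤ (1 - ε) * meanLength p :=
    mul_nonneg (by linarith) (meanLength_nonneg p)
  have hfin : ∀ I : Fin n → Request, (levelAlgorithm K).cost (fLevels K) I ≠ ⊤ := fun I => by
    rw [cost_levelAlgorithm hK]; exact ENNReal.ofReal_ne_top
  refine le_integral_of_typical hp hcard hc (Nat.cast_nonneg D)
    (integrable_opt hfin (integrable_cost_levelAlgorithm hp hK n)) (ae_of_all _ fun I => ?_)
  set S := typical m ((1 - ε) * meanLength p) ((1 - ε) * meanRate p) I with hS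
  rw [add_assoc, ← sub_le_iff_le_add]
  refine le_toReal_opt (ne_top_of_le_ne_top (hfin I) (opt_le_algCost _ _ I)) fun σ hσ => ?_
  have hsize : ∀ t < n, size I σ t ≤ K := by
    intro t ht
    by_contra hcon
    exact hσ (cost_fLevels_eq_top I σ ht (not_le.mp hcon))
  rw [cost_fLevels I σ hsize, ENNReal.toReal_ofReal (Finset.sum_nonneg fun t _ =>
    mergeLen_nonneg I σ t), sum_mergeLen]
  have h1 := window_records_le hm (size I σ) (w := fun u => (len I u : ℝ))
    (fun u => NNReal.coe_nonneg _) (S := S) (n := n) (c := (1 - ε) * meanLength p)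
    (fun u hu => (mem_typical.mp hu).2.1.2) (fun u hu => (mem_typical.mp hu).2.2.1)
  have h2 := sum_sub_records_le hD (b := size I σ) (n := n)
    (fun t ht => ⟨one_le_size I σ ht, hsize t ht⟩) (typical_subset _ _ _ I : S ⊆ _)
  rw [Finset.sum_sub_distrib, Finset.sum_const, nsmul_eq_mul] at h2
  have h3 : (0 : ℝ) ≤ m * ∑ u ∈ Finset.range n, (rate I u : ℝ) := by positivity
  have h4 : (1 - ε) * meanLength p * (D * S.card - ((D + K).choose (K + 1) : ℕ))
      ≤ (1 - ε) * meanLength p * ∑ u ∈ S, (records (size I σ) n u : ℝ) :=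
    mul_le_mul_of_nonneg_left (by linarith) hc
  linarith

end

section
variable {K : ℕ}

lemma rpow_one_div_pow (hK : 1 ≤ K) (n : ℕ) : ((n : ℝ) ^ (1 / (K : ℝ))) ^ K = n := by
  rw [one_div]
  exact Real.rpow_inv_natCast_pow (Nat.cast_nonneg n) (by omega)

lemma rpow_one_add_one_div (hK : 1 ≤ K) (n : ℕ) :
    (n : ℝ) ^ (1 + 1 / (K : ℝ)) = n * (n : ℝ) ^ (1 / (K : ℝ)) := by
  have : (0 : ℝ) < 1 + 1 / K := by positivity
  rw [Real.rpow_add' (Nat.cast_nonneg n) this.ne', Real.rpow_one]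

lemma tendsto_rpow_one_div (hK : 1 ≤ K) :
    Tendsto (fun n : ℕ => (n : ℝ) ^ (1 / (K : ℝ))) atTop atTop :=
  (tendsto_rpow_atTop (by positivity)).comp tendsto_natCast_atTop_atTop

lemma tendsto_add_pow_div (hK : 1 ≤ K) (κ c : ℝ) :
    Tendsto (fun n : ℕ => (κ * (n : ℝ) ^ (1 / (K : ℝ)) + c) ^ (K + 1)
      / (n * (n : ℝ) ^ (1 / (K : ℝ)))) atTop (𝓝 (κ ^ (K + 1))) := by
  have h1 : Tendsto (fun n : ℕ => (κ + c / (n : ℝ) ^ (1 / (K : ℝ))) ^ (K + 1)) atTop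
      (𝓝 ((κ + 0) ^ (K + 1))) :=
    (tendsto_const_nhds.add ((tendsto_rpow_one_div hK).const_div_atTop c)).pow _
  rw [add_zero] at h1
  refine h1.congr' ?_
  filter_upwards [eventually_ge_atTop 1] with n hn
  have hn0 : (0 : ℝ) < n := by exact_mod_cast hn
  have hw : 0 < (n : ℝ) ^ (1 / (K : ℝ)) := Real.rpow_pos_of_pos hn0 _
  have e : (n : ℝ) * (n : ℝ) ^ (1 / (K : ℝ)) = ((n : ℝ) ^ (1 / (K : ℝ))) ^ (K + 1) := by
    rw [pow_succ, rpow_one_div_pow hK]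
  rw [e, ← div_pow]
  congr 1
  field_simp

/-- `(K!)^{1/K}`. -/
noncomputable def factorialRoot (K : ℕ) : ℝ := ((K ! : ℕ) : ℝ) ^ (1 / (K : ℝ))

lemma factorialRoot_pos (K : ℕ) : 0 < factorialRoot K :=
  Real.rpow_pos_of_pos (by exact_mod_cast Nat.factorial_pos K) _

lemma factorialRoot_pow (hK : 1 ≤ K) : factorialRoot K ^ K = (K ! : ℕ) := rpow_one_div_pow hK _

lemma factorialRoot_pow_succ_div (hK : 1 ≤ K) :
    factorialRoot K ^ (K + 1) / ((K + 1)! : ℕ) = factorialRoot K / (K + 1) := by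
  rw [pow_succ, factorialRoot_pow hK, Nat.factorial_succ]
  have : ((K ! : ℕ) : ℝ) ≠ 0 := by exact_mod_cast Nat.factorial_ne_zero K
  push_cast
  field_simp

lemma target_fLevels_eq (hK : 1 ≤ K) (x : ℝ) (n : ℕ) :
    x * K * (n : ℝ) ^ (1 + 1 / (K : ℝ)) / levelConst K
      = x * (K / (K + 1)) * factorialRoot K * (n * (n : ℝ) ^ (1 / (K : ℝ))) := by
  rw [rpow_one_add_one_div hK, levelConst]
  change _ / (_ / factorialRoot K) = _
  have := (factorialRoot_pos K).ne'
  field_simp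

/-- `(κ n^{1/K} + c)^{K+1} / (K+1)!` with `κ = (K!)^{1/K}` is asymptotically
`κ n^{1+1/K} / (K+1)`. -/
lemma tendsto_factorialRoot_pow_div (hK : 1 ≤ K) (c : ℝ) :
    Tendsto (fun n : ℕ => (factorialRoot K * (n : ℝ) ^ (1 / (K : ℝ)) + c) ^ (K + 1)
      / ((K + 1)! : ℕ) / (n * (n : ℝ) ^ (1 / (K : ℝ)))) atTop
      (𝓝 (factorialRoot K / (K + 1))) := by
  have := (tendsto_add_pow_div hK (factorialRoot K) c).div_const (((K + 1)! : ℕ) : ℝ)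
  rw [factorialRoot_pow_succ_div hK] at this
  refine this.congr fun n => ?_
  rw [div_right_comm]

variable {p : Measure Request} [IsProbabilityMeasure p]

lemma expectedOpt_fLevels_lower (hp : IsBoundedDist p) (hK : 1 ≤ K) (hx : 0 < meanLength p)
    {η : ℝ} (hη : 0 < η) : ∀ᶠ n : ℕ in atTop,
      (1 - η) * (meanLength p * K * (n : ℝ) ^ (1 + 1 / (K : ℝ)) / levelConst K)
        ≤ expectedOpt (fLevels K) p n := by
  set x := meanLength p with hxdef
  set κ := factorialRoot K with hκdef
  have hκ : 0 < κ := factorialRoot_pos K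
  set ε := min η 1 / 4 with hε
  have hε0 : 0 < ε := by positivity
  have hε1 : ε ≤ 1 / 4 := by rw [hε]; linarith [min_le_right η 1]
  have hεη : 4 * ε ≤ η := by rw [hε]; linarith [min_le_left η 1]
  obtain ⟨m, hm, hcard⟩ := exists_le_integral_card_typical hp hε0 hε0 (by linarith)
  set w : ℕ → ℝ := fun n => (n : ℝ) ^ (1 / (K : ℝ)) with hw
  set low : ℕ → ℝ := fun n => (1 - ε) * x * (κ * w n * ((1 - ε) * (n - 2 * m))
    - (κ * w n + (K + 2 : ℕ)) ^ (K + 1) / ((K + 1)! : ℕ)) - m * n * (x + meanRate p) with hlow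
  have hwt : Tendsto w atTop atTop := tendsto_rpow_one_div hK
  have hnt : Tendsto (fun n : ℕ => (n : ℝ)) atTop atTop := tendsto_natCast_atTop_atTop
  have hlim : Tendsto (fun n : ℕ => low n / (n * w n)) atTop
      (𝓝 ((1 - ε) * x * (κ * ((1 - ε) * (1 - 0)) - κ / (K + 1)) - 0)) := by
    have t1 : Tendsto (fun n : ℕ => (1 - ε) * x * (κ * ((1 - ε) * (1 - 2 * m / (n : ℝ)))
        - (κ * w n + (K + 2 : ℕ)) ^ (K + 1) / ((K + 1)! : ℕ) / (n * w n))
        - m * (x + meanRate p) / w n) atTop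
        (𝓝 ((1 - ε) * x * (κ * ((1 - ε) * (1 - 0)) - κ / (K + 1)) - 0)) :=
      ((((tendsto_const_nhds.sub (hnt.const_div_atTop _)).const_mul _).const_mul _).sub
        (tendsto_factorialRoot_pow_div hK _)).const_mul _ |>.sub (hwt.const_div_atTop _)
    refine t1.congr' ?_
    filter_upwards [eventually_ge_atTop 1, hwt.eventually_gt_atTop 0] with n hn hwn
    have hn0 : (0 : ℝ) < n := by exact_mod_cast hn
    have hf : (((K + 1)! : ℕ) : ℝ) ≠ 0 := by exact_mod_cast Nat.factorial_ne_zero _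
    simp only [hlow]
    field_simp
  have hgt : (1 - η) * (x * (K / (K + 1)) * κ)
      < (1 - ε) * x * (κ * ((1 - ε) * (1 - 0)) - κ / (K + 1)) - 0 := by
    have hK1 : (1 : ℝ) ≤ K := by exact_mod_cast hK
    set ρ : ℝ := K / (K + 1) with hρ
    have hρ1 : 1 / (K + 1 : ℝ) = 1 - ρ := by rw [hρ]; field_simp; ring
    have hρ2 : 1 / 2 ≤ ρ := by rw [hρ, div_le_div_iff₀ two_pos (by linarith)]; linarith
    have e1 : (1 - ε) * x * (κ * ((1 - ε) * (1 - 0)) - κ / (K + 1)) - 0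
        = x * κ * ((1 - ε) * (ρ - ε)) := by
      rw [show κ / (K + 1 : ℝ) = κ * (1 / (K + 1)) by ring, hρ1]; ring
    rw [e1, show (1 - η) * (x * ρ * κ) = x * κ * ((1 - η) * ρ) by ring]
    refine mul_lt_mul_of_pos_left ?_ (by positivity)
    nlinarith
  filter_upwards [hlim.eventually_const_lt hgt, eventually_ge_atTop 1, hwt.eventually_gt_atTop 0,
    hnt.eventually_ge_atTop (2 * m : ℝ)] with n h1 hn hwn h2m
  have hn0 : (0 : ℝ) < n := by exact_mod_cast hn
  rw [target_fLevels_eq hK]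
  rw [lt_div_iff₀ (by positivity)] at h1
  have h2 : low n ≤ expectedOpt (fLevels K) p n := by
    have hκw : 0 ≤ κ * w n := by positivity
    refine le_trans ?_ (opt_fLevels_lower hp hK hm (D := ⌈κ * w n⌉₊ + 1) (by omega)
      (by linarith) (hcard n))
    have hD1 : κ * w n ≤ (⌈κ * w n⌉₊ + 1 : ℕ) := by
      push_cast; linarith [Nat.le_ceil (κ * w n)]
    have hD2 : ((⌈κ * w n⌉₊ + 1 + K : ℕ) : ℝ) ≤ κ * w n + (K + 2 : ℕ) := by
      push_cast; linarith [Nat.ceil_lt_add_one hκw]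
    have hC : (((⌈κ * w n⌉₊ + 1 + K).choose (K + 1) : ℕ) : ℝ)
        ≤ (κ * w n + (K + 2 : ℕ)) ^ (K + 1) / ((K + 1)! : ℕ) :=
      (Nat.choose_le_pow_div _ _).trans (by gcongr)
    have : (0 : ℝ) ≤ (1 - ε) * (n - 2 * m) := mul_nonneg (by linarith) (by linarith)
    have : 0 ≤ 1 - ε := by linarith
    simp only [hlow]
    gcongr
  calc _ = (1 - η) * (x * (K / (K + 1)) * κ) * (n * w n) := by ring
    _ ≤ low n := h1.le
    _ ≤ _ := h2

lemma expectedCost_levelAlgorithm_upper (hp : IsBoundedDist p) (hK : 1 ≤ K)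
    (hx : 0 < meanLength p) {η : ℝ} (hη : 0 < η) : ∀ᶠ n : ℕ in atTop,
      expectedCost (levelAlgorithm K) (fLevels K) p n ≤
        (1 + η) * (meanLength p * K * (n : ℝ) ^ (1 + 1 / (K : ℝ)) / levelConst K) := by
  set x := meanLength p with hxdef
  set κ := factorialRoot K with hκdef
  have hκ : 0 < κ := factorialRoot_pos K
  set w : ℕ → ℝ := fun n => (n : ℝ) ^ (1 / (K : ℝ)) with hw
  have hK1 : (0 : ℝ) < K := by exact_mod_cast hK
  have hwt : Tendsto w atTop atTop := tendsto_rpow_one_div hK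
  have hlim := (tendsto_factorialRoot_pow_div hK (K + 2 : ℕ)).const_mul (x * K)
  have hlt : x * K * (factorialRoot K / (K + 1)) < (1 + η) * (x * (K / (K + 1)) * κ) := by
    have : 0 < x * K * (κ / (K + 1)) := by positivity
    calc x * K * (κ / (K + 1)) < (1 + η) * (x * K * (κ / (K + 1))) := by nlinarith
      _ = _ := by ring
  filter_upwards [hlim.eventually_lt_const hlt, eventually_ge_atTop 1,
    hwt.eventually_gt_atTop 0] with n h1 hn hwn
  have hn0 : (0 : ℝ) < n := by exact_mod_cast hn
  rw [target_fLevels_eq hK, expectedCost_levelAlgorithm hp hK]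
  obtain ⟨d, hd, hsum⟩ := sum_topFile_levels_le hK hn
  have hdw : (d : ℝ) ≤ κ * w n := by
    have h3 : (d : ℝ) ^ K / (K ! : ℕ) ≤ n := by
      calc (d : ℝ) ^ K / (K ! : ℕ) ≤ ((d + K + 1 - K : ℕ) : ℝ) ^ K / (K ! : ℕ) := by
            gcongr; omega
        _ ≤ ((d + K).choose K : ℕ) := Nat.pow_le_choose K (d + K)
        _ ≤ n := by exact_mod_cast hd
    rw [div_le_iff₀ (by exact_mod_cast Nat.factorial_pos K)] at h3
    refine le_of_pow_le_pow_left₀ (n := K) (by omega) (by positivity) ?_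
    rw [mul_pow, hκdef, factorialRoot_pow hK, rpow_one_div_pow hK]
    linarith
  have hC : (((d + K + 2).choose (K + 1) : ℕ) : ℝ)
      ≤ (κ * w n + (K + 2 : ℕ)) ^ (K + 1) / ((K + 1)! : ℕ) := by
    refine (Nat.choose_le_pow_div _ _).trans ?_
    gcongr
    push_cast
    linarith
  calc x * (∑ t ∈ Finset.range n, (topFile (levels K) t).card : ℕ)
      ≤ x * (K * (d + K + 2).choose (K + 1) : ℕ) := by gcongr
    _ ≤ x * K * ((κ * w n + (K + 2 : ℕ)) ^ (K + 1) / ((K + 1)! : ℕ)) := by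
        push_cast at hC ⊢
        rw [mul_assoc x]
        gcongr
    _ = x * K * ((κ * w n + (K + 2 : ℕ)) ^ (K + 1) / ((K + 1)! : ℕ) / (n * w n)) * (n * w n) := by
        field_simp
    _ ≤ (1 + η) * (x * (K / (K + 1)) * κ) * (n * w n) := by
        gcongr
    _ = _ := by ring

lemma levelConst_pos (K : ℕ) : 0 < levelConst K :=
  div_pos (by positivity) (factorialRoot_pos K)

/-- The fixed stack sizes `levels K` are asymptotically optimal for every bounded distribution; if
all lengths vanish, then so do all costs. -/
theorem levelAlgorithm_spec (hp : IsBoundedDist p) (hK : 1 ≤ K) :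
    AsymptoticallyOneCompetitive (levelAlgorithm K) (fLevels K) p ∧
      expectedOpt (fLevels K) p ~[atTop] fun n : ℕ =>
        meanLength p * K * (n : ℝ) ^ (1 + 1 / (K : ℝ)) / levelConst K := by
  have hfin : ∀ (n : ℕ) (I : Fin n → Request), (levelAlgorithm K).cost (fLevels K) I ≠ ⊤ :=
    fun n I => by rw [cost_levelAlgorithm hK]; exact ENNReal.ofReal_ne_top
  have hint := integrable_cost_levelAlgorithm hp hK
  have hle : ∀ n, expectedOpt (fLevels K) p n ≤ expectedCost (levelAlgorithm K) (fLevels K) p n :=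
    fun n => expectedOpt_le (hfin n) (hint n)
  suffices h : expectedCost (levelAlgorithm K) (fLevels K) p ~[atTop] expectedOpt (fLevels K) p ∧
      expectedOpt (fLevels K) p ~[atTop] fun n : ℕ =>
        meanLength p * K * (n : ℝ) ^ (1 + 1 / (K : ℝ)) / levelConst K from
    ⟨⟨hint, fun n => integrable_opt (hfin n) (hint n), h.1⟩, h.2⟩
  rcases (meanLength_nonneg p).eq_or_lt with hx | hx
  · have h1 : expectedCost (levelAlgorithm K) (fLevels K) p = 0 := by
      funext n; rw [expectedCost_levelAlgorithm hp hK, ← hx, zero_mul]; rfl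
    have h2 : expectedOpt (fLevels K) p = 0 := by
      funext n
      refine le_antisymm ((hle n).trans (by rw [h1])) ?_
      exact integral_nonneg fun I => ENNReal.toReal_nonneg
    have h3 : (fun n : ℕ => meanLength p * K * (n : ℝ) ^ (1 + 1 / (K : ℝ)) / levelConst K) = 0 := by
      funext n; rw [← hx]; simp
    rw [h1, h2, h3]
    exact ⟨IsEquivalent.refl, IsEquivalent.refl⟩
  · refine isEquivalent_of_squeeze ?_ hle
      (fun η hη => expectedOpt_fLevels_lower hp hK hx hη)
      (fun η hη => expectedCost_levelAlgorithm_upper hp hK hx hη)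
    filter_upwards [eventually_ge_atTop 1] with n hn
    have hn0 : (0 : ℝ) < n := by exact_mod_cast hn
    have hK0 : (0 : ℝ) < K := by exact_mod_cast hK
    have := levelConst_pos K
    positivity

end

/-- By Stirling's formula `(K!)^{1/K}` is asymptotically `K / e`. -/
theorem tendsto_levelConst : Tendsto levelConst atTop (𝓝 (Real.exp 1)) := by
  have hlog : Tendsto (fun K : ℕ => Real.log K / (K : ℝ)) atTop (𝓝 0) :=
    (Real.isLittleO_log_id_atTop.tendsto_div_nhds_zero).comp tendsto_natCast_atTop_atTop
  have hinv : Tendsto (fun K : ℕ => 1 / (K : ℝ)) atTop (𝓝 0) :=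
    tendsto_one_div_atTop_nhds_zero_nat
  -- `log (K!) = log (stirlingSeq K) + log (2 * K) / 2 + K * (log K - 1)`
  have hst : Tendsto (fun K : ℕ => Real.log (Stirling.stirlingSeq K)) atTop
      (𝓝 (Real.log √Real.pi)) :=
    Stirling.tendsto_stirlingSeq_sqrt_pi.log (by positivity)
  have hmain : Tendsto (fun K : ℕ => Real.log (1 + 1 / (K : ℝ)) + 1
      - Real.log (Stirling.stirlingSeq K) * (1 / (K : ℝ))
      - (Real.log 2 * (1 / (K : ℝ)) + Real.log K / (K : ℝ)) / 2) atTop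
      (𝓝 (Real.log (1 + 0) + 1 - Real.log √Real.pi * 0 - (Real.log 2 * 0 + 0) / 2)) := by
    refine Tendsto.sub (Tendsto.sub (Tendsto.add_const 1 ?_) (hst.mul hinv))
      (((hinv.const_mul _).add hlog).div_const 2)
    exact (tendsto_const_nhds.add hinv).log (by norm_num)
  have hexp := (Real.continuous_exp.tendsto _).comp hmain
  have e : Real.log (1 + 0) + 1 - Real.log √Real.pi * 0 - (Real.log 2 * 0 + 0) / 2 = 1 := by simp
  rw [e] at hexp
  refine hexp.congr' ?_
  filter_upwards [eventually_ge_atTop 1] with K hK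
  have hK0 : (0 : ℝ) < K := by exact_mod_cast hK
  have hf : (0 : ℝ) < (K ! : ℕ) := by exact_mod_cast Nat.factorial_pos K
  have hlc := levelConst_pos K
  rw [Function.comp_apply, ← Real.exp_log hlc]
  congr 1
  rw [levelConst, Real.log_div (by positivity) (by positivity), Real.log_rpow hf,
    Stirling.log_stirlingSeq_formula, Real.log_mul (by norm_num) hK0.ne',
    Real.log_div hK0.ne' (Real.exp_pos 1).ne', Real.log_exp,
    show 1 + 1 / (K : ℝ) = (K + 1) / K by field_simp, Real.log_div (by positivity) hK0.ne']
  field_simp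
  ring

/-! ### The Kraft equation -/

lemma kraftSum_lt {x y β β' : ℝ} (hx : 0 < x) (hy : 0 < y) (hβ : 0 < β) (h : β < β') :
    (2 : ℝ) ^ (-(x / β)) + (2 : ℝ) ^ (-(y / β)) < (2 : ℝ) ^ (-(x / β')) + (2 : ℝ) ^ (-(y / β')) := by
  have key : ∀ z : ℝ, 0 < z → (2 : ℝ) ^ (-(z / β)) < (2 : ℝ) ^ (-(z / β')) := by
    intro z hz
    refine Real.rpow_lt_rpow_of_exponent_lt one_lt_two (neg_lt_neg ?_)
    exact div_lt_div_of_pos_left hz hβ h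
  exact add_lt_add (key x hx) (key y hy)

lemma SolvesKraft.le_of_one_le {x y β β' : ℝ} (h : SolvesKraft x y β) (hx : 0 < x) (hy : 0 < y)
    (hβ' : 0 < β') (h1 : 1 ≤ (2 : ℝ) ^ (-(x / β')) + (2 : ℝ) ^ (-(y / β'))) : β ≤ β' := by
  by_contra hcon
  have := kraftSum_lt hx hy hβ' (not_le.mp hcon)
  rw [h.2] at this
  linarith

lemma SolvesKraft.unique {x y β β' : ℝ} (h : SolvesKraft x y β) (h' : SolvesKraft x y β')
    (hx : 0 < x) (hy : 0 < y) : β' = β :=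
  le_antisymm (h'.le_of_one_le hx hy h.1 h.2.ge) (h.le_of_one_le hx hy h'.1 h'.2.ge)

lemma two_rpow_neg_div {x y u σ : ℝ} (hx : 0 < x) (hy : 0 < y) (hσ : 0 < σ) (z : ℝ)
    (hu : 0 < Real.log (1 + u)) :
    (2 : ℝ) ^ (-(z / (Real.log 2 / σ * ((x + y) / Real.log (1 + u)))))
      = Real.exp (-(σ * (z * Real.log (1 + u) / (x + y)))) := by
  rw [Real.rpow_def_of_pos two_pos]
  have := Real.log_pos one_lt_two
  congr 1
  field_simp

/-- If `y ≤ x`, then the solution of the Kraft equation is at least `(log 2 / 4) Q` with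
`Q = (x + y) / log (1 + x / y)`. -/
lemma kraftSum_le_one {x y : ℝ} (hy : 0 < y) (hyx : y ≤ x) :
    (2 : ℝ) ^ (-(x / (Real.log 2 / 4 * ((x + y) / Real.log (1 + x / y)))))
      + (2 : ℝ) ^ (-(y / (Real.log 2 / 4 * ((x + y) / Real.log (1 + x / y))))) ≤ 1 := by
  have hx : 0 < x := hy.trans_le hyx
  set u := x / y with hu
  have hu1 : 1 ≤ u := by rw [hu, le_div_iff₀ hy]; linarith
  set l := Real.log (1 + u) with hl
  have hl2 : 0.69 ≤ l := by
    have : Real.log 2 ≤ l := Real.log_le_log two_pos (by linarith)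
    linarith [Real.log_two_gt_d9]
  rw [two_rpow_neg_div hx hy (by norm_num) x (by linarith),
    two_rpow_neg_div hx hy (by norm_num) y (by linarith), ← hl]
  have hxu : x = u * y := by rw [hu]; field_simp
  have e1 : x * l / (x + y) = u * l / (1 + u) := by rw [hxu]; field_simp; ring
  have e2 : y * l / (x + y) = l / (1 + u) := by rw [hxu]; field_simp; ring
  rw [e1, e2]
  have hs : 0 < 1 + u := by linarith
  have h1 : Real.exp (-(4 * (u * l / (1 + u)))) ≤ 1 / (1 + u) ^ 2 := by
    have : 1 / (1 + u) ^ 2 = Real.exp (-(2 * l)) := by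
      rw [Real.exp_neg, two_mul, Real.exp_add, hl, Real.exp_log hs, one_div, sq]
    rw [this, Real.exp_le_exp]
    have : l / 2 ≤ u * l / (1 + u) := by
      rw [div_le_div_iff₀ two_pos hs]; nlinarith
    linarith
  have h2 : Real.exp (-(4 * (l / (1 + u)))) ≤ (1 + u) / (1 + u + 4 * l) := by
    rw [Real.exp_neg, inv_eq_one_div, div_le_div_iff₀ (Real.exp_pos _) (by linarith), one_mul]
    have := Real.add_one_le_exp (4 * (l / (1 + u)))
    calc 1 + u + 4 * l = (1 + u) * (4 * (l / (1 + u)) + 1) := by field_simp; ring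
      _ ≤ _ := by gcongr
  have h3 : 1 / (1 + u) ^ 2 + (1 + u) / (1 + u + 4 * l) ≤ 1 := by
    have : 1 / (1 + u) ^ 2 ≤ 4 * l / (1 + u + 4 * l) := by
      rw [div_le_div_iff₀ (by positivity) (by linarith)]
      nlinarith [mul_nonneg (sub_nonneg.mpr hl2) (by nlinarith : (0 : ℝ) ≤ (1 + u) ^ 2 - 1)]
    have e : 4 * l / (1 + u + 4 * l) + (1 + u) / (1 + u + 4 * l) = 1 := by
      rw [← add_div, div_eq_one_iff_eq (by linarith)]; ring
    linarith
  linarith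

/-- If `y ≤ x`, then the solution of the Kraft equation is at most `2 log 2 Q` with
`Q = (x + y) / log (1 + x / y)`. -/
lemma one_le_kraftSum {x y : ℝ} (hy : 0 < y) (hyx : y ≤ x) :
    1 ≤ (2 : ℝ) ^ (-(x / (Real.log 2 / (1 / 2) * ((x + y) / Real.log (1 + x / y)))))
      + (2 : ℝ) ^ (-(y / (Real.log 2 / (1 / 2) * ((x + y) / Real.log (1 + x / y))))) := by
  have hx : 0 < x := hy.trans_le hyx
  set u := x / y with hu
  have hu1 : 1 ≤ u := by rw [hu, le_div_iff₀ hy]; linarith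
  set l := Real.log (1 + u) with hl
  have hl0 : 0 < l := Real.log_pos (by linarith)
  rw [two_rpow_neg_div hx hy (by norm_num) x (by linarith),
    two_rpow_neg_div hx hy (by norm_num) y (by linarith), ← hl]
  have hxu : x = u * y := by rw [hu]; field_simp
  have e1 : x * l / (x + y) = u * l / (1 + u) := by rw [hxu]; field_simp; ring
  have e2 : y * l / (x + y) = l / (1 + u) := by rw [hxu]; field_simp; ring
  rw [e1, e2]
  have hs : 0 < 1 + u := by linarith
  have h1 : Real.exp (-(l / 2)) ≤ Real.exp (-(1 / 2 * (u * l / (1 + u)))) := by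
    rw [Real.exp_le_exp]
    have : u * l / (1 + u) ≤ l := by
      rw [div_le_iff₀ hs]; nlinarith
    linarith
  have h2 : 1 - l / (2 * (1 + u)) ≤ Real.exp (-(1 / 2 * (l / (1 + u)))) := by
    have := Real.add_one_le_exp (-(1 / 2 * (l / (1 + u))))
    have e : l / (2 * (1 + u)) = 1 / 2 * (l / (1 + u)) := by field_simp
    linarith
  have h3 : l / (2 * (1 + u)) ≤ Real.exp (-(l / 2)) := by
    have e : 1 + u = Real.exp (l / 2) * Real.exp (l / 2) := by
      rw [← Real.exp_add, add_halves, hl, Real.exp_log hs]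
    rw [e, Real.exp_neg, inv_eq_one_div, div_le_div_iff₀ (by positivity) (by positivity)]
    have := Real.add_one_le_exp (l / 2)
    have hpos := Real.exp_pos (l / 2)
    nlinarith
  linarith

lemma exists_solvesKraft_of_le {x y : ℝ} (hy : 0 < y) (hyx : y ≤ x) :
    ∃ β, SolvesKraft x y β ∧ Real.log 2 / 4 * ((x + y) / Real.log (1 + x / y)) ≤ β ∧
      β ≤ 2 * Real.log 2 * ((x + y) / Real.log (1 + x / y)) := by
  have hx : 0 < x := hy.trans_le hyx
  have hlog : 0 < Real.log (1 + x / y) := Real.log_pos (by have := div_pos hx hy; linarith)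
  have h2 := Real.log_pos one_lt_two
  set Q := (x + y) / Real.log (1 + x / y) with hQ
  have hQ0 : 0 < Q := div_pos (by linarith) hlog
  have hlo := kraftSum_le_one hy hyx
  have hhi := one_le_kraftSum hy hyx
  rw [← hQ] at hlo hhi
  rw [show Real.log 2 / (1 / 2) * Q = 2 * Real.log 2 * Q by ring] at hhi
  have hle : Real.log 2 / 4 * Q ≤ 2 * Real.log 2 * Q := by nlinarith [mul_pos h2 hQ0]
  have hcont : ContinuousOn (fun β : ℝ => (2 : ℝ) ^ (-(x / β)) + (2 : ℝ) ^ (-(y / β)))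
      (Set.Icc (Real.log 2 / 4 * Q) (2 * Real.log 2 * Q)) := by
    have key : ∀ z : ℝ, ContinuousOn (fun β : ℝ => (2 : ℝ) ^ (-(z / β)))
        (Set.Icc (Real.log 2 / 4 * Q) (2 * Real.log 2 * Q)) := by
      intro z
      refine ContinuousOn.rpow continuousOn_const ?_ fun _ _ => Or.inl two_ne_zero
      refine (continuousOn_const.div continuousOn_id fun β hβ => ?_).neg
      have : 0 < Real.log 2 / 4 * Q := by positivity
      exact (this.trans_le hβ.1).ne'
    exact (key x).add (key y)
  obtain ⟨β, hβ, hβ1⟩ := intermediate_value_Icc hle hcont ⟨hlo, hhi⟩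
  have : 0 < Real.log 2 / 4 * Q := by positivity
  exact ⟨β, ⟨this.trans_le hβ.1, hβ1⟩, hβ.1, hβ.2⟩

/-- Existence of a solution of the Kraft equation, and its order of magnitude. -/
lemma exists_solvesKraft {x y : ℝ} (hx : 0 < x) (hy : 0 < y) :
    ∃ β, SolvesKraft x y β ∧
      Real.log 2 / 4 * ((x + y) / Real.log (1 + max (x / y) (y / x))) ≤ β ∧
      β ≤ 2 * Real.log 2 * ((x + y) / Real.log (1 + max (x / y) (y / x))) := by
  rcases le_total y x with h | h
  · rw [max_eq_left ((div_le_one hx).mpr h |>.trans ((one_le_div hy).mpr h))]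
    exact exists_solvesKraft_of_le hy h
  · rw [max_eq_right ((div_le_one hy).mpr h |>.trans ((one_le_div hx).mpr h)), add_comm x y]
    obtain ⟨β, ⟨h1, h2⟩, h3⟩ := exists_solvesKraft_of_le hx h
    exact ⟨β, ⟨h1, by rw [add_comm]; exact h2⟩, h3⟩

/-! ### Lower bound for the linear problem -/

lemma toReal_cost_fLinear {n : ℕ} (I : Fin n → Request) (σ : Schedule n) :
    (cost fLinear I σ).toReal
      = ∑ t ∈ Finset.range n, (mergeLen I σ t + rate I t * size I σ t) := by
  rw [cost_fLinear, ENNReal.toReal_ofReal]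
  refine Finset.sum_nonneg fun t _ => add_nonneg (mergeLen_nonneg I σ t) (by positivity)

lemma cost_fLinear_ne_top {n : ℕ} (I : Fin n → Request) (σ : Schedule n) :
    cost fLinear I σ ≠ ⊤ := by
  rw [cost_fLinear]; exact ENNReal.ofReal_ne_top

lemma opt_fLinear_ne_top {n : ℕ} (I : Fin n → Request) : opt fLinear I ≠ ⊤ :=
  ne_top_of_le_ne_top (cost_fLinear_ne_top I 0) (iInf_le _ 0)

lemma mergeLen_le {M : ℝ} {n : ℕ} (I : Fin n → Request) (hI : ∀ u, (len I u : ℝ) ≤ M)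
    (σ : Schedule n) (t : ℕ) : mergeLen I σ t ≤ (t + 1) * M := by
  have hM : 0 ≤ M := (NNReal.coe_nonneg _).trans (hI 0)
  calc mergeLen I σ t ≤ (topFile (size I σ) t).card • M :=
        Finset.sum_le_card_nsmul _ _ _ fun u _ => hI u
    _ ≤ (t + 1) * M := by
        rw [nsmul_eq_mul]
        have : ((topFile (size I σ) t).card : ℝ) ≤ t + 1 := by
          exact_mod_cast card_topFile_le (size I σ) t
        gcongr

lemma step_cost_le {M : ℝ} {n : ℕ} (I : Fin n → Request) (hl : ∀ u, (len I u : ℝ) ≤ M)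
    (hr : ∀ u, (rate I u : ℝ) ≤ M) (σ : Schedule n) {t : ℕ} (ht : t < n) :
    mergeLen I σ t + rate I t * size I σ t ≤ 2 * (t + 1) * M := by
  have h1 := mergeLen_le I hl σ t
  have h2 : (size I σ t : ℝ) ≤ t + 1 := by exact_mod_cast size_le I σ ht
  have hM : 0 ≤ M := (NNReal.coe_nonneg _).trans (hl 0)
  have : (rate I t : ℝ) * size I σ t ≤ M * (t + 1) := by
    gcongr
    exact hr t
  linarith

section
variable {p : Measure Request} [IsProbabilityMeasure p]

lemma IsBoundedDist.ae_le (hp : IsBoundedDist p) : ∃ M : ℝ, 0 ≤ M ∧ ∀ n,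
    ∀ᵐ I : Fin n → Request ∂(iid p n), (∀ u, (len I u : ℝ) ≤ M) ∧ ∀ u, (rate I u : ℝ) ≤ M := by
  obtain ⟨M, hM, hl, hr⟩ := hp.exists_boundedBy
  refine ⟨M, hM, fun n => ?_⟩
  simp_rw [coe_len, coe_rate_eq]
  exact (hl.ae_coord_le hM n).and (hr.ae_coord_le hM n)

lemma integrable_algCost_fLinear (hp : IsBoundedDist p) {A : OnlineAlgorithm}
    (hA : ∀ t, Measurable (A t)) (n : ℕ) :
    Integrable (fun I => (A.cost fLinear I).toReal) (iid p n) := by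
  obtain ⟨M, hM, hle⟩ := hp.ae_le
  refine Integrable.of_bound (measurable_algCost hA fLinear n).ennreal_toReal.aestronglyMeasurable
    (∑ t ∈ Finset.range n, 2 * ((t : ℝ) + 1) * M) ?_
  filter_upwards [hle n] with I hI
  rw [Real.norm_of_nonneg ENNReal.toReal_nonneg, OnlineAlgorithm.cost, toReal_cost_fLinear]
  exact Finset.sum_le_sum fun t ht => step_cost_le I hI.1 hI.2 _ (Finset.mem_range.mp ht)

lemma integrable_opt_fLinear (hp : IsBoundedDist p) (n : ℕ) :
    Integrable (fun I => (opt fLinear I).toReal) (iid p n) :=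
  integrable_opt (fun I => cost_fLinear_ne_top I ((obliviousAlgorithm 0).schedule I))
    (integrable_algCost_fLinear hp (fun _ => measurable_const) n)

lemma opt_fLinear_lower (hp : IsBoundedDist p) (hx : 0 < meanLength p) (hy : 0 < meanRate p)
    {β : ℝ} (hβ : SolvesKraft (meanLength p) (meanRate p) β) {m n : ℕ} (hm : 1 ≤ m) (hn : 1 ≤ n)
    {ε δ : ℝ} (hε1 : ε ≤ 1)
    (hcard : (1 - δ) * (n - 2 * m) ≤ ∫ I, ((typical m ((1 - ε) * meanLength p)
      ((1 - ε) * meanRate p) I).card : ℝ) ∂(iid p n)) :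
    (1 - ε) * (β * Real.logb 2 n * ((1 - δ) * (n - 2 * m)) - β * n)
      - m * n * (meanLength p + meanRate p) ≤ expectedOpt fLinear p n := by
  have hn0 : (0 : ℝ) < n := by exact_mod_cast hn
  have hlam : 0 ≤ β * Real.logb 2 n :=
    mul_nonneg hβ.1.le (Real.logb_nonneg one_lt_two (by exact_mod_cast hn))
  refine le_integral_of_typical hp hcard (by linarith) hlam
    (integrable_opt_fLinear hp n) (ae_of_all _ fun I => ?_)
  set x := meanLength p with hxdef
  set y := meanRate p with hydef
  set S := typical m ((1 - ε) * x) ((1 - ε) * y) I with hS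
  rw [add_assoc, ← sub_le_iff_le_add]
  refine le_toReal_opt (opt_fLinear_ne_top I) fun σ _ => ?_
  rw [toReal_cost_fLinear, Finset.sum_add_distrib, sum_mergeLen]
  have h1 := window_records_le hm (size I σ) (w := fun u => (len I u : ℝ))
    (fun u => NNReal.coe_nonneg _) (S := S) (n := n) (c := (1 - ε) * x)
    (fun u hu => (mem_typical.mp hu).2.1.2) (fun u hu => (mem_typical.mp hu).2.2.1)
  have h2 := window_size_le hm (b := size I σ) (fun u v huv hv => size_le_add I σ huv hv)
    (w := fun u => (rate I u : ℝ)) (fun u => NNReal.coe_nonneg _) (S := S) (n := n)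
    (c := (1 - ε) * y) (fun u hu => ⟨(mem_typical.mp hu).2.1.1, (mem_typical.mp hu).1⟩)
    (fun u hu => (mem_typical.mp hu).2.2.2)
  have h3 := sum_sub_linear_le hx hy hβ (b := size I σ) (n := n)
    (fun t ht => one_le_size I σ ht) hlam (typical_subset _ _ _ I : S ⊆ _)
  rw [mul_div_cancel_left₀ _ hβ.1.ne', Real.rpow_logb two_pos (by norm_num) hn0,
    Finset.sum_sub_distrib, Finset.sum_const, nsmul_eq_mul, Finset.sum_add_distrib,
    ← Finset.mul_sum, ← Finset.mul_sum] at h3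
  have h4 : (1 - ε) * (β * Real.logb 2 n * S.card - β * n)
      ≤ (1 - ε) * (x * ∑ u ∈ S, (records (size I σ) n u : ℝ)
        + y * ∑ u ∈ S, (size I σ u : ℝ)) :=
    mul_le_mul_of_nonneg_left (by linarith) (by linarith)
  linarith

lemma expectedOpt_fLinear_lower (hp : IsBoundedDist p) (hx : 0 < meanLength p)
    (hy : 0 < meanRate p) {β : ℝ} (hβ : SolvesKraft (meanLength p) (meanRate p) β)
    {η : ℝ} (hη : 0 < η) : ∀ᶠ n : ℕ in atTop,
      (1 - η) * (β * n * Real.logb 2 n) ≤ expectedOpt fLinear p n := by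
  have hβ0 := hβ.1
  set ε := min η 1 / 4 with hε
  have hε0 : 0 < ε := by positivity
  have hε1 : ε ≤ 1 / 4 := by rw [hε]; linarith [min_le_right η 1]
  have hεη : 4 * ε ≤ η := by rw [hε]; linarith [min_le_left η 1]
  obtain ⟨m, hm, hcard⟩ := exists_le_integral_card_typical hp hε0 hε0 (by linarith)
  have hnt : Tendsto (fun n : ℕ => (n : ℝ)) atTop atTop := tendsto_natCast_atTop_atTop
  have hlt : Tendsto (fun n : ℕ => Real.logb 2 n) atTop atTop :=
    (Real.tendsto_logb_atTop one_lt_two).comp hnt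
  have hlim : Tendsto (fun n : ℕ => (1 - ε) * (β * ((1 - ε) * (1 - 2 * m / (n : ℝ)))
      - β / Real.logb 2 n) - m * (meanLength p + meanRate p) / Real.logb 2 n) atTop
      (𝓝 ((1 - ε) * (β * ((1 - ε) * (1 - 0)) - 0) - 0)) :=
    ((((tendsto_const_nhds.sub (hnt.const_div_atTop _)).const_mul _).const_mul _).sub
      (hlt.const_div_atTop _)).const_mul _ |>.sub (hlt.const_div_atTop _)
  have hgt : (1 - η) * β < (1 - ε) * (β * ((1 - ε) * (1 - 0)) - 0) - 0 := by
    have : (1 - ε) * (β * ((1 - ε) * (1 - 0)) - 0) - 0 = (1 - ε) ^ 2 * β := by ring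
    rw [this]
    refine mul_lt_mul_of_pos_right ?_ hβ0
    nlinarith
  filter_upwards [hlim.eventually_const_lt hgt, eventually_ge_atTop 1,
    hlt.eventually_gt_atTop 0] with n h1 hn hln
  have hn0 : (0 : ℝ) < n := by exact_mod_cast hn
  refine le_trans ?_ (opt_fLinear_lower hp hx hy hβ hm hn (by linarith) (hcard n))
  calc (1 - η) * (β * n * Real.logb 2 n) = (1 - η) * β * (n * Real.logb 2 n) := by ring
    _ ≤ ((1 - ε) * (β * ((1 - ε) * (1 - 2 * m / (n : ℝ)))
      - β / Real.logb 2 n) - m * (meanLength p + meanRate p) / Real.logb 2 n)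
        * (n * Real.logb 2 n) := by gcongr
    _ = _ := by field_simp

end

/-! ### Balanced trees -/

/-- The sequence of stack sizes given by the binary search tree on `n` requests that has
a fraction `q` of the requests to the left of its root, and whose subtrees are built in the same
way. The root is the last request of stack size `1`; the sizes on its right are larger by one. -/
noncomputable def balanced (q : ℝ) : ℕ → ℕ → ℕ
  | 0, _ => 0
  | n + 1, t =>
    if t < min ⌊q * (n + 1 : ℕ)⌋₊ n then balanced q (min ⌊q * (n + 1 : ℕ)⌋₊ n) t
    else if t = min ⌊q * (n + 1 : ℕ)⌋₊ n then 1
    else 1 + balanced q (n - min ⌊q * (n + 1 : ℕ)⌋₊ n) (t - min ⌊q * (n + 1 : ℕ)⌋₊ n - 1)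
termination_by n => n
decreasing_by all_goals omega

/-- The recursive structure of `balanced q (n + 1)`, whose root is at `k`. -/
lemma exists_balanced_root (q : ℝ) (n : ℕ) : ∃ k, k ≤ n ∧ k = min ⌊q * (n + 1 : ℕ)⌋₊ n ∧
    (∀ t < k, balanced q (n + 1) t = balanced q k t) ∧ balanced q (n + 1) k = 1 ∧
    ∀ t, balanced q (n + 1) (k + 1 + t) = balanced q (n - k) t + 1 := by
  refine ⟨min ⌊q * (n + 1 : ℕ)⌋₊ n, min_le_right _ _, rfl, fun t ht => ?_, ?_, fun t => ?_⟩
  · rw [balanced, if_pos ht]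
  · rw [balanced, if_neg (lt_irrefl _), if_pos rfl]
  · rw [balanced, if_neg (by omega), if_neg (by omega), add_comm]
    congr 2
    omega

lemma one_le_balanced (q : ℝ) {n t : ℕ} (ht : t < n) : 1 ≤ balanced q n t := by
  induction n using Nat.strong_induction_on generalizing t with
  | _ n ih =>
    obtain ⟨n, rfl⟩ : ∃ k, n = k + 1 := ⟨n - 1, by omega⟩
    obtain ⟨k, hkn, -, h1, h2, h3⟩ := exists_balanced_root q n
    rcases lt_trichotomy t k with h | rfl | h
    · rw [h1 t h]; exact ih k (by omega) h
    · rw [h2]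
    · obtain ⟨s, rfl⟩ : ∃ s, t = k + 1 + s := ⟨t - k - 1, by omega⟩
      rw [h3]; omega

lemma balanced_zero_le (q : ℝ) (n : ℕ) : balanced q n 0 ≤ 1 := by
  induction n using Nat.strong_induction_on with
  | _ n ih =>
    cases n with
    | zero => simp [balanced]
    | succ n =>
      obtain ⟨k, hkn, -, h1, h2, -⟩ := exists_balanced_root q n
      rcases Nat.eq_zero_or_pos k with rfl | h
      · rw [h2]
      · rw [h1 0 h]; exact ih k (by omega)

lemma balanced_succ_le (q : ℝ) {n t : ℕ} (ht : t + 1 < n) :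
    balanced q n (t + 1) ≤ balanced q n t + 1 := by
  induction n using Nat.strong_induction_on generalizing t with
  | _ n ih =>
    obtain ⟨n, rfl⟩ : ∃ k, n = k + 1 := ⟨n - 1, by omega⟩
    obtain ⟨k, hkn, -, h1, h2, h3⟩ := exists_balanced_root q n
    rcases lt_trichotomy (t + 1) k with h | h | h
    · rw [h1 _ h, h1 t (by omega)]; exact ih k (by omega) h
    · rw [h, h2]; omega
    · obtain ⟨s, hs⟩ : ∃ s, t + 1 = k + 1 + s := ⟨t - k, by omega⟩
      rw [hs, h3]
      cases s with
      | zero =>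
        rw [show t = k by omega, h2]
        have := balanced_zero_le q (n - k)
        omega
      | succ s =>
        rw [show t = k + 1 + s by omega, h3]
        have := ih (n - k) (by omega) (t := s) (by omega)
        omega

/-- Every node of the tree has a nonempty subtree; its size is at most `n` times the product of
the fractions along the path from the root. -/
lemma balanced_spec {q : ℝ} (hq0 : 0 < q) (hq1 : q < 1) {n t : ℕ} (ht : t < n) :
    q * (1 - q) ≤ q ^ records (balanced q n) n t * (1 - q) ^ balanced q n t * n := by
  have hq : 0 < 1 - q := by linarith
  induction n using Nat.strong_induction_on generalizing t with
  | _ n ih =>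
    obtain ⟨n, rfl⟩ : ∃ k, n = k + 1 := ⟨n - 1, by omega⟩
    obtain ⟨k, hkn, hk, h1, h2, h3⟩ := exists_balanced_root q n
    have hn1 : (1 : ℝ) ≤ (n + 1 : ℕ) := by exact_mod_cast Nat.succ_pos n
    have hqn : 0 ≤ q * (n + 1 : ℕ) := by positivity
    have hfloor : ⌊q * (n + 1 : ℕ)⌋₊ ≤ n := by
      rw [← Nat.lt_succ_iff, Nat.floor_lt hqn]
      calc q * (n + 1 : ℕ) < 1 * (n + 1 : ℕ) := by gcongr
        _ = _ := by rw [one_mul]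
    rw [min_eq_left hfloor] at hk
    have hk1 : (k : ℝ) ≤ q * (n + 1 : ℕ) := by rw [hk]; exact Nat.floor_le hqn
    have hk2 : ((n - k : ℕ) : ℝ) ≤ (1 - q) * (n + 1 : ℕ) := by
      have := Nat.lt_floor_add_one (q * (n + 1 : ℕ))
      rw [← hk] at this
      rw [Nat.cast_sub hkn]
      push_cast at this ⊢
      linarith
    have hroot : ∀ t v, t ≤ k → v ∈ recordSet (balanced q (n + 1)) (n + 1) t → v ≤ k := by
      intro t v htk hv
      rw [mem_recordSet] at hv
      by_contra hvk
      have h4 := hv.2 k htk (by omega)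
      obtain ⟨s, rfl⟩ : ∃ s, v = k + 1 + s := ⟨v - k - 1, by omega⟩
      rw [h2, h3] at h4
      have := one_le_balanced q (n := n - k) (t := s) (by omega)
      omega
    rcases lt_trichotomy t k with h | rfl | h
    · have hsub : recordSet (balanced q (n + 1)) (n + 1) t
          ⊆ insert k (recordSet (balanced q k) k t) := by
        intro v hv
        have hvk := hroot t v h.le hv
        rw [Finset.mem_insert, mem_recordSet]
        rw [mem_recordSet] at hv
        rcases eq_or_ne v k with rfl | hne
        · exact Or.inl rfl
        · refine Or.inr ⟨⟨hv.1.1, by omega⟩, fun s hs hs' => ?_⟩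
          rw [← h1 v (by omega), ← h1 s (by omega)]
          exact hv.2 s hs hs'
      have hcard : records (balanced q (n + 1)) (n + 1) t ≤ records (balanced q k) k t + 1 :=
        (Finset.card_le_card hsub).trans (Finset.card_insert_le _ _)
      rw [h1 t h]
      calc q * (1 - q) ≤ q ^ records (balanced q k) k t * (1 - q) ^ balanced q k t * k :=
            ih k (by omega) h
        _ ≤ q ^ records (balanced q k) k t * (1 - q) ^ balanced q k t * (q * (n + 1 : ℕ)) := by
            gcongr
        _ = q ^ (records (balanced q k) k t + 1) * (1 - q) ^ balanced q k t * (n + 1 : ℕ) := by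
            ring
        _ ≤ _ := by
            have := pow_le_pow_of_le_one hq0.le hq1.le hcard
            gcongr
    · have hcard : records (balanced q (n + 1)) (n + 1) t ≤ 1 := by
        refine (Finset.card_le_card (t := {t}) fun v hv => ?_).trans (by simp)
        have h4 := hroot t v le_rfl hv
        rw [mem_recordSet] at hv
        rw [Finset.mem_singleton]
        omega
      have := pow_le_pow_of_le_one hq0.le hq1.le hcard
      rw [h2, pow_one]
      calc q * (1 - q) = q ^ 1 * (1 - q) * 1 := by ring
        _ ≤ _ := by gcongr
    · obtain ⟨s, rfl⟩ : ∃ s, t = k + 1 + s := ⟨t - k - 1, by omega⟩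
      have hrec : records (balanced q (n + 1)) (n + 1) (k + 1 + s)
          = records (balanced q (n - k)) (n - k) s := by
        have := records_shift (b := balanced q (n + 1)) (c := balanced q (n - k)) (e := n - k)
          (t := s) (k := k + 1) (k' := 1) fun w _ _ => h3 w
        rwa [show k + 1 + (n - k) = n + 1 by omega] at this
      rw [hrec, h3]
      calc q * (1 - q) ≤ q ^ records (balanced q (n - k)) (n - k) s
              * (1 - q) ^ balanced q (n - k) s * (n - k : ℕ) := ih (n - k) (by omega) (by omega)
        _ ≤ q ^ records (balanced q (n - k)) (n - k) s
              * (1 - q) ^ balanced q (n - k) s * ((1 - q) * (n + 1 : ℕ)) := by gcongr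
        _ = _ := by ring

/-- The fraction `2^{-X/β}` of the optimal tree for lengths `X` and read rates `Y`, where `β`
solves the Kraft equation; `0` if there is no solution. -/
noncomputable def splitRatio (X Y : ℕ) : ℝ :=
  open Classical in
  if h : ∃ β, SolvesKraft X Y β then (2 : ℝ) ^ (-((X : ℝ) / h.choose)) else 0

/-- In the balanced tree for estimates `X` and `Y` of the lengths and the read rates that are
accurate up to the factors `1 ± η`, all nodes are cheap. -/
lemma balanced_cost_le {x y β η : ℝ} (hx : 0 < x) (hy : 0 < y) (hβ : SolvesKraft x y β)
    (hη0 : 0 < η) (hη1 : η < 1) {N : ℕ} (hN : 1 ≤ N) {X Y : ℕ}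
    (hX1 : (1 - η) * (N * x) ≤ X) (hX2 : X ≤ (1 + η) * (N * x))
    (hY1 : (1 - η) * (N * y) ≤ Y) (hY2 : Y ≤ (1 + η) * (N * y)) {t : ℕ} (ht : t < N) :
    x * records (balanced (splitRatio X Y) N) N t + y * balanced (splitRatio X Y) N t
      ≤ (1 + η) / (1 - η) * (x + y + β * Real.logb 2 N) := by
  have hN0 : (0 : ℝ) < N := by exact_mod_cast hN
  have hη : 0 < 1 - η := by linarith
  have hX0 : (0 : ℝ) < X := lt_of_lt_of_le (by positivity) hX1
  have hY0 : (0 : ℝ) < Y := lt_of_lt_of_le (by positivity) hY1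
  have hex : ∃ β', SolvesKraft X Y β' := by
    obtain ⟨β', h, -⟩ := exists_solvesKraft hX0 hY0
    exact ⟨β', h⟩
  have hspec := hex.choose_spec
  have hqdef : splitRatio X Y = (2 : ℝ) ^ (-((X : ℝ) / hex.choose)) := by
    rw [splitRatio, dif_pos hex]
  generalize hex.choose = β' at hspec hqdef
  obtain ⟨hβ'0, hβ'1⟩ := hspec
  set q := splitRatio X Y with hq
  have h1q : 1 - q = (2 : ℝ) ^ (-((Y : ℝ) / β')) := by rw [hqdef]; linarith
  have hq0 : 0 < q := by rw [hqdef]; positivity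
  have hq1 : 0 < 1 - q := by rw [h1q]; positivity
  have hβ'le : β' ≤ (1 + η) * (N * β) := by
    have hpos : 0 < (1 + η) * (N * β) := by have := hβ.1; positivity
    refine SolvesKraft.le_of_one_le ⟨hβ'0, hβ'1⟩ hX0 hY0 hpos ?_
    refine hβ.2.ge.trans ?_
    have key : ∀ z Z : ℝ, Z ≤ (1 + η) * (N * z) →
        (2 : ℝ) ^ (-(z / β)) ≤ (2 : ℝ) ^ (-(Z / ((1 + η) * (N * β)))) := by
      intro z Z hZ
      refine Real.rpow_le_rpow_of_exponent_le one_le_two (neg_le_neg ?_)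
      rw [div_le_div_iff₀ hpos hβ.1]
      calc Z * β ≤ (1 + η) * (N * z) * β := by have := hβ.1; gcongr
        _ = _ := by ring
    exact add_le_add (key x X hX2) (key y Y hY2)
  set a := records (balanced q N) N t with ha
  set b := balanced q N t with hb
  have hsp : q * (1 - q) ≤ q ^ a * (1 - q) ^ b * N := balanced_spec hq0 (by linarith) ht
  have hlog := Real.logb_le_logb_of_le one_lt_two (by positivity) hsp
  have hlq : Real.logb 2 q = -(X / β') := by
    rw [hqdef, Real.logb_rpow two_pos (by norm_num)]
  have hl1q : Real.logb 2 (1 - q) = -(Y / β') := by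
    rw [h1q, Real.logb_rpow two_pos (by norm_num)]
  rw [Real.logb_mul hq0.ne' hq1.ne', Real.logb_mul (by positivity) hN0.ne',
    Real.logb_mul (by positivity) (by positivity), Real.logb_pow, Real.logb_pow, hlq, hl1q] at hlog
  have hmain : X * a + Y * b ≤ X + Y + β' * Real.logb 2 N := by
    have := mul_le_mul_of_nonneg_left hlog hβ'0.le
    have e1 : β' * (-(X / β') + -(Y / β')) = -(X + Y : ℝ) := by field_simp; ring
    have e2 : β' * (a * -(X / β') + b * -(Y / β') + Real.logb 2 N)
        = -(X * a + Y * b) + β' * Real.logb 2 N := by field_simp; ring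
    rw [e1, e2] at this
    linarith
  have hlogN : 0 ≤ Real.logb 2 N := Real.logb_nonneg one_lt_two (by exact_mod_cast hN)
  have hfin : (1 - η) * N * (x * a + y * b) ≤ (1 + η) * N * (x + y + β * Real.logb 2 N) := by
    have h1 := mul_le_mul_of_nonneg_right hX1 (Nat.cast_nonneg (α := ℝ) a)
    have h2 := mul_le_mul_of_nonneg_right hY1 (Nat.cast_nonneg (α := ℝ) b)
    have h3 := mul_le_mul_of_nonneg_right hβ'le hlogN
    nlinarith
  rw [div_mul_eq_mul_div, le_div_iff₀ hη]
  refine le_of_mul_le_mul_left ?_ hN0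
  linarith

/-! ### The algorithm for the linear problem -/

/-- The stack sizes during a phase of length `N`: all requests are merged at its beginning, and
then the balanced tree is built on top of the merged file. -/
noncomputable def phaseSize (q : ℝ) (N : ℕ) : ℕ → ℕ
  | 0 => 1
  | s + 1 => balanced q N s + 1

lemma phaseSize_succ_le (q : ℝ) {N s : ℕ} (hs : s < N) :
    phaseSize q N (s + 1) ≤ phaseSize q N s + 1 := by
  cases s with
  | zero => have := balanced_zero_le q N; simp only [phaseSize]; omega
  | succ s => have := balanced_succ_le q hs; simp only [phaseSize]; omega

lemma one_le_phaseSize (q : ℝ) (N s : ℕ) : 1 ≤ phaseSize q N s := by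
  cases s <;> simp [phaseSize]

/-- The integer parts of the total length and the total read rate of the first `N` requests. -/
noncomputable def estimates (l r : ℕ → ℝ≥0) (N : ℕ) : ℕ × ℕ :=
  (⌊∑ u ∈ Finset.range N, l u⌋₊, ⌊∑ u ∈ Finset.range N, r u⌋₊)

/-- The number of files merged with the new one at time `t` by the algorithm for the linear
problem, given the sequences of lengths and of read rates. Merging is free as long as all lengths
vanish, and large stacks are free as long as all read rates vanish. Apart from these cases, there
are phases `[N, 2 * N)` with `N` a power of two; the tree for a phase is based on the requests
before the phase. -/
noncomputable def mergeCount (l r : ℕ → ℝ≥0) (t : ℕ) : ℕ :=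
  open Classical in
  if ∀ u ≤ t, l u = 0 then t
  else if ∀ u ≤ t, r u = 0 then 0
  else if t = 2 ^ Nat.log 2 t then t
  else
    phaseSize (splitRatio (estimates l r (2 ^ Nat.log 2 t)).1 (estimates l r (2 ^ Nat.log 2 t)).2)
        (2 ^ Nat.log 2 t) (t - 2 ^ Nat.log 2 t - 1) + 1
      - phaseSize
          (splitRatio (estimates l r (2 ^ Nat.log 2 t)).1 (estimates l r (2 ^ Nat.log 2 t)).2)
          (2 ^ Nat.log 2 t) (t - 2 ^ Nat.log 2 t)

/-- The online algorithm for the linear problem. -/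
noncomputable def linearAlgorithm : OnlineAlgorithm := fun t I => mergeCount (len I) (rate I) t

lemma estimates_congr {l l' r r' : ℕ → ℝ≥0} {N : ℕ} (hl : ∀ u < N, l u = l' u)
    (hr : ∀ u < N, r u = r' u) : estimates l r N = estimates l' r' N := by
  unfold estimates
  rw [Finset.sum_congr rfl fun u hu => hl u (Finset.mem_range.mp hu),
    Finset.sum_congr rfl fun u hu => hr u (Finset.mem_range.mp hu)]

lemma mergeCount_congr {l l' r r' : ℕ → ℝ≥0} {t : ℕ} (hl : ∀ u ≤ t, l u = l' u)
    (hr : ∀ u ≤ t, r u = r' u) : mergeCount l r t = mergeCount l' r' t := by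
  have h1 : (∀ u ≤ t, l u = 0) ↔ ∀ u ≤ t, l' u = 0 :=
    forall₂_congr fun u hu => by rw [hl u hu]
  have h2 : (∀ u ≤ t, r u = 0) ↔ ∀ u ≤ t, r' u = 0 :=
    forall₂_congr fun u hu => by rw [hr u hu]
  have h3 : estimates l r (2 ^ Nat.log 2 t) = estimates l' r' (2 ^ Nat.log 2 t) := by
    have hlt : ∀ u < 2 ^ Nat.log 2 t, u ≤ t := by
      intro u hu
      rcases Nat.eq_zero_or_pos t with rfl | ht
      · simp at hu; omega
      · have := Nat.pow_log_le_self 2 ht.ne'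
        omega
    exact estimates_congr (fun u hu => hl u (hlt u hu)) fun u hu => hr u (hlt u hu)
  unfold mergeCount
  simp only [h1, h2, h3]

lemma schedule_linearAlgorithm {n : ℕ} (I : Fin n → Request) {t : ℕ} (ht : t < n) :
    linearAlgorithm.schedule I ⟨t, ht⟩ = mergeCount (len I) (rate I) t := by
  refine mergeCount_congr (fun u hu => ?_) fun u hu => ?_
  · have hu : u ≤ t := hu
    unfold len
    rw [dif_pos (show u < t + 1 by omega), dif_pos (show u < n by omega)]
    rfl
  · have hu : u ≤ t := hu
    unfold rate
    rw [dif_pos (show u < t + 1 by omega), dif_pos (show u < n by omega)]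
    rfl

lemma measurable_len (n u : ℕ) : Measurable fun I : Fin n → Request => len I u := by
  unfold len; split_ifs <;> fun_prop

lemma measurable_rate (n u : ℕ) : Measurable fun I : Fin n → Request => rate I u := by
  unfold rate; split_ifs <;> fun_prop

lemma measurable_estimates (n N : ℕ) :
    Measurable fun I : Fin n → Request => estimates (len I) (rate I) N := by
  unfold estimates
  exact (Finset.measurable_fun_sum _ fun u _ => measurable_len n u).nat_floor.prodMk
    (Finset.measurable_fun_sum _ fun u _ => measurable_rate n u).nat_floor

lemma measurable_linearAlgorithm (t : ℕ) : Measurable (linearAlgorithm t) := by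
  have hset : ∀ g : (Fin (t + 1) → Request) → ℕ → ℝ≥0, (∀ u, Measurable fun I => g I u) →
      MeasurableSet {I | ∀ u ≤ t, g I u = 0} := by
    intro g hg
    have : {I | ∀ u ≤ t, g I u = 0} = ⋂ u ∈ Set.Iic t, {I | g I u = 0} := by
      ext I; simp
    rw [this]
    exact MeasurableSet.biInter (Set.to_countable _) fun u _ =>
      measurableSet_eq_fun (hg u) measurable_const
  have hest := measurable_estimates (t + 1) (2 ^ Nat.log 2 t)
  unfold linearAlgorithm mergeCount
  refine Measurable.ite (hset _ (measurable_len _)) measurable_const ?_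
  refine Measurable.ite (hset _ (measurable_rate _)) measurable_const ?_
  refine Measurable.ite (MeasurableSet.const _) measurable_const ?_
  exact (measurable_of_countable fun e : ℕ × ℕ =>
    phaseSize (splitRatio e.1 e.2) (2 ^ Nat.log 2 t) (t - 2 ^ Nat.log 2 t - 1) + 1
      - phaseSize (splitRatio e.1 e.2) (2 ^ Nat.log 2 t) (t - 2 ^ Nat.log 2 t)).comp hest

/-- The stack sizes during a phase, provided that both estimates are positive. -/
lemma size_linearAlgorithm {n : ℕ} (I : Fin n → Request) {i : ℕ}
    (hX : (estimates (len I) (rate I) (2 ^ i)).1 ≠ 0)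
    (hY : (estimates (len I) (rate I) (2 ^ i)).2 ≠ 0) {s : ℕ} (hs : s < 2 ^ i)
    (hn : 2 ^ i + s < n) :
    size I (linearAlgorithm.schedule I) (2 ^ i + s)
      = phaseSize (splitRatio (estimates (len I) (rate I) (2 ^ i)).1
          (estimates (len I) (rate I) (2 ^ i)).2) (2 ^ i) s := by
  have hpos : 0 < 2 ^ i := by positivity
  have hne : ∀ g : ℕ → ℝ≥0, ⌊∑ u ∈ Finset.range (2 ^ i), g u⌋₊ ≠ 0 →
      ∀ t, 2 ^ i ≤ t → ¬ ∀ u ≤ t, g u = 0 := by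
    intro g hg t ht hz
    refine hg ?_
    rw [Finset.sum_eq_zero fun u hu => hz u (by rw [Finset.mem_range] at hu; omega),
      Nat.floor_zero]
  have hlog : ∀ s < 2 ^ i, Nat.log 2 (2 ^ i + s) = i := by
    intro s hs
    exact Nat.log_eq_of_pow_le_of_lt_pow (by omega) (by rw [pow_succ]; omega)
  induction s with
  | zero =>
    have hm : mergeCount (len I) (rate I) (2 ^ i) = 2 ^ i := by
      have := hlog 0 hpos
      rw [add_zero] at this
      rw [mergeCount, if_neg (hne _ hX _ le_rfl), if_neg (hne _ hY _ le_rfl), this, if_pos rfl]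
    obtain ⟨j, hj⟩ : ∃ j, 2 ^ i = j + 1 := ⟨2 ^ i - 1, by omega⟩
    rw [add_zero] at hn ⊢
    simp only [hj] at hn hm ⊢
    rw [size_succ I _ hn, schedule_linearAlgorithm I hn, hm]
    have := size_le I (linearAlgorithm.schedule I) (t := j) (by omega)
    simp only [phaseSize]
    omega
  | succ s ih =>
    have ih := ih (by omega) (by omega)
    have hm := schedule_linearAlgorithm I hn
    rw [mergeCount, if_neg (hne _ hX _ (by omega)), if_neg (hne _ hY _ (by omega)),
      hlog _ hs, if_neg (by omega), show 2 ^ i + (s + 1) - 2 ^ i - 1 = s by omega,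
      Nat.add_sub_cancel_left] at hm
    rw [← add_assoc, size_succ I _ (by omega), ih]
    simp only [← add_assoc] at hm
    rw [hm]
    have h1 := phaseSize_succ_le (splitRatio (estimates (len I) (rate I) (2 ^ i)).1
          (estimates (len I) (rate I) (2 ^ i)).2) (N := 2 ^ i) (s := s) (by omega)
    have h2 := one_le_phaseSize (splitRatio (estimates (len I) (rate I) (2 ^ i)).1
          (estimates (len I) (rate I) (2 ^ i)).2) (2 ^ i) (s + 1)
    omega

/-! ### Cost of a phase -/

lemma records_le (b : ℕ → ℕ) (e t : ℕ) : records b e t ≤ e := by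
  calc records b e t ≤ (Finset.Ico t e).card := Finset.card_filter_le _ _
    _ ≤ e := by rw [Nat.card_Ico]; omega

lemma balanced_le (q : ℝ) (n t : ℕ) : balanced q n t ≤ n := by
  induction n using Nat.strong_induction_on generalizing t with
  | _ n ih =>
    cases n with
    | zero => simp [balanced]
    | succ n =>
      obtain ⟨k, hkn, -, h1, h2, h3⟩ := exists_balanced_root q n
      rcases lt_trichotomy t k with h | rfl | h
      · rw [h1 t h]; exact (ih k (by omega) t).trans (by omega)
      · rw [h2]; omega
      · obtain ⟨s, rfl⟩ : ∃ s, t = k + 1 + s := ⟨t - k - 1, by omega⟩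
        rw [h3]
        have := ih (n - k) (by omega) s
        omega

/-- The cost of request `t` for the linear algorithm. -/
noncomputable def stepCost {n : ℕ} (I : Fin n → Request) (t : ℕ) : ℝ :=
  mergeLen I (linearAlgorithm.schedule I) t + rate I t * size I (linearAlgorithm.schedule I) t

lemma toReal_cost_linearAlgorithm {n : ℕ} (I : Fin n → Request) :
    (linearAlgorithm.cost fLinear I).toReal = ∑ t ∈ Finset.range n, stepCost I t :=
  toReal_cost_fLinear I _

lemma stepCost_nonneg {n : ℕ} (I : Fin n → Request) (t : ℕ) : 0 ≤ stepCost I t :=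
  add_nonneg (mergeLen_nonneg _ _ _) (by positivity)

lemma measurable_stepCost (n t : ℕ) : Measurable fun I : Fin n → Request => stepCost I t := by
  have h : Measurable fun q : (Fin n → Request) × Schedule n =>
      mergeLen q.1 q.2 t + rate q.1 t * size q.1 q.2 t := by
    refine measurable_from_prod_countable_left fun σ => ?_
    have h1 : ∀ I : Fin n → Request, size I σ = size (0 : Fin n → Request) σ :=
      fun I => size_congr I 0 σ
    simp only [mergeLen, h1]
    refine Measurable.fun_add ?_ ?_
    · exact Finset.measurable_fun_sum _ fun u _ => (measurable_len n u).coe_nnreal_real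
    · exact (measurable_rate n t).coe_nnreal_real.mul_const _
  have h2 := measurable_id.prodMk (measurable_schedule measurable_linearAlgorithm n)
  have h3 : (fun I : Fin n → Request => stepCost I t)
      = (fun q : (Fin n → Request) × Schedule n => mergeLen q.1 q.2 t + rate q.1 t * size q.1 q.2 t)
        ∘ fun I => (id I, linearAlgorithm.schedule I) := rfl
  rw [h3]
  exact h.comp h2

/-- The number of merges of the `s`-th request in the balanced tree for the estimates `e`. -/
noncomputable def treeRecords (N s : ℕ) (e : ℕ × ℕ) : ℕ :=
  records (balanced (splitRatio e.1 e.2) N) N s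

/-- The stack size after the `s`-th request in the balanced tree for the estimates `e`. -/
noncomputable def treeSize (N s : ℕ) (e : ℕ × ℕ) : ℕ := balanced (splitRatio e.1 e.2) N s

/-- The cost of a phase that starts at time `N = 2 ^ i`, up to time `e`. -/
lemma sum_phase_le {M : ℝ} {n : ℕ} (I : Fin n → Request) (hl : ∀ u, (len I u : ℝ) ≤ M)
    (hr : ∀ u, (rate I u : ℝ) ≤ M) {N i e : ℕ} (hN : N = 2 ^ i) (hNe : N < e) (hen : e ≤ n)
    (he : e ≤ 2 * N) {E : ℕ × ℕ} (hE : estimates (len I) (rate I) N = E)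
    (hX : E.1 ≠ 0) (hY : E.2 ≠ 0) :
    ∑ t ∈ Finset.Ico N e, stepCost I t ≤ 2 * (N + 1) * M
      + ∑ u ∈ Finset.Ico (N + 1) e, ((treeRecords N (u - (N + 1)) E : ℝ) * len I u
        + (treeSize N (u - (N + 1)) E + 1 : ℝ) * rate I u) := by
  set σ := linearAlgorithm.schedule I with hσ
  have hsize : ∀ s < N, N + s < n → size I σ (N + s) = phaseSize (splitRatio E.1 E.2) N s := by
    intro s hs hn
    subst hN
    have := size_linearAlgorithm I (i := i) (by rw [hE]; exact hX) (by rw [hE]; exact hY) hs hn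
    rw [hE] at this
    exact this
  have h0 : size I σ N = 1 := by
    have := hsize 0 (by omega) (by omega)
    rwa [add_zero] at this
  have hs1 : ∀ s, N + 1 + s < e → size I σ (N + 1 + s) = treeSize N s E + 1 := by
    intro s hs
    have := hsize (s + 1) (by omega) (by omega)
    rwa [show N + (s + 1) = N + 1 + s by ring] at this
  have hpos : ∀ s, N + 1 + s < e → 1 ≤ treeSize N s E :=
    fun s hs => one_le_balanced _ (by omega)
  have hmerge : ∀ t ∈ Finset.Ico (N + 1) e,
      mergeLen I σ t = ∑ u ∈ (topFile (size I σ) t).filter (N + 1 ≤ ·), (len I u : ℝ) := by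
    intro t ht
    rw [Finset.mem_Ico] at ht
    rw [Finset.filter_true_of_mem, mergeLen]
    intro u hu
    by_contra hlt
    have h1 := (mem_topFile.mp hu).2 N (by omega) (by omega)
    obtain ⟨s, rfl⟩ : ∃ s, t = N + 1 + s := ⟨t - (N + 1), by omega⟩
    rw [h0, hs1 s ht.2] at h1
    have := hpos s ht.2
    omega
  rw [Finset.sum_eq_sum_Ico_succ_bot hNe]
  refine add_le_add (step_cost_le I hl hr σ (by omega)) ?_
  unfold stepCost
  rw [Finset.sum_add_distrib, Finset.sum_add_distrib, Finset.sum_congr rfl hmerge,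
    sum_topFile_eq]
  refine add_le_add (Finset.sum_le_sum fun u hu => ?_) (Finset.sum_le_sum fun u hu => ?_)
  · rw [Finset.mem_Ico] at hu
    rw [mul_comm]
    refine mul_le_mul_of_nonneg_right ?_ (NNReal.coe_nonneg _)
    obtain ⟨s, rfl⟩ : ∃ s, u = N + 1 + s := ⟨u - (N + 1), by omega⟩
    obtain ⟨d, rfl⟩ : ∃ d, e = N + 1 + d := ⟨e - (N + 1), by omega⟩
    rw [Nat.add_sub_cancel_left]
    have h1 : records (size I σ) (N + 1 + d) (N + 1 + s)
        = records (balanced (splitRatio E.1 E.2) N) d s :=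
      records_shift fun w _ hw => hs1 w (by omega)
    rw [h1]
    exact_mod_cast records_mono _ (by omega) s
  · rw [Finset.mem_Ico] at hu
    obtain ⟨s, rfl⟩ : ∃ s, u = N + 1 + s := ⟨u - (N + 1), by omega⟩
    rw [Nat.add_sub_cancel_left, mul_comm, ← hσ, hs1 s hu.2]
    push_cast
    exact le_rfl

/-! ### Accuracy of the estimates -/

/-- The estimates `e` based on `N` requests are correct up to the factors `1 ± η`, if `x` and `y`
are the mean length and the mean read rate. -/
def Accurate (η x y : ℝ) (N : ℕ) (e : ℕ × ℕ) : Prop :=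
  ((1 - η) * (N * x) ≤ e.1 ∧ (e.1 : ℝ) ≤ (1 + η) * (N * x)) ∧
    ((1 - η) * (N * y) ≤ e.2 ∧ (e.2 : ℝ) ≤ (1 + η) * (N * y))

section
variable {p : Measure Request} [IsProbabilityMeasure p]

lemma prob_floor_sum_le {ψ : Request → ℝ} {M : ℝ} (h : BoundedBy p ψ M) (hM : 0 ≤ M) {n N : ℕ}
    (hN : 1 ≤ N) (hNn : N ≤ n) {x η : ℝ} (hx : ∫ z, ψ z ∂p = x) (hx0 : 0 < x) (hη : 0 < η)
    {f : (Fin n → Request) → ℝ≥0}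
    (hf : ∀ I, (f I : ℝ) = ∑ u ∈ Finset.range N, coord ψ I u) :
    (iid p n).real {I | ¬ ((1 - η) * (N * x) ≤ (⌊f I⌋₊ : ℝ) ∧
      (⌊f I⌋₊ : ℝ) ≤ (1 + η) * (N * x))} ≤ ((2 * M / (η * x)) ^ 2 + 2 / (η * x)) / N := by
  have hN0 : (0 : ℝ) < N := by exact_mod_cast hN
  rcases le_total (η * x * N) 2 with hsmall | hlarge
  · refine measureReal_le_one.trans ?_
    rw [le_div_iff₀ hN0, one_mul]
    have : (N : ℝ) ≤ 2 / (η * x) := by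
      rw [le_div_iff₀ (by positivity)]; linarith
    have : 0 ≤ (2 * M / (η * x)) ^ 2 := by positivity
    linarith
  · have hdev := h.prob_sum_dev_le hM (n := n) (W := Finset.range N)
      (fun u hu => by rw [Finset.mem_range] at hu; omega) (c := η * x * N / 2) (by positivity)
    rw [hx, Finset.card_range] at hdev
    refine (measureReal_mono fun I hI => ?_).trans (hdev.trans ?_)
    · rw [Set.mem_ofPred_eq, ← hf]
      rw [Set.mem_ofPred_eq] at hI
      have h1 : (⌊f I⌋₊ : ℝ) ≤ f I := by exact_mod_cast Nat.floor_le (zero_le (a := f I))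
      have h2 : (f I : ℝ) < ⌊f I⌋₊ + 1 := by exact_mod_cast Nat.lt_floor_add_one (f I)
      by_contra hcon
      rw [not_le, abs_lt] at hcon
      refine hI ⟨?_, ?_⟩ <;> nlinarith
    · have e : (N : ℝ) * M ^ 2 / (η * x * N / 2) ^ 2 = (2 * M / (η * x)) ^ 2 / N := by
        field_simp
      rw [e]
      have : 0 ≤ 2 / (η * x) := by positivity
      gcongr
      linarith

lemma exists_prob_not_accurate_le (hp : IsBoundedDist p) (hx : 0 < meanLength p)
    (hy : 0 < meanRate p) {η : ℝ} (hη : 0 < η) : ∃ C : ℝ, 0 ≤ C ∧ ∀ n N : ℕ, 1 ≤ N → N ≤ n →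
      (iid p n).real {I | ¬ Accurate η (meanLength p) (meanRate p) N
        (estimates (len I) (rate I) N)} ≤ C / N := by
  obtain ⟨M, hM, hl, hr⟩ := hp.exists_boundedBy
  set x := meanLength p with hxdef
  set y := meanRate p with hydef
  refine ⟨((2 * M / (η * x)) ^ 2 + 2 / (η * x)) + ((2 * M / (η * y)) ^ 2 + 2 / (η * y)),
    by positivity, fun n N hN hNn => ?_⟩
  have h1 := prob_floor_sum_le hl hM (n := n) hN hNn (x := x) rfl hx hη
    (f := fun I => ∑ u ∈ Finset.range N, len I u) fun I => by
      push_cast; exact Finset.sum_congr rfl fun u _ => coe_len I u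
  have h2 := prob_floor_sum_le hr hM (n := n) hN hNn (x := y) rfl hy hη
    (f := fun I => ∑ u ∈ Finset.range N, rate I u) fun I => by
      push_cast; exact Finset.sum_congr rfl fun u _ => coe_rate_eq I u
  rw [add_div]
  refine le_trans ?_ (add_le_add h1 h2)
  refine le_trans (measureReal_mono fun I hI => ?_) (measureReal_union_le _ _)
  rw [Set.mem_union, Set.mem_ofPred_eq, Set.mem_ofPred_eq]
  rw [Set.mem_ofPred_eq] at hI
  by_contra hcon
  push Not at hcon
  exact hI ⟨⟨hcon.1.1, hcon.1.2⟩, hcon.2.1, hcon.2.2⟩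

/-- Estimates are independent of later requests. -/
lemma indepFun_estimates {ψ : Request → ℝ} (hψ : Measurable ψ) {n N u : ℕ} (hNu : N ≤ u)
    (hu : u < n) : IndepFun (fun I : Fin n → Request => estimates (len I) (rate I) N)
      (fun I => coord ψ I u) (iid p n) := by
  classical
  set S : Finset (Fin n) := Finset.univ.filter fun t => (t : ℕ) < N with hS
  have hdisj : Disjoint S {⟨u, hu⟩} := by
    rw [Finset.disjoint_singleton_right, hS, Finset.mem_filter]
    simp only [Finset.mem_univ, true_and]
    omega
  have hind := (iIndepFun_request p n).indepFun_finset S {⟨u, hu⟩} hdisj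
    fun t => measurable_pi_apply t
  set ext : (S → Request) → (Fin n → Request) := fun v t => if h : t ∈ S then v ⟨t, h⟩ else 0
    with hext
  have hextm : Measurable ext := by
    refine measurable_pi_lambda _ fun t => ?_
    by_cases h : t ∈ S
    · simp only [hext, dif_pos h]; exact measurable_pi_apply _
    · simp only [hext, dif_neg h]; exact measurable_const
  have hφ2 : Measurable fun v : (({⟨u, hu⟩} : Finset (Fin n)) → Request) =>
      ψ (v ⟨⟨u, hu⟩, Finset.mem_singleton_self _⟩) := hψ.comp (measurable_pi_apply _)
  have := hind.comp ((measurable_estimates n N).comp hextm) hφ2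
  convert this using 1
  · funext I
    simp only [Function.comp_apply]
    refine estimates_congr (fun w hw => ?_) fun w hw => ?_
    · have : (⟨w, by omega⟩ : Fin n) ∈ S := by simp [hS, hw]
      simp only [len, dif_pos (show w < n by omega), hext, dif_pos this]
    · have : (⟨w, by omega⟩ : Fin n) ∈ S := by simp [hS, hw]
      simp only [rate, dif_pos (show w < n by omega), hext, dif_pos this]
  · funext I
    simp only [coord, dif_pos hu, Function.comp_apply]

lemma integrable_estimates {h : ℕ × ℕ → ℝ} {B : ℝ} (hB : ∀ e, |h e| ≤ B) (n N : ℕ) :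
    Integrable (fun I : Fin n → Request => h (estimates (len I) (rate I) N)) (iid p n) :=
  Integrable.of_bound ((measurable_of_countable h).comp
    (measurable_estimates n N)).aestronglyMeasurable B (ae_of_all _ fun _ => hB _)

lemma integrable_estimates_mul {ψ : Request → ℝ} {M : ℝ} (hψ : BoundedBy p ψ M) (hM : 0 ≤ M)
    {h : ℕ × ℕ → ℝ} {B : ℝ} (hB : ∀ e, |h e| ≤ B) (n N u : ℕ) :
    Integrable (fun I : Fin n → Request => h (estimates (len I) (rate I) N) * coord ψ I u)
      (iid p n) := by
  refine Integrable.of_bound (((measurable_of_countable h).comp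
    (measurable_estimates n N)).mul (measurable_coord hψ.measurable u)).aestronglyMeasurable
    (B * M) ?_
  filter_upwards [hψ.ae_coord_le hM n] with I hI
  rw [norm_mul, Real.norm_eq_abs, Real.norm_of_nonneg (hψ.coord_nonneg I u)]
  exact mul_le_mul (hB _) (hI u) (hψ.coord_nonneg I u) ((abs_nonneg _).trans (hB (0, 0)))

lemma integral_estimates_mul {ψ : Request → ℝ} (hψ : Measurable ψ) (h : ℕ × ℕ → ℝ) {n N u : ℕ}
    (hNu : N ≤ u) (hu : u < n) :
    ∫ I : Fin n → Request, h (estimates (len I) (rate I) N) * coord ψ I u ∂(iid p n)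
      = (∫ I : Fin n → Request, h (estimates (len I) (rate I) N) ∂(iid p n)) * ∫ z, ψ z ∂p := by
  have hind := (indepFun_estimates (p := p) hψ hNu hu).comp (measurable_of_countable h)
    measurable_id
  rw [← integral_coord hψ hu]
  exact hind.integral_fun_mul_eq_mul_integral
    ((measurable_of_countable h).comp (measurable_estimates n N)).aestronglyMeasurable
    (measurable_coord hψ u).aestronglyMeasurable

lemma integrable_stepCost (hp : IsBoundedDist p) {n t : ℕ} (ht : t < n) :
    Integrable (fun I : Fin n → Request => stepCost I t) (iid p n) := by
  obtain ⟨M, hM, hle⟩ := hp.ae_le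
  refine Integrable.of_bound (measurable_stepCost n t).aestronglyMeasurable
    (2 * ((t : ℝ) + 1) * M) ?_
  filter_upwards [hle n] with I hI
  rw [Real.norm_of_nonneg (stepCost_nonneg I t)]
  exact step_cost_le I hI.1 hI.2 _ ht

/-! ### Expected cost of the linear algorithm -/

/-- The expected cost of a phase: accurate estimates make all nodes of the tree cheap in
expectation, as the requests of the phase are independent of the estimates. Inaccurate estimates
have probability `O(1/N)`, so that a crude bound suffices for them. -/
lemma integral_phase_le (hp : IsBoundedDist p) (hx : 0 < meanLength p) (hy : 0 < meanRate p)
    {β : ℝ} (hβ : SolvesKraft (meanLength p) (meanRate p) β) {η : ℝ} (hη0 : 0 < η) (hη1 : η < 1) :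
    ∃ C : ℝ, 0 ≤ C ∧ ∀ n i e : ℕ, 2 ^ i < e → e ≤ n → e ≤ 2 * 2 ^ i →
      ∑ t ∈ Finset.Ico (2 ^ i) e, ∫ I : Fin n → Request, stepCost I t ∂(iid p n) ≤
        (e - (2 ^ i : ℕ)) * ((1 + η) / (1 - η) * (meanLength p + meanRate p
          + β * Real.logb 2 (2 ^ i : ℕ)) + meanRate p) + C * (2 ^ i : ℕ) := by
  classical
  obtain ⟨M, hM, hl, hr⟩ := hp.exists_boundedBy
  obtain ⟨C, hC, hprob⟩ := exists_prob_not_accurate_le hp hx hy hη0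
  set x := meanLength p with hxdef
  set y := meanRate p with hydef
  refine ⟨4 * M + 4 * M * C, by positivity, fun n i e hNe hen he => ?_⟩
  generalize hN : 2 ^ i = N at hNe he ⊢
  have hN1 : 1 ≤ N := by rw [← hN]; exact Nat.one_le_two_pow
  have hN0 : (0 : ℝ) < N := by exact_mod_cast hN1
  have hN1' : (1 : ℝ) ≤ N := by exact_mod_cast hN1
  set Λ := (1 + η) / (1 - η) * (x + y + β * Real.logb 2 N) with hΛ
  have hΛ0 : 0 ≤ Λ := by
    have := Real.logb_nonneg one_lt_two hN1'
    have h1 : 0 < 1 - η := by linarith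
    have h2 := hβ.1
    positivity
  set g₁ : ℕ → ℕ × ℕ → ℝ := fun u E =>
    if Accurate η x y N E then (treeRecords N (u - (N + 1)) E : ℝ) else 0 with hg₁
  set g₂ : ℕ → ℕ × ℕ → ℝ := fun u E =>
    if Accurate η x y N E then (treeSize N (u - (N + 1)) E + 1 : ℝ) else 0 with hg₂
  set g₃ : ℕ × ℕ → ℝ := fun E => if Accurate η x y N E then 0 else 1 with hg₃
  have hb₁ : ∀ u E, |g₁ u E| ≤ N := by
    intro u E
    simp only [hg₁]
    split_ifs
    · rw [abs_of_nonneg (by positivity)]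
      exact_mod_cast records_le _ N _
    · simp
  have hb₂ : ∀ u E, |g₂ u E| ≤ N + 1 := by
    intro u E
    simp only [hg₂]
    split_ifs
    · rw [abs_of_nonneg (by positivity)]
      have : (treeSize N (u - (N + 1)) E : ℝ) ≤ N := by exact_mod_cast balanced_le _ N _
      linarith
    · simp only [abs_zero]; positivity
  have hb₃ : ∀ E, |g₃ E| ≤ 1 := by
    intro E
    simp only [hg₃]
    split_ifs <;> simp
  set est : (Fin n → Request) → ℕ × ℕ := fun I => estimates (len I) (rate I) N with hest
  have hpath : ∀ᵐ I ∂(iid p n), ∑ t ∈ Finset.Ico N e, stepCost I t ≤ 4 * N * M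
      + ∑ u ∈ Finset.Ico (N + 1) e, (g₁ u (est I) * coord lenFun I u
        + g₂ u (est I) * coord rateFun I u) + 4 * N ^ 2 * M * g₃ (est I) := by
    filter_upwards [hl.ae_coord_le hM n, hr.ae_coord_le hM n] with I hI1 hI2
    simp only [← coe_len, ← coe_rate_eq] at hI1 hI2 ⊢
    by_cases hacc : Accurate η x y N (est I)
    · have hpos : 0 < (1 - η) * N := mul_pos (by linarith) hN0
      have hX : (est I).1 ≠ 0 := by
        intro h0
        have := hacc.1.1
        rw [h0, Nat.cast_zero] at this
        nlinarith
      have hY : (est I).2 ≠ 0 := by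
        intro h0
        have := hacc.2.1
        rw [h0, Nat.cast_zero] at this
        nlinarith
      have := sum_phase_le I hI1 hI2 hN.symm hNe hen he (E := est I) rfl hX hY
      simp only [hg₁, hg₂, hg₃, if_pos hacc, mul_zero, add_zero]
      refine this.trans (add_le_add_left ?_ _)
      nlinarith
    · simp only [hg₁, hg₂, hg₃, if_neg hacc, zero_mul, add_zero, Finset.sum_const_zero, mul_one]
      have h1 : ∑ t ∈ Finset.Ico N e, stepCost I t ≤ (Finset.Ico N e).card • (2 * (2 * N) * M) := by
        refine Finset.sum_le_card_nsmul _ _ _ fun t ht => ?_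
        rw [Finset.mem_Ico] at ht
        refine (step_cost_le I hI1 hI2 _ (by omega)).trans ?_
        have : (t : ℝ) + 1 ≤ 2 * N := by exact_mod_cast (by omega : t + 1 ≤ 2 * N)
        gcongr
      have h2 : ((Finset.Ico N e).card : ℝ) ≤ N := by
        rw [Nat.card_Ico]; exact_mod_cast (by omega : e - N ≤ N)
      rw [nsmul_eq_mul] at h1
      calc _ ≤ ((Finset.Ico N e).card : ℝ) * (2 * (2 * N) * M) := h1
        _ ≤ N * (2 * (2 * N) * M) := by gcongr
        _ = 4 * N ^ 2 * M := by ring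
        _ ≤ 4 * N * M + 4 * N ^ 2 * M := by
            have : 0 ≤ 4 * (N : ℝ) * M := by positivity
            linarith
  have i₁ : ∀ u, Integrable (fun I => g₁ u (est I) * coord lenFun I u) (iid p n) :=
    fun u => integrable_estimates_mul hl hM (hb₁ u) n N u
  have i₂ : ∀ u, Integrable (fun I => g₂ u (est I) * coord rateFun I u) (iid p n) :=
    fun u => integrable_estimates_mul hr hM (hb₂ u) n N u
  have i₃ : Integrable (fun I => g₃ (est I)) (iid p n) := integrable_estimates hb₃ n N
  have j₁ : ∀ u, Integrable (fun I => g₁ u (est I)) (iid p n) :=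
    fun u => integrable_estimates (hb₁ u) n N
  have j₂ : ∀ u, Integrable (fun I => g₂ u (est I)) (iid p n) :=
    fun u => integrable_estimates (hb₂ u) n N
  have hnode : ∀ u ∈ Finset.Ico (N + 1) e,
      ∫ I, (g₁ u (est I) * coord lenFun I u + g₂ u (est I) * coord rateFun I u) ∂(iid p n)
        ≤ Λ + y := by
    intro u hu
    rw [Finset.mem_Ico] at hu
    rw [integral_add (i₁ u) (i₂ u), integral_estimates_mul hl.measurable (g₁ u) (by omega)
      (by omega), integral_estimates_mul hr.measurable (g₂ u) (by omega) (by omega)]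
    change (∫ I, g₁ u (est I) ∂(iid p n)) * x + (∫ I, g₂ u (est I) ∂(iid p n)) * y ≤ Λ + y
    rw [← integral_mul_const, ← integral_mul_const,
      ← integral_add ((j₁ u).mul_const x) ((j₂ u).mul_const y)]
    calc ∫ I, (g₁ u (est I) * x + g₂ u (est I) * y) ∂(iid p n) ≤ ∫ _, (Λ + y) ∂(iid p n) := by
          refine integral_mono (((j₁ u).mul_const x).add ((j₂ u).mul_const y))
            (integrable_const _) fun I => ?_
          simp only [hg₁, hg₂]
          split_ifs with hacc
          · have := balanced_cost_le hx hy hβ hη0 hη1 hN1 hacc.1.1 hacc.1.2 hacc.2.1 hacc.2.2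
              (t := u - (N + 1)) (by omega)
            change _ ≤ Λ at this
            simp only [treeRecords, treeSize]
            linarith
          · simp only [zero_mul, add_zero]; positivity
      _ = Λ + y := by simp
  have hbad : ∫ I, g₃ (est I) ∂(iid p n) ≤ C / N := by
    have hm : MeasurableSet {I | ¬ Accurate η x y N (est I)} :=
      measurable_estimates n N (Set.to_countable {E | ¬ Accurate η x y N E}).measurableSet
    have he : (fun I => g₃ (est I)) = Set.indicator {I | ¬ Accurate η x y N (est I)} 1 := by
      funext I
      simp only [hg₃, Set.indicator_apply, Set.mem_ofPred_eq, Pi.one_apply, ite_not]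
    rw [he, integral_indicator_one hm]
    exact hprob n N hN1 (by omega)
  have isum : Integrable (fun I => ∑ u ∈ Finset.Ico (N + 1) e, (g₁ u (est I) * coord lenFun I u
        + g₂ u (est I) * coord rateFun I u)) (iid p n) :=
    integrable_finsetSum _ fun u _ => (i₁ u).add (i₂ u)
  have hstep : ∀ t ∈ Finset.Ico N e, Integrable (fun I => stepCost I t) (iid p n) := by
    intro t ht
    rw [Finset.mem_Ico] at ht
    exact integrable_stepCost hp (by omega)
  have hmono := integral_mono_ae (integrable_finsetSum _ hstep)
    (((integrable_const _).add isum).add (i₃.const_mul _)) hpath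
  have e1 : ∫ I, ∑ u ∈ Finset.Ico (N + 1) e, (g₁ u (est I) * coord lenFun I u
      + g₂ u (est I) * coord rateFun I u) ∂(iid p n) = ∑ u ∈ Finset.Ico (N + 1) e,
      ∫ I, (g₁ u (est I) * coord lenFun I u + g₂ u (est I) * coord rateFun I u) ∂(iid p n) :=
    integral_finsetSum _ fun u _ => (i₁ u).add (i₂ u)
  have e2 : ∫ I, 4 * (N : ℝ) ^ 2 * M * g₃ (est I) ∂(iid p n)
      = 4 * (N : ℝ) ^ 2 * M * ∫ I, g₃ (est I) ∂(iid p n) := integral_const_mul _ _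
  have e3 : ∫ _ : Fin n → Request, (4 * (N : ℝ) * M) ∂(iid p n) = 4 * N * M := by simp
  rw [integral_finsetSum _ hstep, integral_add' ((integrable_const _).add isum) (i₃.const_mul _),
    integral_add' (integrable_const _) isum, e1, e2, e3] at hmono
  refine hmono.trans ?_
  have h1 : ∑ u ∈ Finset.Ico (N + 1) e, ∫ I, (g₁ u (est I) * coord lenFun I u
      + g₂ u (est I) * coord rateFun I u) ∂(iid p n) ≤ (e - N) * (Λ + y) := by
    refine (Finset.sum_le_card_nsmul _ _ _ hnode).trans ?_
    rw [nsmul_eq_mul, Nat.card_Ico]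
    have : ((e - (N + 1) : ℕ) : ℝ) ≤ e - N := by
      rw [Nat.cast_sub (by omega)]; push_cast; linarith
    gcongr
  have h2 : 4 * (N : ℝ) ^ 2 * M * ∫ I, g₃ (est I) ∂(iid p n) ≤ 4 * M * C * N := by
    calc _ ≤ 4 * (N : ℝ) ^ 2 * M * (C / N) := by gcongr
      _ = _ := by field_simp
  linarith

lemma expectedCost_linearAlgorithm_eq (hp : IsBoundedDist p) (n : ℕ) :
    expectedCost linearAlgorithm fLinear p n
      = ∑ t ∈ Finset.range n, ∫ I : Fin n → Request, stepCost I t ∂(iid p n) := by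
  unfold expectedCost
  simp_rw [toReal_cost_linearAlgorithm]
  rw [integral_finsetSum _ fun t ht => integrable_stepCost hp (Finset.mem_range.mp ht)]

lemma expectedCost_linearAlgorithm_le (hp : IsBoundedDist p) (hx : 0 < meanLength p)
    (hy : 0 < meanRate p) {β : ℝ} (hβ : SolvesKraft (meanLength p) (meanRate p) β) {η : ℝ}
    (hη0 : 0 < η) (hη1 : η < 1) : ∃ C : ℝ, ∀ n : ℕ, 1 ≤ n →
      expectedCost linearAlgorithm fLinear p n
        ≤ n * ((1 + η) / (1 - η) * (β * Real.logb 2 n) + C) := by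
  obtain ⟨M, hM, hle⟩ := hp.ae_le
  obtain ⟨C, hC, hphase⟩ := integral_phase_le hp hx hy hβ hη0 hη1
  set x := meanLength p with hxdef
  set y := meanRate p with hydef
  set ρ := (1 + η) / (1 - η) with hρ
  have hρ0 : 0 < ρ := div_pos (by linarith) (by linarith)
  have hβ0 := hβ.1
  refine ⟨ρ * (x + y) + y + 2 * (C + 2 * M), fun n hn => ?_⟩
  set h : ℕ → ℝ := fun t => ∫ I : Fin n → Request, stepCost I t ∂(iid p n) with hh
  set D := ρ * (x + y + β * Real.logb 2 n) + y with hD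
  have hn1 : (1 : ℝ) ≤ n := by exact_mod_cast hn
  have hlog : 0 ≤ Real.logb 2 n := Real.logb_nonneg one_lt_two hn1
  have hD0 : 0 ≤ D := by positivity
  have hph : ∀ i e : ℕ, 2 ^ i < e → e ≤ n → e ≤ 2 * 2 ^ i →
      ∑ t ∈ Finset.Ico (2 ^ i) e, h t ≤ (e - (2 ^ i : ℕ)) * D + C * (2 ^ i : ℕ) := by
    intro i e h1 h2 h3
    refine (hphase n i e h1 h2 h3).trans ?_
    have h4 : (0 : ℝ) ≤ e - (2 ^ i : ℕ) := by
      have : ((2 ^ i : ℕ) : ℝ) ≤ e := by exact_mod_cast h1.le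
      linarith
    have h5 : Real.logb 2 (2 ^ i : ℕ) ≤ Real.logb 2 n :=
      Real.logb_le_logb_of_le one_lt_two (by positivity) (by exact_mod_cast h1.le.trans h2)
    have : ρ * (x + y + β * Real.logb 2 (2 ^ i : ℕ)) + y ≤ D := by rw [hD]; gcongr
    gcongr
  have hfull : ∀ i : ℕ, 2 ^ i ≤ n →
      ∑ t ∈ Finset.range (2 ^ i), h t ≤ (2 ^ i : ℕ) * (D + (C + 2 * M)) := by
    intro i
    induction i with
    | zero =>
      intro _
      rw [pow_zero, Finset.sum_range_one, Nat.cast_one, one_mul]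
      have : h 0 ≤ 2 * M := by
        calc h 0 ≤ ∫ _ : Fin n → Request, 2 * M ∂(iid p n) := by
              refine integral_mono_ae (integrable_stepCost hp hn) (integrable_const _) ?_
              filter_upwards [hle n] with I hI
              have := step_cost_le I hI.1 hI.2 (linearAlgorithm.schedule I) (t := 0) hn
              rw [Nat.cast_zero, zero_add, mul_one] at this
              exact this
          _ = 2 * M := by simp
      linarith
    | succ i ih =>
      intro hi
      have hpos : 0 < 2 ^ i := by positivity
      have h2 : 2 ^ (i + 1) = 2 * 2 ^ i := by ring
      have h3 := ih (by omega)
      have h4 := hph i (2 ^ (i + 1)) (by omega) hi (by omega)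
      rw [Finset.range_eq_Ico] at h3 ⊢
      rw [← Finset.sum_Ico_consecutive h (Nat.zero_le (2 ^ i)) (by omega)]
      have h5 : ((2 ^ (i + 1) : ℕ) : ℝ) = 2 * (2 ^ i : ℕ) := by rw [h2]; push_cast; ring
      rw [h5] at h4 ⊢
      have h6 : 0 ≤ M * ((2 ^ i : ℕ) : ℝ) := by positivity
      linarith
  have hl1 := Nat.pow_log_le_self 2 (show n ≠ 0 by omega)
  have hl2 := Nat.lt_pow_succ_log_self one_lt_two n
  rw [expectedCost_linearAlgorithm_eq hp]
  change ∑ t ∈ Finset.range n, h t ≤ _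
  set i := Nat.log 2 n with hi
  have hfi := hfull i hl1
  have hl1' : ((2 ^ i : ℕ) : ℝ) ≤ n := by exact_mod_cast hl1
  have htot : ∑ t ∈ Finset.range n, h t ≤ n * (D + 2 * (C + 2 * M)) := by
    rcases hl1.eq_or_lt with heq | hlt
    · rw [heq] at hfi
      refine hfi.trans ?_
      gcongr
      linarith
    · have h4 := hph i n hlt le_rfl (by rw [pow_succ] at hl2; omega)
      rw [Finset.range_eq_Ico] at hfi ⊢
      rw [← Finset.sum_Ico_consecutive h (Nat.zero_le (2 ^ i)) hl1]
      have h5 : ((2 ^ i : ℕ) : ℝ) * (C + 2 * M) ≤ n * (C + 2 * M) := by gcongr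
      have h6 : C * ((2 ^ i : ℕ) : ℝ) ≤ C * n := by gcongr
      have h7 : 0 ≤ M * (n : ℝ) := by positivity
      linarith
  refine htot.trans (le_of_eq ?_)
  rw [hD]
  ring

lemma expectedCost_linearAlgorithm_upper (hp : IsBoundedDist p) (hx : 0 < meanLength p)
    (hy : 0 < meanRate p) {β : ℝ} (hβ : SolvesKraft (meanLength p) (meanRate p) β) {η : ℝ}
    (hη : 0 < η) : ∀ᶠ n : ℕ in atTop,
      expectedCost linearAlgorithm fLinear p n ≤ (1 + η) * (β * n * Real.logb 2 n) := by
  have hβ0 := hβ.1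
  set ε := min η 1 / 4 with hε
  have hε0 : 0 < ε := by positivity
  have hε1 : ε ≤ 1 / 4 := by rw [hε]; linarith [min_le_right η 1]
  have hεη : 4 * ε ≤ η := by rw [hε]; linarith [min_le_left η 1]
  obtain ⟨C, hC⟩ := expectedCost_linearAlgorithm_le hp hx hy hβ hε0 (by linarith)
  have hlt : Tendsto (fun n : ℕ => Real.logb 2 n) atTop atTop :=
    (Real.tendsto_logb_atTop one_lt_two).comp tendsto_natCast_atTop_atTop
  have hlim : Tendsto (fun n : ℕ => (1 + ε) / (1 - ε) * β + C / Real.logb 2 n) atTop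
      (𝓝 ((1 + ε) / (1 - ε) * β + 0)) := tendsto_const_nhds.add (hlt.const_div_atTop _)
  have hgt : (1 + ε) / (1 - ε) * β + 0 < (1 + η) * β := by
    rw [add_zero]
    refine mul_lt_mul_of_pos_right ?_ hβ0
    rw [div_lt_iff₀ (by linarith)]
    nlinarith
  filter_upwards [hlim.eventually_lt_const hgt, eventually_ge_atTop 1,
    hlt.eventually_gt_atTop 0] with n h1 hn hln
  have hn0 : (0 : ℝ) < n := by exact_mod_cast hn
  refine (hC n hn).trans ?_
  calc n * ((1 + ε) / (1 - ε) * (β * Real.logb 2 n) + C)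
      = ((1 + ε) / (1 - ε) * β + C / Real.logb 2 n) * (n * Real.logb 2 n) := by field_simp
    _ ≤ (1 + η) * β * (n * Real.logb 2 n) := by gcongr
    _ = _ := by ring

end

/-! ### The linear problem with vanishing lengths or vanishing read rates -/

lemma len_le_mergeLen {n : ℕ} (I : Fin n → Request) (σ : Schedule n) (t : ℕ) :
    (len I t : ℝ) ≤ mergeLen I σ t := by
  refine Finset.single_le_sum (f := fun u => (len I u : ℝ)) (fun _ _ => NNReal.coe_nonneg _) ?_
  rw [mem_topFile]
  refine ⟨le_rfl, fun s hs hs' => ?_⟩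
  rw [le_antisymm hs' hs]

lemma toReal_opt_eq_of_le {n : ℕ} {I : Fin n → Request}
    (h : ∀ σ : Schedule n, ∀ t < n, stepCost I t ≤ mergeLen I σ t + rate I t * size I σ t) :
    (linearAlgorithm.cost fLinear I).toReal = (opt fLinear I).toReal := by
  refine le_antisymm (le_toReal_opt (opt_fLinear_ne_top I) fun σ _ => ?_)
    (ENNReal.toReal_mono (cost_fLinear_ne_top I _) (opt_le_algCost _ _ I))
  rw [toReal_cost_linearAlgorithm, toReal_cost_fLinear]
  exact Finset.sum_le_sum fun t ht => h σ t (Finset.mem_range.mp ht)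

lemma stepCost_le_of_len_eq_zero {n : ℕ} {I : Fin n → Request} (hI : ∀ u, len I u = 0)
    (σ : Schedule n) {t : ℕ} (ht : t < n) :
    stepCost I t ≤ mergeLen I σ t + rate I t * size I σ t := by
  have hmerge : ∀ σ, mergeLen I σ t = 0 := fun σ => by
    rw [mergeLen]
    exact Finset.sum_eq_zero fun u _ => by rw [hI u, NNReal.coe_zero]
  have hsize : size I (linearAlgorithm.schedule I) t = 1 := by
    cases t with
    | zero => exact size_zero I _ ht
    | succ t =>
      rw [size_succ I _ ht, schedule_linearAlgorithm I ht, mergeCount, if_pos fun u _ => hI u]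
      have := size_le I (linearAlgorithm.schedule I) (t := t) (by omega)
      omega
  rw [stepCost, hmerge, hmerge, hsize]
  have : (1 : ℝ) ≤ size I σ t := by exact_mod_cast one_le_size I σ ht
  have h0 : (0 : ℝ) ≤ rate I t := NNReal.coe_nonneg _
  push_cast
  nlinarith

lemma stepCost_le_of_rate_eq_zero {n : ℕ} {I : Fin n → Request} (hI : ∀ u, rate I u = 0)
    (σ : Schedule n) {t : ℕ} (ht : t < n) :
    stepCost I t ≤ mergeLen I σ t + rate I t * size I σ t := by
  rw [stepCost, hI, NNReal.coe_zero, zero_mul, zero_mul, add_zero, add_zero]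
  refine le_trans ?_ (len_le_mergeLen I σ t)
  by_cases hz : ∀ u ≤ t, len I u = 0
  · rw [mergeLen, Finset.sum_eq_zero fun u hu => ?_]
    · exact NNReal.coe_nonneg _
    · rw [hz u (mem_topFile.mp hu).1, NNReal.coe_zero]
  · have htop : topFile (size I (linearAlgorithm.schedule I)) t ⊆ {t} := by
      intro u hu
      rw [mem_topFile] at hu
      rw [Finset.mem_singleton]
      by_contra hne
      obtain ⟨t, rfl⟩ : ∃ s, t = s + 1 := ⟨t - 1, by omega⟩
      have h1 := hu.2 t (by omega) (by omega)
      rw [size_succ I _ ht, schedule_linearAlgorithm I ht, mergeCount, if_neg hz,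
        if_pos fun u _ => hI u] at h1
      omega
    calc mergeLen I (linearAlgorithm.schedule I) t ≤ ∑ u ∈ {t}, (len I u : ℝ) :=
          Finset.sum_le_sum_of_subset_of_nonneg htop fun _ _ _ => NNReal.coe_nonneg _
      _ = len I t := Finset.sum_singleton _ _

section
variable {p : Measure Request} [IsProbabilityMeasure p]

lemma BoundedBy.ae_coord_eq_zero {ψ : Request → ℝ} {M : ℝ} (h : BoundedBy p ψ M)
    (h0 : ∫ z, ψ z ∂p = 0) (n : ℕ) : ∀ᵐ I : Fin n → Request ∂(iid p n), ∀ u, coord ψ I u = 0 := by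
  have hint : Integrable ψ p := by
    refine Integrable.of_bound h.measurable.aestronglyMeasurable M ?_
    filter_upwards [h.le] with z hz
    rwa [Real.norm_of_nonneg (h.nonneg z)]
  have hae := (integral_eq_zero_iff_of_nonneg h.nonneg hint).mp h0
  have hz : BoundedBy p ψ 0 := ⟨h.measurable, h.nonneg, hae.mono fun z hz => hz.le⟩
  filter_upwards [hz.ae_coord_le le_rfl n] with I hI u
  exact le_antisymm (hI u) (hz.coord_nonneg I u)

lemma expectedCost_linearAlgorithm_eq_opt (hp : IsBoundedDist p)
    (h : meanLength p = 0 ∨ meanRate p = 0) :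
    expectedCost linearAlgorithm fLinear p = expectedOpt fLinear p := by
  obtain ⟨M, hM, hl, hr⟩ := hp.exists_boundedBy
  funext n
  refine integral_congr_ae ?_
  rcases h with h | h
  · filter_upwards [hl.ae_coord_eq_zero h n] with I hI
    refine toReal_opt_eq_of_le fun σ t ht => stepCost_le_of_len_eq_zero (fun u => ?_) σ ht
    rw [← NNReal.coe_eq_zero, coe_len, hI u]
  · filter_upwards [hr.ae_coord_eq_zero h n] with I hI
    refine toReal_opt_eq_of_le fun σ t ht => stepCost_le_of_rate_eq_zero (fun u => ?_) σ ht
    rw [← NNReal.coe_eq_zero, coe_rate_eq, hI u]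

/-! ### Asymptotic optimality of the linear algorithm -/

lemma linearAlgorithm_equivalents (hp : IsBoundedDist p) (hx : 0 < meanLength p)
    (hy : 0 < meanRate p) {β : ℝ} (hβ : SolvesKraft (meanLength p) (meanRate p) β) :
    expectedCost linearAlgorithm fLinear p ~[atTop] expectedOpt fLinear p ∧
      expectedOpt fLinear p ~[atTop] fun n : ℕ => β * n * Real.logb 2 n := by
  refine isEquivalent_of_squeeze ?_
    (fun n => expectedOpt_le (fun I => cost_fLinear_ne_top I _)
      (integrable_algCost_fLinear hp measurable_linearAlgorithm n))
    (fun η hη => expectedOpt_fLinear_lower hp hx hy hβ hη)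
    (fun η hη => expectedCost_linearAlgorithm_upper hp hx hy hβ hη)
  filter_upwards [eventually_ge_atTop 2] with n hn
  have hn0 : (1 : ℝ) < n := by exact_mod_cast hn
  have := Real.logb_pos one_lt_two hn0
  have := hβ.1
  positivity

/-- The linear algorithm is asymptotically optimal for every bounded distribution. -/
theorem linearAlgorithm_spec (hp : IsBoundedDist p) :
    AsymptoticallyOneCompetitive linearAlgorithm fLinear p := by
  refine ⟨integrable_algCost_fLinear hp measurable_linearAlgorithm, integrable_opt_fLinear hp, ?_⟩
  rcases (meanLength_nonneg p).eq_or_lt with hx | hx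
  · rw [expectedCost_linearAlgorithm_eq_opt hp (Or.inl hx.symm)]
  rcases (meanRate_nonneg p).eq_or_lt with hy | hy
  · rw [expectedCost_linearAlgorithm_eq_opt hp (Or.inr hy.symm)]
  obtain ⟨β, hβ, -⟩ := exists_solvesKraft hx hy
  exact (linearAlgorithm_equivalents hp hx hy hβ).1

end

end BMC

theorem theorem5 :
    -- the problem with at most `K` levels
    (∀ K : ℕ, 1 ≤ K → ∃ A : BMC.OnlineAlgorithm,
      (∀ t, Measurable (A t)) ∧
      (∀ (n : ℕ) (I : Fin n → BMC.Request), A.cost (BMC.fLevels K) I ≠ ⊤) ∧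
      ∀ (p : Measure BMC.Request) [IsProbabilityMeasure p], BMC.IsBoundedDist p →
        BMC.AsymptoticallyOneCompetitive A (BMC.fLevels K) p ∧
        BMC.expectedOpt (BMC.fLevels K) p ~[atTop] fun n : ℕ =>
          BMC.meanLength p * K * (n : ℝ) ^ (1 + 1 / (K : ℝ)) / BMC.levelConst K) ∧
    Tendsto BMC.levelConst atTop (𝓝 (Real.exp 1)) ∧
    -- the linear problem
    (∃ B : BMC.OnlineAlgorithm,
      (∀ t, Measurable (B t)) ∧
      ∀ (p : Measure BMC.Request) [IsProbabilityMeasure p], BMC.IsBoundedDist p →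
        BMC.AsymptoticallyOneCompetitive B BMC.fLinear p) ∧
    (∃ c C : ℝ, 0 < c ∧ 0 < C ∧
      ∀ (p : Measure BMC.Request) [IsProbabilityMeasure p], BMC.IsBoundedDist p →
        0 < BMC.meanLength p → 0 < BMC.meanRate p →
        ∃ β : ℝ, BMC.SolvesKraft (BMC.meanLength p) (BMC.meanRate p) β ∧
          (∀ β' : ℝ, BMC.SolvesKraft (BMC.meanLength p) (BMC.meanRate p) β' → β' = β) ∧
          (BMC.expectedOpt BMC.fLinear p ~[atTop] fun n : ℕ => β * n * Real.logb 2 n) ∧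
          c * ((BMC.meanLength p + BMC.meanRate p) /
            Real.log (1 + max (BMC.meanLength p / BMC.meanRate p)
              (BMC.meanRate p / BMC.meanLength p))) ≤ β ∧
          β ≤ C * ((BMC.meanLength p + BMC.meanRate p) /
            Real.log (1 + max (BMC.meanLength p / BMC.meanRate p)
              (BMC.meanRate p / BMC.meanLength p)))) := by

  refine ⟨fun K hK => ⟨BMC.levelAlgorithm K, fun t => measurable_const, fun n I => ?_,
      fun p _ hp => BMC.levelAlgorithm_spec hp hK⟩, BMC.tendsto_levelConst,
    ⟨BMC.linearAlgorithm, BMC.measurable_linearAlgorithm, fun p _ hp =>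
      BMC.linearAlgorithm_spec hp⟩,
    ⟨Real.log 2 / 4, 2 * Real.log 2, ?_, ?_, fun p _ hp hx hy => ?_⟩⟩
  · rw [BMC.cost_levelAlgorithm hK]
    exact ENNReal.ofReal_ne_top
  · have := Real.log_pos one_lt_two
    positivity
  · have := Real.log_pos one_lt_two
    positivity
  · obtain ⟨β, hβ, hlo, hhi⟩ := BMC.exists_solvesKraft hx hy
    exact ⟨β, hβ, fun β' hβ' => hβ.unique hβ' hx hy,
      (BMC.linearAlgorithm_equivalents hp hx hy hβ).2, hlo, hhi⟩
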